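/- **Setting.** Let $n\ge 1$ and order $\mathbb Z^n$ by the right lexicographic order: $a<b$ iff for some $i$ one has $a_i<b_i$ and $a_j=b_j$ for all $j>i$. Write $1=(1,0,\dots,0)$ for the least positive element, and for $k<n$ regard $\mathbb Z^k\subset\mathbb Z^n$ as the subgroup of elements whose last $n-k$ coordinates are $0$. Let $X$ be a set and $X^{\pm}=X\sqcup X^{-1}$. *Words.* A $\mathbb Z^n$-word is a function $w:[1,|w|]\to X^{\pm}$ with $|w|\in\mathbb Z^n$, $|w|\ge 0$; concatenation is defined in the obvious way and $w^{-1}(\beta)=w(|w|+1-\beta)^{-1}$. A word is reduced if $w(\beta+1)\ne w(\beta)^{-1}$ for $1\le\beta<|w|$; $R(\mathbb Z^n,X)$ is the set of reduced words, and $u\circ v$ denotes the concatenation of $u,v\in R(\mathbb Z^n,X)$ when it is reduced. For reduced $u,v$, $\operatorname{com}(u,v)$, if it exists, is the word $a$ with $u=a\circ u'$, $v=a\circ v'$, where $u',v'$ have no common first letter; put $c(u,v)=|\operatorname{com}(u,v)|$. The product $u*v$ is defined when $a=\operatorname{com}(u^{-1},v)$ exists: if $u^{-1}=a\circ u'$ and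 $v=a\circ v'$, then $u*v=u'^{-1}\circ v'$. $CDR(\mathbb Z^n,X)$ is the set of reduced words of the form $c^{-1}\circ u\circ c$ with $u$ reduced and either empty or satisfying $u(1)^{-1}\ne u(|u|)$. A subgroup of $CDR(\mathbb Z^n,X)$ is a subset closed under inversion on which $*$ is everywhere defined and which is a group under $*$. A subgroup $G$ is irreducible if there are no $k<n$ and $r\in R(\mathbb Z^n,X)$ such that all products $(r*g)*r^{-1}$, $g\in G$, are defined and $g\mapsto (r*g)*r^{-1}$ is an isomorphism of $G$ onto a subgroup of $CDR(\mathbb Z^n,X)$ all of whose elements have length in $\mathbb Z^k$. *The tree and its ends.* Let $G$ be a subgroup of $CDR(\mathbb Z^n,X)$. The universal $\mathbb Z^n$-tree $\Gamma_G$ is the quotient of $\{(\alpha,g): g\in G,\ 0\le\alpha\le|g|\}$ by the relation $(\alpha,f)\sim(\beta,g)\iff\alpha=\beta\le c(f,g)$, with base point $\varepsilon=\langle 0,1\rangle$ and $\mathbb Z^n$-valued metric $d(\langle\alpha,f\rangle,\langle\beta,g\rangle)=\alpha+\beta-2\min\{\alpha,\beta,c(f,g)\}$. The group $G$ acts on it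 by isometries: $f\cdot\langle\alpha,g\rangle$ equals $\langle|f|-\alpha,f\rangle$ if $\alpha\le c(f^{-1},g)$ and $\langle|f|+\alpha-2c(f^{-1},g),f*g\rangle$ otherwise. Let $\partial_n\Gamma_G$ be the set of ends of $\mathbb Z^n$-type, that is, of isometries $\{\alpha\in\mathbb Z^n:\alpha\ge0\}\to\Gamma_G$ (rays), two rays being identified if they share a common tail. It carries the induced action of $G$ and the topology generated by the cones $U_x$, $x\in\Gamma_G$, where $U_x$ consists of the ends represented by a ray that starts at $\varepsilon$ and contains the segment $[\varepsilon,x]$. *Stationary measures and boundaries.* Let $\mu$ be a probability measure on the discrete countable group $G$; it is non-degenerate if its support generates $G$ as a semigroup. Let $P_\mu$ be the law of the random walk $\tau=(\tau_i)_{i\ge0}$ with $\tau_0=1$ and independent increments $\tau_i^{-1}\tau_{i+1}$ of law $\mu$. If $G$ acts by homeomorphisms on a topological space $M$, a Borel probability measure $\nu$ on $M$ is $\mu$-stationary if $\sum_{g\in G}\mu(g)\,g\cdot\nu=\nu$, where $(g\cdot\nu)(E)=\nu(g^{-1}E)$. For $\mu$-stationary $\nu$, the pair $(M,\nu)$ is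 a $\mu$-boundary if for $P_\mu$-a.e. $\tau$ the measures $\tau_i\cdot\nu$ converge weakly (against bounded continuous functions) to a Dirac measure $\delta_{\omega(\tau)}$ with $\omega(\tau)\in M$. **Statement.** Let $G$ be a finitely generated, non-abelian, irreducible subgroup of $CDR(\mathbb Z^n,X)$ and let $\mu$ be a non-degenerate probability measure on $G$. Then $G$ acts on $\partial_n\Gamma_G$ by homeomorphisms, and there is exactly one $\mu$-stationary Borel probability measure $\nu_\mu$ on $\partial_n\Gamma_G$. This measure is regular and continuous (every point has $\nu_\mu$-measure $0$), and $(\partial_n\Gamma_G,\nu_\mu)$ is a $\mu$-boundary of $G$. (Compactness of $\partial_n\Gamma_G$ is not assumed.) -/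

import Mathlib

open MeasureTheory Filter Topology

namespace ZnFree

/-! ## The ordered group `ℤⁿ` -/

/-- `ℤⁿ` with the right lexicographic order: `a < b` iff there is `i` with `a i < b i` and
`a j = b j` for all `j > i`. -/
def ZVec (n : ℕ) : Type := Colex (Fin n → ℤ)

namespace ZVec

noncomputable instance (n : ℕ) : AddCommGroup (ZVec n) :=
  inferInstanceAs (AddCommGroup (Colex (Fin n → ℤ)))

noncomputable instance (n : ℕ) : LinearOrder (ZVec n) :=
  inferInstanceAs (LinearOrder (Colex (Fin n → ℤ)))

/-- The coordinates of an element of `ℤⁿ`. -/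
def coord {n : ℕ} (a : ZVec n) : Fin n → ℤ := ofColex a

theorem lt_iff {n : ℕ} (a b : ZVec n) :
    a < b ↔ ∃ i, (∀ j, i < j → a.coord j = b.coord j) ∧ a.coord i < b.coord i := Iff.rfl

theorem coord_add {n : ℕ} (a b : ZVec n) : (a + b).coord = a.coord + b.coord := rfl

theorem coord_zero {n : ℕ} : (0 : ZVec n).coord = 0 := rfl

instance (n : ℕ) : IsOrderedAddMonoid (ZVec n) where
  add_le_add_left a b h c := by
    rcases h.eq_or_lt with rfl | h
    · exact le_rfl
    · obtain ⟨i, hi, hlt⟩ := (lt_iff a b).1 h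
      refine le_of_lt ((lt_iff _ _).2 ⟨i, fun j hj => ?_, ?_⟩)
      · rw [coord_add, coord_add, Pi.add_apply, Pi.add_apply, hi j hj]
      · rw [coord_add, coord_add, Pi.add_apply, Pi.add_apply]
        linarith

/-- The element `(1, 0, …, 0)` of `ℤⁿ`. -/
def one (n : ℕ) [NeZero n] : ZVec n := toColex (Pi.single 0 1)

theorem coord_one_zero (n : ℕ) [NeZero n] : (one n).coord 0 = 1 :=
  Pi.single_eq_same (M := fun _ : Fin n => ℤ) 0 1

theorem coord_one_ne {n : ℕ} [NeZero n] {j : Fin n} (hj : j ≠ 0) : (one n).coord j = 0 :=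
  Pi.single_eq_of_ne (M := fun _ : Fin n => ℤ) hj 1

theorem one_pos (n : ℕ) [NeZero n] : 0 < one n := by
  refine (lt_iff _ _).2 ⟨0, fun j hj => ?_, ?_⟩
  · rw [coord_one_ne (ne_of_gt hj), coord_zero, Pi.zero_apply]
  · rw [coord_one_zero, coord_zero, Pi.zero_apply]
    exact Int.one_pos

/-- `ℤⁿ` is discretely ordered, with least positive element `(1, 0, …, 0)`. -/
theorem one_le_of_pos {n : ℕ} [NeZero n] {a : ZVec n} (h : 0 < a) : one n ≤ a := by
  obtain ⟨i, hi, hlt⟩ := (lt_iff 0 a).1 h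
  rw [coord_zero, Pi.zero_apply] at hlt
  have hz : ∀ j, i < j → a.coord j = 0 := fun j hj => (hi j hj).symm
  by_contra hlt'
  obtain ⟨k, hk, hklt⟩ := (lt_iff a (one n)).1 (not_le.1 hlt')
  have hki : i ≤ k := by
    by_contra hki
    have h1 := hk i (not_le.1 hki)
    rw [coord_one_ne (ne_of_gt (lt_of_le_of_lt (Fin.zero_le k) (not_le.1 hki)))] at h1
    omega
  by_cases hk0 : k = 0
  · have hi0 : i = 0 := le_antisymm (hk0 ▸ hki) (Fin.zero_le i)
    rw [hk0, coord_one_zero] at hklt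
    rw [hi0] at hlt
    omega
  · rw [coord_one_ne hk0] at hklt
    rcases hki.eq_or_lt with h1 | h1
    · rw [h1] at hlt
      omega
    · rw [hz k h1] at hklt
      omega

/-- The convex subgroup `ℤᵏ ⊆ ℤⁿ` (the last `n - k` coordinates vanish). -/
def InSub {n : ℕ} (k : ℕ) (a : ZVec n) : Prop := ∀ i : Fin n, k ≤ (i : ℕ) → a.coord i = 0

end ZVec

/-! ## Infinite words -/

/-- The inverse of a letter of `X^± = X ⊔ X⁻¹`; `(x, true)` stands for `x`, `(x, false)` for
`x⁻¹`. -/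
def letterInv {X : Type*} (x : X × Bool) : X × Bool := (x.1, !x.2)

/-- A `ℤⁿ`-word over `X`: a function `[1, len] → X^±` with `len ≥ 0`, encoded as a partial function
on `ℤⁿ` whose domain is exactly `[1, len]`. -/
@[ext]
structure ZWord (n : ℕ) [NeZero n] (X : Type*) where
  len : ZVec n
  letter : ZVec n → Option (X × Bool)
  len_nonneg : 0 ≤ len
  isSome_iff : ∀ β, (letter β).isSome ↔ ZVec.one n ≤ β ∧ β ≤ len

namespace ZWord

variable {n : ℕ} [NeZero n] {X : Type*}

/-- Concatenation `uv`. -/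
noncomputable def concat (u v : ZWord n X) : ZWord n X where
  len := u.len + v.len
  letter β := if β ≤ u.len then u.letter β else v.letter (β - u.len)
  len_nonneg := add_nonneg u.len_nonneg v.len_nonneg
  isSome_iff β := by
    have hu := u.len_nonneg
    have hv := v.len_nonneg
    split_ifs with h
    · rw [u.isSome_iff]
      grind
    · rw [v.isSome_iff]
      have h1 : ZVec.one n ≤ β - u.len := ZVec.one_le_of_pos (by grind)
      grind

/-- The inverse word `u⁻¹(β) = u(|u| + 1 - β)⁻¹`. -/
noncomputable def inv (u : ZWord n X) : ZWord n X where
  len := u.len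
  letter β := (u.letter (u.len + ZVec.one n - β)).map letterInv
  len_nonneg := u.len_nonneg
  isSome_iff β := by
    rw [Option.isSome_map, u.isSome_iff]
    grind

theorem inv_inv (u : ZWord n X) : u.inv.inv = u := by
  refine ZWord.ext rfl (funext fun β => ?_)
  have h : u.len + ZVec.one n - (u.len + ZVec.one n - β) = β := by grind
  change Option.map letterInv (Option.map letterInv
    (u.letter (u.len + ZVec.one n - (u.len + ZVec.one n - β)))) = u.letter β
  rw [h, Option.map_map]
  have h2 : (letterInv ∘ letterInv : X × Bool → X × Bool) = id := by
    funext x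
    simp [letterInv]
  rw [h2, Option.map_id, id]

/-- Reduced words: `u(β + 1) ≠ u(β)⁻¹` for `1 ≤ β < |u|`. -/
def Reduced (u : ZWord n X) : Prop :=
  ∀ β, ZVec.one n ≤ β → β < u.len → u.letter (β + ZVec.one n) ≠ (u.letter β).map letterInv

/-- `w = u ∘ v`: the words `u`, `v` are reduced, `w = uv`, and `w` is reduced. -/
def IsCirc (w u v : ZWord n X) : Prop :=
  u.Reduced ∧ v.Reduced ∧ w.Reduced ∧ w = concat u v

/-- The words `u`, `v` do not start with the same letter (in particular if one of them is
empty). -/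
def NoCommonStart (u v : ZWord n X) : Prop :=
  ∀ x, ¬ (u.letter (ZVec.one n) = some x ∧ v.letter (ZVec.one n) = some x)

/-- `w = com(u, v)` is the longest common initial segment of `u` and `v`. -/
def IsCom (u v w : ZWord n X) : Prop :=
  ∃ u' v', IsCirc u w u' ∧ IsCirc v w v' ∧ NoCommonStart u' v'

/-- `u * v` is defined and equal to `w`: one has `u⁻¹ = a ∘ u'`, `v = a ∘ v'` with
`a = com(u⁻¹, v)`, and `w = u'⁻¹ ∘ v'`. -/
def IsProd (u v w : ZWord n X) : Prop :=
  ∃ a u' v', IsCirc u.inv a u' ∧ IsCirc v a v' ∧ NoCommonStart u' v' ∧ IsCirc w u'.inv v'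

/-- Cyclically reduced words: reduced words `v` with `v(1)⁻¹ ≠ v(|v|)` (no condition if `v` is
empty). -/
def CyclicallyReduced (v : ZWord n X) : Prop :=
  v.Reduced ∧ (0 < v.len → (v.letter (ZVec.one n)).map letterInv ≠ v.letter v.len)

/-- Membership in `CDR(ℤⁿ, X)`: `v` is reduced and `v = c⁻¹ ∘ u ∘ c` with `u` cyclically reduced. -/
def IsCDR (v : ZWord n X) : Prop :=
  ∃ c u t, u.CyclicallyReduced ∧ IsCirc t u c ∧ IsCirc v c.inv t

open Classical in
/-- `c(u, v) = |com(u, v)|` (used only when `com(u, v)` exists). -/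
noncomputable def comLen (u v : ZWord n X) : ZVec n :=
  if h : ∃ w, IsCom u v w then h.choose.len else 0

theorem IsCom.le_iff {u v w : ZWord n X} (h : IsCom u v w) (α : ZVec n) :
    α ≤ w.len ↔ α ≤ u.len ∧ α ≤ v.len ∧
      ∀ β, ZVec.one n ≤ β → β ≤ α → u.letter β = v.letter β := by
  obtain ⟨u', v', ⟨-, -, -, hu⟩, ⟨-, -, -, hv⟩, hne⟩ := h
  have hul : u.len = w.len + u'.len := by rw [hu]; rfl
  have hvl : v.len = w.len + v'.len := by rw [hv]; rfl
  have hu0 := u'.len_nonneg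
  have hv0 := v'.len_nonneg
  have hw0 := w.len_nonneg
  have hpos := ZVec.one_pos n
  constructor
  · intro hα
    refine ⟨by grind, by grind, fun β _ hβ => ?_⟩
    have hβw : β ≤ w.len := hβ.trans hα
    rw [hu, hv]
    simp [concat, hβw]
  · rintro ⟨h1, h2, h3⟩
    by_contra hlt
    have hstep : ZVec.one n ≤ α - w.len := ZVec.one_le_of_pos (by grind)
    have hnot : ¬ (w.len + ZVec.one n ≤ w.len) := by grind
    have e : w.len + ZVec.one n - w.len = ZVec.one n := by grind
    have h4 := h3 (w.len + ZVec.one n) (by grind) (by grind)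
    have hul' : u.letter (w.len + ZVec.one n) = u'.letter (ZVec.one n) := by
      rw [hu]; simp only [concat]; rw [if_neg hnot, e]
    have hvl' : v.letter (w.len + ZVec.one n) = v'.letter (ZVec.one n) := by
      rw [hv]; simp only [concat]; rw [if_neg hnot, e]
    obtain ⟨x, hx⟩ := Option.isSome_iff_exists.1
      ((u'.isSome_iff (ZVec.one n)).2 ⟨le_rfl, by grind⟩)
    exact hne x ⟨hx, by rw [← hvl', ← h4, hul', hx]⟩

theorem comLen_eq {u v w : ZWord n X} (h : IsCom u v w) : comLen u v = w.len := by
  have hex : ∃ w, IsCom u v w := ⟨w, h⟩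
  have h1 : comLen u v = hex.choose.len := dif_pos hex
  rw [h1]
  exact le_antisymm ((h.le_iff _).2 ((hex.choose_spec.le_iff _).1 le_rfl))
    ((hex.choose_spec.le_iff _).2 ((h.le_iff _).1 le_rfl))

end ZWord

/-- A group `G` realized as a subgroup of `CDR(ℤⁿ, X)`: an injective map into `CDR(ℤⁿ, X)` for which
all products `g * h` of images are defined, compatible with products and inverses. -/
structure WordEmbedding (n : ℕ) [NeZero n] (X G : Type*) [Group G] where
  toWord : G → ZWord n X
  injective : Function.Injective toWord
  isCDR : ∀ g, (toWord g).IsCDR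
  map_mul : ∀ g h, ZWord.IsProd (toWord g) (toWord h) (toWord (g * h))
  map_inv : ∀ g, toWord g⁻¹ = (toWord g).inv

namespace WordEmbedding

variable {n : ℕ} [NeZero n] {X G : Type*} [Group G]

/-- `G` is irreducible: there is no `k < n` and no reduced word `r` such that `G` is conjugate by
`r` in `R(ℤⁿ, X)` to a subgroup `H` of `CDR(ℤᵏ, X)`. -/
def Irreducible (φ : WordEmbedding n X G) : Prop :=
  ¬ ∃ k < n, ∃ r : ZWord n X, r.Reduced ∧ ∃ ψ : WordEmbedding n X G,
    (∀ g, (ψ.toWord g).len.InSub k) ∧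
    ∀ g, ∃ w, ZWord.IsProd r (φ.toWord g) w ∧ ZWord.IsProd w r.inv (ψ.toWord g)

variable (φ : WordEmbedding n X G)

/-- The length `|g|`. -/
def len (g : G) : ZVec n := (φ.toWord g).len

/-- `c(f, g) = |com(f, g)|`. -/
noncomputable def c (f g : G) : ZVec n := ZWord.comLen (φ.toWord f) (φ.toWord g)

theorem exists_isCom (f g : G) : ∃ w, ZWord.IsCom (φ.toWord f) (φ.toWord g) w ∧
    φ.len (f⁻¹ * g) = φ.len f + φ.len g - (w.len + w.len) := by
  obtain ⟨a, u', v', h1, h2, h3, h4⟩ := φ.map_mul f⁻¹ g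
  rw [φ.map_inv, ZWord.inv_inv] at h1
  refine ⟨a, ⟨u', v', h1, h2, h3⟩, ?_⟩
  have e1 : φ.len f = a.len + u'.len := by rw [len, h1.2.2.2]; rfl
  have e2 : φ.len g = a.len + v'.len := by rw [len, h2.2.2.2]; rfl
  have e3 : φ.len (f⁻¹ * g) = u'.len + v'.len := by rw [len, h4.2.2.2]; rfl
  grind

theorem two_c (f g : G) : φ.c f g + φ.c f g = φ.len f + φ.len g - φ.len (f⁻¹ * g) := by
  obtain ⟨w, hw, h⟩ := φ.exists_isCom f g
  rw [c, ZWord.comLen_eq hw, h]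
  grind

theorem le_c_iff (f g : G) (α : ZVec n) : α ≤ φ.c f g ↔ α ≤ φ.len f ∧ α ≤ φ.len g ∧
    ∀ β, ZVec.one n ≤ β → β ≤ α → (φ.toWord f).letter β = (φ.toWord g).letter β := by
  obtain ⟨w, hw, -⟩ := φ.exists_isCom f g
  rw [c, ZWord.comLen_eq hw]
  exact hw.le_iff α

theorem c_nonneg (f g : G) : 0 ≤ φ.c f g := by
  obtain ⟨w, hw, -⟩ := φ.exists_isCom f g
  rw [c, ZWord.comLen_eq hw]
  exact w.len_nonneg

theorem len_nonneg (g : G) : 0 ≤ φ.len g := (φ.toWord g).len_nonneg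

theorem len_inv (g : G) : φ.len g⁻¹ = φ.len g := by
  rw [len, φ.map_inv]; rfl

theorem c_comm (f g : G) : φ.c f g = φ.c g f :=
  le_antisymm
    ((φ.le_c_iff _ _ _).2 (by
      obtain ⟨h1, h2, h3⟩ := (φ.le_c_iff f g _).1 le_rfl
      exact ⟨h2, h1, fun β h h' => (h3 β h h').symm⟩))
    ((φ.le_c_iff _ _ _).2 (by
      obtain ⟨h1, h2, h3⟩ := (φ.le_c_iff g f _).1 le_rfl
      exact ⟨h2, h1, fun β h h' => (h3 β h h').symm⟩))

theorem c_self (g : G) : φ.c g g = φ.len g :=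
  le_antisymm ((φ.le_c_iff g g _).1 le_rfl).1
    ((φ.le_c_iff g g _).2 ⟨le_rfl, le_rfl, fun _ _ _ => rfl⟩)

theorem c_le_left (f g : G) : φ.c f g ≤ φ.len f := ((φ.le_c_iff f g _).1 le_rfl).1

theorem c_le_right (f g : G) : φ.c f g ≤ φ.len g := ((φ.le_c_iff f g _).1 le_rfl).2.1

theorem le_c_trans {f g h : G} {α : ZVec n} (h1 : α ≤ φ.c f g) (h2 : α ≤ φ.c g h) :
    α ≤ φ.c f h := by
  rw [le_c_iff] at *
  exact ⟨h1.1, h2.2.1, fun β hβ hα => (h1.2.2 β hβ hα).trans (h2.2.2 β hβ hα)⟩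

theorem len_one : φ.len 1 = 0 := by
  have h := φ.two_c 1 1
  rw [c_self, inv_one, one_mul] at h
  grind

/-! ## The universal tree -/

/-- `S_G = {(α, g) | g ∈ G, α ∈ [0, |g|]}`. -/
structure PrePoint where
  pos : ZVec n
  elt : G
  pos_nonneg : 0 ≤ pos
  pos_le : pos ≤ φ.len elt

/-- `(α, f) ∼ (β, g)` iff `α = β ∈ [0, c(f, g)]`. -/
instance treeSetoid : Setoid φ.PrePoint where
  r p q := p.pos = q.pos ∧ p.pos ≤ φ.c p.elt q.elt
  iseqv :=
    { refl := fun p => ⟨rfl, by rw [c_self]; exact p.pos_le⟩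
      symm := fun {p q} h => ⟨h.1.symm, by rw [c_comm, ← h.1]; exact h.2⟩
      trans := fun {p q r} h h' =>
        ⟨h.1.trans h'.1, φ.le_c_trans h.2 (by rw [h.1]; exact h'.2)⟩ }

/-- The universal `ℤⁿ`-tree `Γ_G = S_G / ∼`. -/
def Tree : Type _ := Quotient φ.treeSetoid

/-- The point `⟨α, g⟩` of `Γ_G`. -/
def mkPoint (p : φ.PrePoint) : φ.Tree := Quotient.mk φ.treeSetoid p

/-- The base point `ε = ⟨0, 1⟩`. -/
noncomputable def basePoint : φ.Tree := φ.mkPoint ⟨0, 1, le_rfl, φ.len_nonneg 1⟩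

/-- `d(⟨α, f⟩, ⟨β, g⟩) = α + β - 2 min{α, β, c(f, g)}` on representatives. -/
noncomputable def preDist (p q : φ.PrePoint) : ZVec n :=
  p.pos + q.pos - 2 • min (min p.pos q.pos) (φ.c p.elt q.elt)

theorem preDist_comm (p q : φ.PrePoint) : φ.preDist p q = φ.preDist q p := by
  rw [preDist, preDist, c_comm, add_comm, min_comm p.pos]

theorem preDist_congr_left {p p' : φ.PrePoint} (h : p ≈ p') (q : φ.PrePoint) :
    φ.preDist p q = φ.preDist p' q := by
  obtain ⟨h1, h2⟩ := h
  have h2' : p.pos ≤ φ.c p'.elt p.elt := by rw [c_comm]; exact h2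
  have key : min p.pos (φ.c p.elt q.elt) = min p.pos (φ.c p'.elt q.elt) := by
    refine le_antisymm (le_min (min_le_left _ _) ?_) (le_min (min_le_left _ _) ?_)
    · exact φ.le_c_trans ((min_le_left _ _).trans h2') (min_le_right _ _)
    · exact φ.le_c_trans ((min_le_left _ _).trans h2) (min_le_right _ _)
  rw [preDist, preDist, ← h1, min_right_comm, key, min_right_comm]

theorem preDist_congr {p q p' q' : φ.PrePoint} (h : p ≈ p') (h' : q ≈ q') :
    φ.preDist p q = φ.preDist p' q' := by
  rw [φ.preDist_congr_left h, preDist_comm, φ.preDist_congr_left h', preDist_comm]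

/-- The `ℤⁿ`-metric of `Γ_G`. -/
noncomputable def dist (x y : φ.Tree) : ZVec n :=
  Quotient.liftOn₂ x y φ.preDist fun _ _ _ _ h h' => φ.preDist_congr h h'

/-- The action of `G` on representatives: `f · ⟨α, g⟩` is `⟨|f| - α, f⟩` if `α ≤ c(f⁻¹, g)`, and
`⟨|f| + α - 2 c(f⁻¹, g), f * g⟩` otherwise. -/
noncomputable def preAct (f : G) (p : φ.PrePoint) : φ.PrePoint :=
  if h : p.pos ≤ φ.c f⁻¹ p.elt then
    { pos := φ.len f - p.pos
      elt := f
      pos_nonneg := by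
        have := φ.c_le_left f⁻¹ p.elt
        rw [len_inv] at this
        grind
      pos_le := by
        have := p.pos_nonneg
        grind }
  else
    { pos := φ.len f + p.pos - 2 • φ.c f⁻¹ p.elt
      elt := f * p.elt
      pos_nonneg := by
        have := φ.c_le_left f⁻¹ p.elt
        rw [len_inv] at this
        grind
      pos_le := by
        have h1 := φ.two_c f⁻¹ p.elt
        have h2 := p.pos_le
        rw [_root_.inv_inv, len_inv] at h1
        grind }

/-- The distance from a point of `Γ_G` to the orbit point `h · ε = ⟨|h|, h⟩`. -/
noncomputable def orbDist (p : φ.PrePoint) (h : G) : ZVec n :=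
  p.pos + φ.len h - 2 • min p.pos (φ.c p.elt h)

theorem orbDist_preAct (f : G) (p : φ.PrePoint) (h : G) :
    φ.orbDist (φ.preAct f p) h = φ.orbDist p (f⁻¹ * h) := by
  have e1 := φ.two_c f h
  have e2 := φ.two_c f⁻¹ (f⁻¹ * h)
  rw [len_inv, _root_.inv_inv, mul_inv_cancel_left] at e2
  have hp0 := p.pos_nonneg
  have hp1 := p.pos_le
  -- ultrametric inequalities for the triple `f⁻¹`, `p.elt`, `f⁻¹ * h`
  have u1 : min (φ.c f⁻¹ p.elt) (φ.c p.elt (f⁻¹ * h)) ≤ φ.c f⁻¹ (f⁻¹ * h) :=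
    φ.le_c_trans (min_le_left _ _) (min_le_right _ _)
  have u2 : min (φ.c f⁻¹ p.elt) (φ.c f⁻¹ (f⁻¹ * h)) ≤ φ.c p.elt (f⁻¹ * h) :=
    φ.le_c_trans (by rw [φ.c_comm p.elt]; exact min_le_left _ _) (min_le_right _ _)
  have u3 : min (φ.c p.elt (f⁻¹ * h)) (φ.c f⁻¹ (f⁻¹ * h)) ≤ φ.c f⁻¹ p.elt :=
    φ.le_c_trans (min_le_right _ _) (by rw [φ.c_comm _ p.elt]; exact min_le_left _ _)
  unfold preAct orbDist
  split_ifs with hc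
  · dsimp only
    have hsum : φ.c f h = φ.len f - φ.c f⁻¹ (f⁻¹ * h) := by grind
    have hmin : min p.pos (φ.c p.elt (f⁻¹ * h)) = min p.pos (φ.c f⁻¹ (f⁻¹ * h)) := by grind
    rw [hmin, hsum]
    grind
  · dsimp only
    have e3 := φ.two_c (f * p.elt) h
    have e4 := φ.two_c p.elt (f⁻¹ * h)
    have e5 := φ.two_c f⁻¹ p.elt
    rw [mul_inv_rev, mul_assoc] at e3
    rw [_root_.inv_inv, len_inv] at e5
    have hsum : φ.c (f * p.elt) h = φ.len f - φ.c f⁻¹ (f⁻¹ * h) - φ.c f⁻¹ p.elt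
        + φ.c p.elt (f⁻¹ * h) := by grind
    rw [hsum]
    grind

theorem equiv_iff_orbDist (p q : φ.PrePoint) : p ≈ q ↔ ∀ h, φ.orbDist p h = φ.orbDist q h := by
  constructor
  · rintro ⟨h1, h2⟩ h
    have h2' : p.pos ≤ φ.c q.elt p.elt := by rw [c_comm]; exact h2
    have h3 : min p.pos (φ.c p.elt h) = min p.pos (φ.c q.elt h) := by
      refine le_antisymm (le_min (min_le_left _ _) ?_) (le_min (min_le_left _ _) ?_)
      · exact φ.le_c_trans ((min_le_left _ _).trans h2') (min_le_right _ _)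
      · exact φ.le_c_trans ((min_le_left _ _).trans h2) (min_le_right _ _)
    rw [orbDist, orbDist, h3, h1]
  · intro H
    have a1 := H 1
    have a2 := H q.elt
    simp only [orbDist, c_self, len_one] at a1 a2
    have b1 := φ.c_le_right p.elt 1
    have b2 := φ.c_le_right q.elt 1
    have b3 := φ.c_nonneg p.elt 1
    have b4 := φ.c_nonneg q.elt 1
    rw [len_one] at b1 b2
    have hp := p.pos_nonneg
    have hq := q.pos_nonneg
    have hq' := q.pos_le
    have e : p.pos = q.pos := by grind
    refine ⟨e, ?_⟩
    grind

/-- The action of `G` on `Γ_G`. -/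
noncomputable instance : MulAction G φ.Tree where
  smul f := Quotient.map' (φ.preAct f) fun p q h =>
    (φ.equiv_iff_orbDist _ _).2 fun k => by
      rw [orbDist_preAct, orbDist_preAct]
      exact (φ.equiv_iff_orbDist p q).1 h _
  one_smul x := by
    induction x using Quotient.inductionOn with
    | h p =>
      refine Quotient.sound ((φ.equiv_iff_orbDist _ _).2 fun k => ?_)
      rw [orbDist_preAct, inv_one, one_mul]
  mul_smul f g x := by
    induction x using Quotient.inductionOn with
    | h p =>
      refine Quotient.sound ((φ.equiv_iff_orbDist _ _).2 fun k => ?_)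
      rw [orbDist_preAct, orbDist_preAct, orbDist_preAct, mul_inv_rev, mul_assoc]

theorem smul_mkPoint (f : G) (p : φ.PrePoint) :
    f • φ.mkPoint p = φ.mkPoint (φ.preAct f p) := rfl

theorem isGreatest_preDist (p q : φ.PrePoint) :
    IsGreatest (Set.range fun h => |φ.orbDist p h - φ.orbDist q h|) (φ.preDist p q) := by
  have hp := p.pos_nonneg
  have hq := q.pos_nonneg
  have hp' := p.pos_le
  have hq' := q.pos_le
  constructor
  · by_cases h : min p.pos q.pos ≤ φ.c p.elt q.elt
    · refine ⟨1, ?_⟩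
      have b1 := φ.c_le_right p.elt 1
      have b2 := φ.c_le_right q.elt 1
      have b3 := φ.c_nonneg p.elt 1
      have b4 := φ.c_nonneg q.elt 1
      simp only [orbDist, preDist, len_one] at *
      grind
    · refine ⟨q.elt, ?_⟩
      simp only [orbDist, preDist, c_self]
      grind
  · rintro _ ⟨h, rfl⟩
    have u1 : min (φ.c p.elt q.elt) (φ.c q.elt h) ≤ φ.c p.elt h :=
      φ.le_c_trans (min_le_left _ _) (min_le_right _ _)
    have u2 : min (φ.c p.elt q.elt) (φ.c p.elt h) ≤ φ.c q.elt h :=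
      φ.le_c_trans (by rw [φ.c_comm q.elt]; exact min_le_left _ _) (min_le_right _ _)
    simp only [orbDist, preDist]
    grind

/-- `G` acts on `Γ_G` by isometries. -/
theorem dist_smul (g : G) (x y : φ.Tree) : φ.dist (g • x) (g • y) = φ.dist x y := by
  induction x using Quotient.inductionOn with
  | h p =>
    induction y using Quotient.inductionOn with
    | h q =>
      change φ.preDist (φ.preAct g p) (φ.preAct g q) = φ.preDist p q
      have h1 := φ.isGreatest_preDist p q
      have h2 := φ.isGreatest_preDist (φ.preAct g p) (φ.preAct g q)
      simp only [orbDist_preAct] at h2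
      have h3 : (Set.range fun h => |φ.orbDist p (g⁻¹ * h) - φ.orbDist q (g⁻¹ * h)|)
          = Set.range fun h => |φ.orbDist p h - φ.orbDist q h| :=
        (Equiv.mulLeft g⁻¹).surjective.range_comp fun h => |φ.orbDist p h - φ.orbDist q h|
      rw [h3] at h2
      exact h2.unique h1

/-- The geodesic segment `[x, y]` of `Γ_G`. -/
def segment (x y : φ.Tree) : Set φ.Tree := {z | φ.dist x z + φ.dist z y = φ.dist x y}

/-! ## Ends of `ℤⁿ`-type -/

/-- A geodesic ray of `ℤⁿ`-type: an isometry `[0, ∞) → Γ_G`, where `[0, ∞) ⊆ ℤⁿ`. -/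
@[ext]
structure Ray where
  toFun : {α : ZVec n // 0 ≤ α} → φ.Tree
  isometry : ∀ s t, φ.dist (toFun s) (toFun t) = |(s : ZVec n) - t|

/-- Two rays are equivalent if they share a common tail. -/
instance raySetoid : Setoid φ.Ray where
  r γ γ' := ∃ s s', ∀ t, γ.toFun (s + t) = γ'.toFun (s' + t)
  iseqv :=
    { refl := fun _ => ⟨0, 0, fun _ => rfl⟩
      symm := fun ⟨s, s', h⟩ => ⟨s', s, fun t => (h t).symm⟩
      trans := by
        rintro γ γ' γ'' ⟨s, s', h⟩ ⟨r, r', h'⟩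
        refine ⟨s + r, r' + s', fun t => ?_⟩
        rw [add_assoc, h, add_assoc, ← h']
        congr 1
        abel }

/-- `∂_n Γ_G`, the set of ends of `ℤⁿ`-type of `Γ_G`. -/
def NEnd : Type _ := Quotient φ.raySetoid

/-- The end represented by a ray. -/
def Ray.toEnd {φ : WordEmbedding n X G} (γ : φ.Ray) : φ.NEnd := Quotient.mk φ.raySetoid γ

noncomputable instance : MulAction G φ.Ray where
  smul g γ := ⟨fun t => g • γ.toFun t, fun s t => by rw [dist_smul, γ.isometry]⟩
  one_smul γ := Ray.ext (funext fun t => one_smul G (γ.toFun t))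
  mul_smul g h γ := Ray.ext (funext fun t => mul_smul g h (γ.toFun t))

/-- The action of `G` on `∂_n Γ_G` induced by the action on `Γ_G`. -/
noncomputable instance : MulAction G φ.NEnd where
  smul g := Quotient.map' (fun γ => g • γ) fun _ _ ⟨s, s', h⟩ =>
    ⟨s, s', fun t => congrArg (fun x => g • x) (h t)⟩
  one_smul e := by
    induction e using Quotient.inductionOn with
    | h γ => exact congrArg (Quotient.mk φ.raySetoid) (one_smul G γ)
  mul_smul g h e := by
    induction e using Quotient.inductionOn with
    | h γ => exact congrArg (Quotient.mk φ.raySetoid) (mul_smul g h γ)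

/-- The cone `U_x`: the ends represented by a ray that starts at `ε` and contains `[ε, x]`. -/
def cone (x : φ.Tree) : Set φ.NEnd :=
  {e | ∃ γ : φ.Ray, γ.toFun 0 = φ.basePoint ∧ γ.toEnd = e ∧
    φ.segment φ.basePoint x ⊆ Set.range γ.toFun}

/-- The topology of `∂_n Γ_G`, generated by the cones. -/
instance : TopologicalSpace φ.NEnd := TopologicalSpace.generateFrom (Set.range φ.cone)

/-- The Borel `σ`-algebra of `∂_n Γ_G`. -/
instance : MeasurableSpace φ.NEnd := borel φ.NEnd

instance : BorelSpace φ.NEnd := ⟨rfl⟩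

end WordEmbedding

/-! ## Random walks, stationary measures, boundaries -/

section RandomWalk

variable {G : Type*} [Group G] [MeasurableSpace G]

/-- `μ` is non-degenerate: its support generates `G` as a semigroup. -/
def IsNondegenerate (μ : Measure G) : Prop :=
  Subsemigroup.closure {g : G | μ {g} ≠ 0} = ⊤

/-- The path `1, x₀, x₀x₁, x₀x₁x₂, …` with increments `x`. -/
def walk (x : ℕ → G) (i : ℕ) : G := ((List.range i).map x).prod

/-- The law `P_μ` on `G^{ℤ_+}` of the right random walk started at the identity, whose increments
are independent with distribution `μ`. -/
noncomputable def pathMeasure (μ : Measure G) : Measure (ℕ → G) :=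
  (Measure.infinitePi fun _ : ℕ => μ).map walk

theorem measurable_walk [Countable G] [DiscreteMeasurableSpace G] :
    Measurable (walk : (ℕ → G) → ℕ → G) := by
  refine measurable_pi_lambda _ fun i => ?_
  induction i with
  | zero => exact measurable_const
  | succ i ih =>
    have : (fun x : ℕ → G => walk x (i + 1)) = fun x => walk x i * x i := by
      funext x
      simp [walk, List.range_succ]
    rw [this]
    have h2 : Measurable fun p : G × G => p.1 * p.2 := measurable_from_prod_countable_left
      fun _ => Measurable.of_discrete
    exact h2.comp (ih.prodMk (measurable_pi_apply i))

theorem isProbabilityMeasure_pathMeasure [Countable G] [DiscreteMeasurableSpace G]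
    (μ : Measure G) [IsProbabilityMeasure μ] : IsProbabilityMeasure (pathMeasure μ) :=
  Measure.isProbabilityMeasure_map measurable_walk.aemeasurable

variable {M : Type*} [TopologicalSpace M] [MeasurableSpace M] [BorelSpace M] [MulAction G M]
  [ContinuousConstSMul G M]

/-- The translate `g · θ` of a Borel probability measure, `(g · θ)(E) = θ(g⁻¹ · E)`. -/
noncomputable def translate (g : G) (θ : ProbabilityMeasure M) : ProbabilityMeasure M :=
  θ.map (f := fun x => g • x) (continuous_const_smul g).measurable.aemeasurable

/-- `ν` is `μ`-stationary: `∑_g μ(g) (g · ν) = ν`. -/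
def IsStationary (μ : Measure G) (ν : ProbabilityMeasure M) : Prop :=
  Measure.sum (fun g : G => μ {g} • (translate g ν : Measure M)) = ν

/-- `(M, ν)` is a `μ`-boundary: `ν` is `μ`-stationary and for `P_μ`-a.e. path `τ` the measures
`τ_i · ν` converge weakly to a Dirac measure. -/
def IsMuBoundary (μ : Measure G) (ν : ProbabilityMeasure M) : Prop :=
  IsStationary μ ν ∧ ∀ᵐ τ ∂(pathMeasure μ), ∃ ω : M,
    Tendsto (fun i : ℕ => translate (τ i) ν) atTop (𝓝 (diracProba ω))

end RandomWalk

end ZnFree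

set_option linter.unusedSectionVars false

/-! The dynamics on the ends only sees the last, most significant coordinate. The map `ZVec.top : ℤⁿ
→ ℤ` is additive and monotone, so it turns the ℤⁿ-valued Gromov products `c f g` into integer ones,
that is, into a Lyndon length function with values in ℤ, the length function of a tree T. A time
whose top coordinate is larger lies later on a ray whatever its lower coordinates are. Hence an end
of ℤⁿ-type is determined by its integer Gromov products with the elements of `G`, and the cone
topology is pointwise convergence of these products. This is `isEndSpace`: the ends form the set of
unbounded "point functions" inside ℤ^G. The probabilistic part uses only this description.

Algebra provides two facts. First, some element is hyperbolic on T (`exists_hyperbolic`): otherwise,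
by finite generation and `len_mul_le`, the top lengths are bounded by that of some `f`, all orbit
points lie around the middle of [ε, f · ε], and conjugating by the word that leads to this middle
puts `G` into words of length in ℤⁿ⁻¹, against irreducibility. Second, there is no finite nonempty
invariant set of ends (`mul_comm_of_finite_invariant`): an end with finite orbit is fixed by `G`,
and the Busemann homomorphism at a fixed end is injective into ℤⁿ because every nontrivial element
of `CDR` is hyperbolic for the full length. Consequently stationary measures have no atoms.

Existence: T need not be locally finite, so the ends need not be compact. The closure of `G` in ℤ^G
is compact and carries a stationary measure. Its bounded points are countably many, and none has
positive mass, since the heaviest ones would form a finite invariant set. So the measure lives on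
the ends.

Boundary: for a clopen set S, the function g ↦ (g · ν)(S) is bounded and harmonic, so along almost
every path it converges and is asymptotically invariant under right translation. Fatou's lemma
replaces compactness by giving finitely many shadows that carry most of the mass infinitely often. A
high power of a hyperbolic element or of its inverse pushes most of ν into one shadow, and
asymptotic invariance then forces the limit mass of a single shadow of each level to be 1.

Uniqueness: the mean of two stationary measures is stationary, hence a boundary measure. When it
collapses to a point mass, so do both measures, and they agree on clopen sets. -/

namespace ZnFree

/-! ### Length functions on groups and hyperbolic elements -/

/-- The Gromov products `c f g` of a group with a (Lyndon) length function `g ↦ c g g` with values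
in an ordered abelian group. -/
structure LengthFn (G Λ : Type*) [Group G] [AddCommGroup Λ] [LinearOrder Λ] where
  c : G → G → Λ
  comm : ∀ f g, c f g = c g f
  nonneg : ∀ f g, 0 ≤ c f g
  ultra : ∀ f g h, min (c f g) (c g h) ≤ c f h
  two_c : ∀ f g, c f g + c f g = c f f + c g g - c (f⁻¹ * g) (f⁻¹ * g)

namespace LengthFn

variable {G Λ : Type*} [Group G] [AddCommGroup Λ] [LinearOrder Λ] [IsOrderedAddMonoid Λ]
  (l : LengthFn G Λ)

/-- The length of a group element. -/
def len (g : G) : Λ := l.c g g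

theorem c_self (g : G) : l.c g g = l.len g := rfl

theorem two_c' (f g : G) : l.c f g + l.c f g = l.len f + l.len g - l.len (f⁻¹ * g) := l.two_c f g

theorem len_nonneg (g : G) : 0 ≤ l.len g := l.nonneg g g

theorem c_le_left (f g : G) : l.c f g ≤ l.len f := by
  have h := l.ultra f g f
  rwa [l.comm g f, min_self] at h

theorem c_le_right (f g : G) : l.c f g ≤ l.len g := l.comm f g ▸ l.c_le_left g f

theorem len_one : l.len 1 = 0 := by
  have h := l.two_c' 1 1
  rw [c_self, inv_one, one_mul] at h
  grind

theorem c_one (g : G) : l.c g 1 = 0 :=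
  le_antisymm (l.len_one ▸ l.c_le_right g 1) (l.nonneg _ _)

theorem len_inv (g : G) : l.len g⁻¹ = l.len g := by
  have h := l.two_c' g 1
  rw [c_one, len_one, mul_one] at h
  grind

/-- Isosceles rule of the ultrametric inequality: `g` has left `f` before `f` and `f'` separate. -/
theorem c_eq_of_lt {f f' g : G} (h : l.c f g < l.c f f') : l.c f' g = l.c f g := by
  have h1 := l.ultra f' f g
  have h2 := l.ultra f f' g
  rw [l.comm f' f] at h1
  grind

/-- Change of base point: translating by `g⁻¹` turns the left side into the Gromov product of `f ·
ε` and `h · ε` seen from `g⁻¹ · ε`. -/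
theorem c_mul_mul (g f h : G) :
    l.c (g * f) (g * h) = l.c f h + l.len g - l.c f g⁻¹ - l.c h g⁻¹ := by
  have h1 := l.two_c' (g * f) (g * h)
  have h2 := l.two_c' f h
  have h3 := l.two_c' g⁻¹ f
  have h4 := l.two_c' g⁻¹ h
  rw [inv_inv, len_inv, l.comm] at h3 h4
  have e : (g * f)⁻¹ * (g * h) = f⁻¹ * h := by group
  rw [e] at h1
  grind

/-- `g` moves the base point along an axis. -/
def Hyperbolic (g : G) : Prop := l.len g < l.len (g * g)

/-- The length of `g * g` exceeds that of `g` by `len g - 2 c g⁻¹ g`, the translation length when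
this is positive. -/
theorem hyperbolic_iff (g : G) : l.Hyperbolic g ↔ l.c g⁻¹ g + l.c g⁻¹ g < l.len g := by
  have h := l.two_c' g⁻¹ g
  rw [inv_inv, len_inv] at h
  unfold Hyperbolic
  grind

variable {l}

theorem Hyperbolic.inv {g : G} (h : l.Hyperbolic g) : l.Hyperbolic g⁻¹ := by
  rw [hyperbolic_iff] at *
  rwa [inv_inv, l.comm, len_inv]

/-- Both claims are proved together: the length of `g ^ (k + 2)` gives `c g (g ^ (k + 2)) = len g -
c g⁻¹ g`, which exceeds `c g⁻¹ g`, and the isosceles rule then yields the next Gromov product and so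
the next length. -/
theorem Hyperbolic.pow_aux {g : G} (h : l.Hyperbolic g) (k : ℕ) :
    l.c g⁻¹ (g ^ (k + 1)) = l.c g⁻¹ g ∧
      l.len (g ^ (k + 2)) = l.len (g ^ (k + 1)) + (l.len g - (l.c g⁻¹ g + l.c g⁻¹ g)) := by
  rw [hyperbolic_iff] at h
  have step : ∀ m : ℕ, l.c g⁻¹ (g ^ m) + l.c g⁻¹ (g ^ m)
      = l.len g + l.len (g ^ m) - l.len (g ^ (m + 1)) := by
    intro m
    rw [l.two_c', inv_inv, len_inv, pow_succ']
  have step' : ∀ m : ℕ, l.c g (g ^ (m + 1)) + l.c g (g ^ (m + 1))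
      = l.len g + l.len (g ^ (m + 1)) - l.len (g ^ m) := by
    intro m
    rw [l.two_c', pow_succ', inv_mul_cancel_left]
  have hc : ∀ m : ℕ, l.c g⁻¹ g < l.c g (g ^ m) → l.c g⁻¹ (g ^ m) = l.c g⁻¹ g := by
    intro m hm
    rw [l.comm g⁻¹ g] at hm ⊢
    rw [l.comm g⁻¹]
    exact l.c_eq_of_lt hm
  induction k with
  | zero =>
    have h1 := step 1
    simp only [zero_add, pow_one] at *
    refine ⟨trivial, ?_⟩
    grind
  | succ k ih =>
    have h1 := step' (k + 1)
    have h2 := hc (k + 1 + 1) (by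
      have := l.nonneg g⁻¹ g
      grind)
    refine ⟨h2, ?_⟩
    have h3 := step (k + 1 + 1)
    grind

theorem Hyperbolic.len_pow_lt {g : G} (h : l.Hyperbolic g) (k : ℕ) :
    l.len (g ^ k) < l.len (g ^ (k + 1)) := by
  have h' := (l.hyperbolic_iff g).1 h
  have := l.nonneg g⁻¹ g
  match k with
  | 0 =>
    rw [pow_zero, len_one, zero_add, pow_one]
    grind
  | k + 1 =>
    have := (h.pow_aux k).2
    grind

theorem Hyperbolic.pow_ne_one {g : G} (h : l.Hyperbolic g) {k : ℕ} (hk : k ≠ 0) : g ^ k ≠ 1 := by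
  intro e
  have hm : StrictMono fun k : ℕ => l.len (g ^ k) := strictMono_nat_of_lt_succ h.len_pow_lt
  have := hm (Nat.pos_of_ne_zero hk)
  simp only [e, pow_zero, lt_self_iff_false] at this

/-- All positive powers leave all negative powers at the same place, the point of the axis nearest
to the base point. -/
theorem Hyperbolic.c_inv_pow_pow {g : G} (h : l.Hyperbolic g) (i j : ℕ) :
    l.c (g⁻¹ ^ (i + 1)) (g ^ (j + 1)) = l.c g⁻¹ g := by
  have h1 := (h.pow_aux j).1
  have h2 := (h.inv.pow_aux i).1
  match i with
  | 0 => simpa using h1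
  | i + 1 =>
    have h3 : l.c g⁻¹ g < l.c g⁻¹ (g⁻¹ ^ (i + 1 + 1)) := by
      have e1 := l.two_c' g⁻¹ (g⁻¹ ^ (i + 1 + 1))
      rw [pow_succ' g⁻¹ (i + 1), inv_mul_cancel_left, ← pow_succ'] at e1
      have e2 := (h.inv.pow_aux i).2
      have h' := (l.hyperbolic_iff g).1 h
      rw [inv_inv, l.comm g, len_inv] at e2
      rw [len_inv] at e1
      grind
    rw [← h1] at h3 ⊢
    exact l.c_eq_of_lt h3

variable (l)

/-- If `x`, `y` and `x * y` are elliptic, then `x` and `y` have a common fixed point. -/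
theorem len_mul_le {x y : G} (hx : ¬ l.Hyperbolic x) (hy : ¬ l.Hyperbolic y)
    (hxy : ¬ l.Hyperbolic (x * y)) : l.len (x * y) ≤ max (l.len x) (l.len y) := by
  rw [hyperbolic_iff] at *
  have e1 := l.two_c' x⁻¹ y
  have e2 := l.two_c' x (x * y)
  have e3 := l.two_c' y⁻¹ (x * y)⁻¹
  have e : y⁻¹⁻¹ * (x * y)⁻¹ = x⁻¹ := by group
  rw [inv_mul_cancel_left] at e2
  rw [inv_inv, len_inv] at e1
  rw [e, len_inv, len_inv, len_inv] at e3
  -- If `x * y` were longer than both factors, it would follow `x⁻¹`, and its inverse would follow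
  -- `y`, beyond `c x⁻¹ y`. Two uses of the isosceles rule give `c (x * y)⁻¹ (x * y) = c x⁻¹ y`, and
  -- ellipticity of `x * y` becomes `2 len (x * y) ≤ len x + len y`.
  by_contra hlt
  have u1 := l.ultra (x * y) x x⁻¹
  have u2 := l.ultra (x * y)⁻¹ y⁻¹ y
  have h1 : l.c x⁻¹ y < l.c x⁻¹ (x * y) := by
    rw [l.comm (x * y) x, l.comm x x⁻¹] at u1
    rw [l.comm x⁻¹ (x * y)]
    grind
  have h2 : l.c x⁻¹ y < l.c y (x * y)⁻¹ := by
    rw [l.comm (x * y)⁻¹ y⁻¹] at u2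
    rw [l.comm y]
    grind
  have h3 := l.c_eq_of_lt h1
  rw [l.comm] at h3
  rw [← h3] at h2
  have h4 := l.c_eq_of_lt h2
  rw [h4, h3] at hxy
  grind

end LengthFn
-- The most significant coordinate
namespace ZVec

variable {n : ℕ} [NeZero n]

/-- The last, most significant, coordinate of an element of `ℤⁿ`. -/
def top (a : ZVec n) : ℤ := a.coord ⟨n - 1, Nat.sub_one_lt (NeZero.ne n)⟩

theorem top_zero : top (0 : ZVec n) = 0 := rfl

theorem top_add (a b : ZVec n) : top (a + b) = top a + top b := rfl

theorem top_sub (a b : ZVec n) : top (a - b) = top a - top b := by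
  have h := top_add (a - b) b
  rw [sub_add_cancel] at h
  omega

theorem top_mono {a b : ZVec n} (h : a ≤ b) : top a ≤ top b := by
  rcases h.eq_or_lt with rfl | h
  · exact le_rfl
  · obtain ⟨i, hi, hlt⟩ := (lt_iff a b).1 h
    have hn := NeZero.ne n
    rcases (show i ≤ ⟨n - 1, Nat.sub_one_lt hn⟩ from Fin.le_def.2 (by simp; omega)).eq_or_lt
      with rfl | h1
    · exact hlt.le
    · exact (hi _ h1).le

theorem lt_of_top_lt {a b : ZVec n} (h : top a < top b) : a < b :=
  lt_of_not_ge fun h' => absurd (top_mono h') (not_le.2 h)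

theorem top_min (a b : ZVec n) : top (min a b) = min (top a) (top b) := by
  rcases le_total a b with h | h
  · rw [min_eq_left h, min_eq_left (top_mono h)]
  · rw [min_eq_right h, min_eq_right (top_mono h)]

theorem exists_top_eq (n : ℕ) [NeZero n] (k : ℤ) : ∃ a : ZVec n, top a = k :=
  ⟨toColex (Pi.single _ k), Pi.single_eq_same (M := fun _ : Fin n => ℤ) _ k⟩

/-- Through this, a group whose lengths all have vanishing top coordinate contradicts irreducibility
with `k = n - 1`. -/
theorem inSub_of_top_eq_zero {a : ZVec n} (h : top a = 0) : InSub (n - 1) a := by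
  intro i hi
  have : i = ⟨n - 1, Nat.sub_one_lt (NeZero.ne n)⟩ := Fin.ext (by simp; omega)
  rw [this]
  exact h

end ZVec

/-! ### Points and rays of the universal tree -/

namespace WordEmbedding

variable {n : ℕ} [NeZero n] {X G : Type*} [Group G] (φ : WordEmbedding n X G)

/-- `x` is the point at distance `α` from `ε` on the segment `[ε, g · ε]`. -/
def At (α : ZVec n) (g : G) (x : φ.Tree) : Prop :=
  ∃ (h₀ : 0 ≤ α) (h₁ : α ≤ φ.len g), x = φ.mkPoint ⟨α, g, h₀, h₁⟩

variable {φ}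

theorem exists_at (x : φ.Tree) : ∃ α g, φ.At α g x := by
  induction x using Quotient.inductionOn with
  | h p => exact ⟨p.pos, p.elt, p.pos_nonneg, p.pos_le, rfl⟩

theorem At.nonneg {α : ZVec n} {g : G} {x : φ.Tree} (h : φ.At α g x) : 0 ≤ α := h.1

theorem At.le_len {α : ZVec n} {g : G} {x : φ.Tree} (h : φ.At α g x) : α ≤ φ.len g := h.2.1

theorem At.dist_eq {α β : ZVec n} {f g : G} {x y : φ.Tree} (hx : φ.At α f x) (hy : φ.At β g y) :
    φ.dist x y = α + β - 2 • min (min α β) (φ.c f g) := by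
  obtain ⟨_, _, rfl⟩ := hx
  obtain ⟨_, _, rfl⟩ := hy
  rfl

theorem At.eq_iff {α β : ZVec n} {f g : G} {x y : φ.Tree} (hx : φ.At α f x) (hy : φ.At β g y) :
    x = y ↔ α = β ∧ α ≤ φ.c f g := by
  obtain ⟨_, _, rfl⟩ := hx
  obtain ⟨_, _, rfl⟩ := hy
  exact Quotient.eq

theorem At.change {α : ZVec n} {f g : G} {x : φ.Tree} (hx : φ.At α f x) (h : α ≤ φ.c f g) :
    φ.At α g x := by
  have h1 : α ≤ φ.len g := h.trans (φ.c_le_right f g)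
  exact ⟨hx.nonneg, h1, (hx.eq_iff (y := φ.mkPoint ⟨α, g, hx.nonneg, h1⟩) ⟨_, _, rfl⟩).2 ⟨rfl, h⟩⟩

theorem exists_at_of_le {α : ZVec n} {g : G} (h₀ : 0 ≤ α) (h₁ : α ≤ φ.len g) :
    ∃ x, φ.At α g x := ⟨_, h₀, h₁, rfl⟩

theorem at_basePoint (g : G) : φ.At 0 g φ.basePoint :=
  At.change (f := 1) ⟨le_rfl, φ.len_nonneg 1, rfl⟩ (φ.c_nonneg _ _)

variable (φ)

/-- The distance from a point of `Γ_G` to the orbit point `h · ε`. -/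
noncomputable def toOrbit (x : φ.Tree) (h : G) : ZVec n :=
  Quotient.liftOn x (fun p => φ.orbDist p h) fun p q hpq => (φ.equiv_iff_orbDist p q).1 hpq h

variable {φ}

theorem At.toOrbit_eq {α : ZVec n} {g : G} {x : φ.Tree} (hx : φ.At α g x) (h : G) :
    φ.toOrbit x h = α + φ.len h - 2 • min α (φ.c g h) := by
  obtain ⟨_, _, rfl⟩ := hx
  rfl

theorem toOrbit_smul (g : G) (x : φ.Tree) (h : G) :
    φ.toOrbit (g • x) h = φ.toOrbit x (g⁻¹ * h) := by
  induction x using Quotient.inductionOn with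
  | h p => exact φ.orbDist_preAct g p h

theorem min_c_le (f g h : G) : min (φ.c f g) (φ.c g h) ≤ φ.c f h :=
  φ.le_c_trans (min_le_left _ _) (min_le_right _ _)

/-- The Gromov product of the points ⟨a, f⟩ and ⟨b, g⟩ is `min (min a b) (c f g)`; this is its
ultrametric inequality. -/
theorem min_gromov_le (a b d : ZVec n) (f g h : G) :
    min (min (min a b) (φ.c f g)) (min (min b d) (φ.c g h)) ≤ min (min a d) (φ.c f h) := by
  refine le_min (le_min ?_ ?_) (le_trans ?_ (min_c_le f g h))
  · exact (min_le_left _ _).trans ((min_le_left _ _).trans (min_le_left _ _))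
  · exact (min_le_right _ _).trans ((min_le_left _ _).trans (min_le_right _ _))
  · exact min_le_min (min_le_right _ _) (min_le_right _ _)

/-- A normalized description of a ray from `ε`: the point at time `t` lies on `[ε, E t · ε]`. -/
theorem exists_ray_of_elts (E : ZVec n → G) (h1 : ∀ t, 0 ≤ t → t ≤ φ.len (E t))
    (h2 : ∀ s t, 0 ≤ s → s ≤ t → s ≤ φ.c (E s) (E t)) :
    ∃ γ : φ.Ray, ∀ t : {α : ZVec n // 0 ≤ α}, φ.At t (E t) (γ.toFun t) := by
  refine ⟨⟨fun t => φ.mkPoint ⟨t, E t, t.2, h1 t t.2⟩, fun s t => ?_⟩, fun t => ⟨t.2, h1 t t.2, rfl⟩⟩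
  rw [At.dist_eq (φ := φ) (α := s) (f := E s) (β := t) (g := E t) ⟨_, _, rfl⟩ ⟨_, _, rfl⟩]
  rcases le_total (s : ZVec n) t with h | h
  · have := h2 s t s.2 h
    grind
  · have := h2 t s t.2 h
    rw [c_comm] at this
    grind

theorem ray_arith {p s t q A : ZVec n}
    (h : p + (s + t - s) + (p + (p + t + q - s)) - 2 • A = -(s + t - (p + t + q))) :
    A = p + t := by
  grind

/-- `P t` is the distance from `ε` to the given ray at time `t`. The ray needs at most time `P 0` to
pass its point nearest to `ε`, so its point at time `α + P 0` is at distance at least `α` from `ε`.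
The new ray takes, at time `α`, the point at distance `α` on the segment leading there. -/
theorem exists_ray_from_base (γ : φ.Ray) :
    ∃ E : ZVec n → G, ∃ γ' : φ.Ray, γ'.toEnd = γ.toEnd ∧
      ∀ t : {α : ZVec n // 0 ≤ α}, φ.At t (E t) (γ'.toFun t) := by
  choose P g hat using fun t : {α : ZVec n // 0 ≤ α} => exists_at (γ.toFun t)
  have hd : ∀ s t, P s + P t - 2 • min (min (P s) (P t)) (φ.c (g s) (g t)) = |(s : ZVec n) - t| :=
    fun s t => by rw [← γ.isometry, (hat s).dist_eq (hat t)]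
  have hP : ∀ t, 0 ≤ P t := fun t => (hat t).nonneg
  have hPl : ∀ t, P t ≤ φ.len (g t) := fun t => (hat t).le_len
  set z : {α : ZVec n // 0 ≤ α} := 0 with hz
  have hz0 : (z : ZVec n) = 0 := rfl
  have key1 : ∀ t : {α : ZVec n // 0 ≤ α}, (t : ZVec n) - P z ≤ P t := by
    intro t
    have := hd z t
    have := hP t
    have := hP z
    have := t.2
    have := φ.c_nonneg (g z) (g t)
    rw [hz0] at *
    grind
  have hlev : ∀ α β : ZVec n, ∀ ha : 0 ≤ α, ∀ hb : 0 ≤ β, α ≤ β →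
      α ≤ φ.c (g ⟨α + P z, add_nonneg ha (hP z)⟩) (g ⟨β + P z, add_nonneg hb (hP z)⟩) := by
    intro α β ha hb hab
    have h1 := hd ⟨α + P z, add_nonneg ha (hP z)⟩ ⟨β + P z, add_nonneg hb (hP z)⟩
    have h2 := key1 ⟨α + P z, add_nonneg ha (hP z)⟩
    have h3 := key1 ⟨β + P z, add_nonneg hb (hP z)⟩
    dsimp only at h1 h2 h3
    grind
  let E : ZVec n → G := fun α => if h : 0 ≤ α then g ⟨α + P z, add_nonneg h (hP z)⟩ else 1
  have hE : ∀ α (h : 0 ≤ α), E α = g ⟨α + P z, add_nonneg h (hP z)⟩ := fun α h => dif_pos h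
  obtain ⟨γ', hγ'⟩ := exists_ray_of_elts (φ := φ) E
    (fun t ht => by
      rw [hE t ht]
      exact le_trans (by simpa using key1 ⟨t + P z, add_nonneg ht (hP z)⟩) (hPl _))
    (fun s t hs hst => by
      rw [hE s hs, hE t (hs.trans hst)]
      exact hlev s t hs (hs.trans hst) hst)
  refine ⟨E, γ', ?_, hγ'⟩
  have hone := ZVec.one_pos n
  -- From this time on the old ray moves straight away from `ε`. The extra unit makes `P z < s`
  -- strict, which rules out the case `C ≤ A` below.
  have hs0 : 0 ≤ P z + ZVec.one n := add_nonneg (hP z) hone.le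
  set s : {α : ZVec n // 0 ≤ α} := ⟨P z + ZVec.one n, hs0⟩ with hs
  have hsv : (s : ZVec n) = P z + ZVec.one n := rfl
  have key2 : ∀ t : {α : ZVec n // 0 ≤ α}, (s : ZVec n) ≤ t → P t = P s + (t - s) := by
    intro t ht
    have a1 := hd z s
    have a2 := hd z t
    have a3 := hd s t
    have u2 := min_gromov_le (φ := φ) (P s) (P z) (P t) (g s) (g z) (g t)
    have u3 := min_gromov_le (φ := φ) (P z) (P s) (P t) (g z) (g s) (g t)
    rw [φ.c_comm (g s) (g z), min_comm (P s) (P z)] at u2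
    have hC : min (min (P s) (P t)) (φ.c (g s) (g t)) ≤ P s :=
      (min_le_left _ _).trans (min_le_left _ _)
    have hz := hP z
    have hs := hP s
    rw [hz0] at a1 a2
    rw [abs_of_nonpos (by grind)] at a1 a2 a3
    generalize min (min (P z) (P s)) (φ.c (g z) (g s)) = A at *
    generalize min (min (P z) (P t)) (φ.c (g z) (g t)) = B at *
    generalize min (min (P s) (P t)) (φ.c (g s) (g t)) = C at *
    rcases le_total A C with h | h
    · rw [min_eq_left h] at u3
      grind
    · rw [min_eq_right h] at u3
      grind
  -- On the common tail the time of the new ray is the distance from `ε`, so time `P s + t`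
  -- corresponds to `s + t` on the old ray.
  refine Quotient.sound ⟨⟨P s, hP s⟩, s, fun t => ?_⟩
  have ht := t.2
  have b1 := key2 (s + t) (by simpa using ht)
  have e1 : ((s + t : {α : ZVec n // 0 ≤ α}) : ZVec n) = s + t := rfl
  have hnn : 0 ≤ P s + (t : ZVec n) := add_nonneg (hP s) ht
  have hT : 0 ≤ P s + (t : ZVec n) + P z := add_nonneg hnn (hP z)
  have k1 := key1 s
  have b2 := key2 ⟨P s + (t : ZVec n) + P z, hT⟩ (by
    change (s : ZVec n) ≤ P s + (t : ZVec n) + P z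
    grind)
  have b3 := hd (s + t) ⟨P s + (t : ZVec n) + P z, hT⟩
  have k2 := hγ' (⟨P s, hP s⟩ + t)
  refine (k2.eq_iff (hat (s + t))).2 ?_
  have e2 : ((⟨P s, hP s⟩ + t : {α : ZVec n // 0 ≤ α}) : ZVec n) = P s + t := rfl
  rw [e2, hE _ hnn, φ.c_comm]
  rw [e1] at b1 b3
  refine ⟨by grind, ?_⟩
  dsimp only at b2 b3
  rw [abs_of_nonpos (by grind)] at b3
  have hle := min_le_right (min (P (s + t)) (P ⟨P s + (t : ZVec n) + P z, hT⟩))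
    (φ.c (g (s + t)) (g ⟨P s + (t : ZVec n) + P z, hT⟩))
  generalize min (min (P (s + t)) (P ⟨P s + (t : ZVec n) + P z, hT⟩))
    (φ.c (g (s + t)) (g ⟨P s + (t : ZVec n) + P z, hT⟩)) = A at *
  have hA : A = P s + t := by
    rw [b1, b2] at b3
    exact ray_arith b3
  exact hA ▸ hle

end WordEmbedding
-- Gromov products of ends
namespace WordEmbedding

variable {n : ℕ} [NeZero n] {X G : Type*} [Group G] {φ : WordEmbedding n X G}

variable (φ) in
/-- The `ℤⁿ`-valued Gromov products of `G`. -/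
noncomputable def lengthFn : LengthFn G (ZVec n) where
  c := φ.c
  comm := φ.c_comm
  nonneg := φ.c_nonneg
  ultra := min_c_le
  two_c f g := by rw [φ.two_c, φ.c_self, φ.c_self, φ.c_self]

variable (φ) in
theorem lengthFn_len (g : G) : φ.lengthFn.len g = φ.len g := φ.c_self g

theorem lengthFn_c (f g : G) : φ.lengthFn.c f g = φ.c f g := rfl

variable (φ) in
/-- The integer Gromov products of `G`, given by the most significant coordinate. -/
noncomputable def topLengthFn : LengthFn G ℤ where
  c f g := (φ.c f g).top
  comm f g := by rw [φ.c_comm]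
  nonneg f g := ZVec.top_mono (φ.c_nonneg f g)
  ultra f g h := by
    rw [← ZVec.top_min]
    exact ZVec.top_mono (min_c_le f g h)
  two_c f g := by
    rw [← ZVec.top_add, φ.two_c, φ.c_self, φ.c_self, φ.c_self, ZVec.top_sub, ZVec.top_add]

theorem topLengthFn_c (f g : G) : φ.topLengthFn.c f g = (φ.c f g).top := rfl

variable (φ) in
theorem topLengthFn_len (g : G) : φ.topLengthFn.len g = (φ.len g).top :=
  congrArg ZVec.top (φ.c_self g)

theorem at_gromov {γ : φ.Ray} {E : ZVec n → G}
    (h : ∀ t : {α : ZVec n // 0 ≤ α}, φ.At t (E t) (γ.toFun t)) {s t : ZVec n} (hs : 0 ≤ s)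
    (hst : s ≤ t) : s ≤ φ.c (E s) (E t) := by
  have h1 := (h ⟨s, hs⟩).dist_eq (h ⟨t, hs.trans hst⟩)
  rw [γ.isometry, abs_of_nonpos (by simpa using hst)] at h1
  dsimp only at h1
  rw [min_eq_left hst] at h1
  have h2 := min_le_right s (φ.c (E s) (E t))
  generalize min s (φ.c (E s) (E t)) = A at *
  grind

theorem exists_elts_of_base {γ : φ.Ray} (h : γ.toFun 0 = φ.basePoint) :
    ∃ E : ZVec n → G, ∀ t : {α : ZVec n // 0 ≤ α}, φ.At t (E t) (γ.toFun t) := by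
  choose P g hat using fun t : {α : ZVec n // 0 ≤ α} => exists_at (γ.toFun t)
  refine ⟨fun t => if ht : 0 ≤ t then g ⟨t, ht⟩ else 1, fun t => ?_⟩
  dsimp only
  rw [dif_pos t.2]
  have h1 := (at_basePoint (φ := φ) 1).dist_eq (hat t)
  have h2 : φ.dist φ.basePoint (γ.toFun t) = |(0 : ZVec n) - t| := by
    rw [← h, γ.isometry]
    rfl
  have h3 := hat t
  rw [min_eq_left h3.nonneg, min_eq_left (φ.c_nonneg _ _), smul_zero, h2, zero_sub, abs_neg,
    abs_of_nonneg t.2, zero_add, sub_zero] at h1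
  rwa [← h1] at h3

/-- On a ray from `ε` the time is the distance from `ε`, so a common tail is reached at equal times,
and the segments from `ε` to its points agree. -/
theorem ray_unique {γ γ' : φ.Ray} {E E' : ZVec n → G}
    (h : ∀ t : {α : ZVec n // 0 ≤ α}, φ.At t (E t) (γ.toFun t))
    (h' : ∀ t : {α : ZVec n // 0 ≤ α}, φ.At t (E' t) (γ'.toFun t))
    (he : γ.toEnd = γ'.toEnd) : γ = γ' := by
  obtain ⟨s, s', hs⟩ := Quotient.exact he
  have e := fun t => ((h (s + t)).eq_iff (h' (s' + t))).1 (hs t)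
  refine Ray.ext (funext fun t => ((h t).eq_iff (h' t)).2 ⟨rfl, ?_⟩)
  have h0 : ((s + t : {α : ZVec n // 0 ≤ α}) : ZVec n) = ((s' + t : {α : ZVec n // 0 ≤ α})) :=
    (e t).1
  have hle : (t : ZVec n) ≤ ((s + t : {α : ZVec n // 0 ≤ α}) : ZVec n) :=
    le_add_of_nonneg_left s.2
  refine φ.le_c_trans (at_gromov h t.2 hle) (φ.le_c_trans (hle.trans (e t).2) ?_)
  rw [φ.c_comm, ← h0]
  have := at_gromov h' t.2 hle
  exact this

theorem NEnd.exists_ray (e : φ.NEnd) : ∃ E : ZVec n → G, ∃ γ : φ.Ray, γ.toEnd = e ∧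
    ∀ t : {α : ZVec n // 0 ≤ α}, φ.At t (E t) (γ.toFun t) := by
  induction e using Quotient.inductionOn with
  | h γ => exact exists_ray_from_base γ

/-- Group elements whose orbit points approach a given end. -/
noncomputable def NEnd.elts (e : φ.NEnd) : ZVec n → G := e.exists_ray.choose

/-- The ray from `ε` representing an end. -/
noncomputable def NEnd.ray (e : φ.NEnd) : φ.Ray := e.exists_ray.choose_spec.choose

theorem NEnd.toEnd_ray (e : φ.NEnd) : e.ray.toEnd = e := e.exists_ray.choose_spec.choose_spec.1

theorem NEnd.at_ray (e : φ.NEnd) (t : {α : ZVec n // 0 ≤ α}) : φ.At t (e.elts t) (e.ray.toFun t) :=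
  e.exists_ray.choose_spec.choose_spec.2 t

theorem NEnd.le_c_elts (e : φ.NEnd) {s t : ZVec n} (hs : 0 ≤ s) (hst : s ≤ t) :
    s ≤ φ.c (e.elts s) (e.elts t) := at_gromov e.at_ray hs hst

theorem NEnd.le_len_elts (e : φ.NEnd) {s : ZVec n} (hs : 0 ≤ s) : s ≤ φ.len (e.elts s) :=
  (e.at_ray ⟨s, hs⟩).le_len

/-- The Gromov product of an end and a group element. -/
noncomputable def NEnd.c (e : φ.NEnd) (h : G) : ZVec n := φ.c (e.elts (φ.len h + ZVec.one n)) h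

theorem c_eq_of_lt {f f' g : G} (h : φ.c f g < φ.c f f') : φ.c f' g = φ.c f g :=
  φ.lengthFn.c_eq_of_lt h

/-- The Gromov product with `h` cannot exceed `φ.len h`, so it stabilizes once the approximation of
`e` is good strictly beyond that length. This explains the added unit in `NEnd.c`. -/
theorem NEnd.c_elts (e : φ.NEnd) {h : G} {α : ZVec n} (hα : φ.len h < α) :
    φ.c (e.elts α) h = e.c h := by
  have h0 := φ.len_nonneg h
  have h1 : φ.len h + ZVec.one n ≤ α := by
    have := ZVec.one_le_of_pos (sub_pos.2 hα)
    grind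
  have h2 := e.le_c_elts (add_nonneg h0 (ZVec.one_pos n).le) h1
  refine c_eq_of_lt (lt_of_lt_of_le (lt_of_le_of_lt (φ.c_le_right _ _) ?_) h2)
  exact lt_add_of_pos_right _ (ZVec.one_pos n)

theorem NEnd.c_nonneg (e : φ.NEnd) (h : G) : 0 ≤ e.c h := φ.c_nonneg _ _

theorem NEnd.c_le_len (e : φ.NEnd) (h : G) : e.c h ≤ φ.len h := φ.c_le_right _ _

theorem NEnd.c_one (e : φ.NEnd) : e.c 1 = 0 :=
  le_antisymm ((e.c_le_len 1).trans φ.len_one.le) (e.c_nonneg 1)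

theorem exists_gt (a b : ZVec n) : ∃ α, 0 ≤ α ∧ a < α ∧ b < α := by
  refine ⟨max 0 (max a b) + ZVec.one n, ?_⟩
  have := ZVec.one_pos n
  grind

theorem NEnd.ultra (e : φ.NEnd) (g h : G) : min (e.c g) (φ.c g h) ≤ e.c h := by
  obtain ⟨α, -, h1, h2⟩ := exists_gt (φ.len g) (φ.len h)
  rw [← e.c_elts h1, ← e.c_elts h2]
  exact min_c_le _ _ _

theorem NEnd.ultra' (e : φ.NEnd) (g h : G) : min (e.c g) (e.c h) ≤ φ.c g h := by
  obtain ⟨α, -, h1, h2⟩ := exists_gt (φ.len g) (φ.len h)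
  rw [← e.c_elts h1, ← e.c_elts h2, φ.c_comm _ g]
  exact min_c_le _ _ _

theorem NEnd.le_c (e : φ.NEnd) {α : ZVec n} (hα : 0 ≤ α) : α ≤ e.c (e.elts α) := by
  have h := e.le_len_elts hα
  have := ZVec.one_pos n
  rw [NEnd.c, φ.c_comm]
  exact e.le_c_elts hα (h.trans (le_add_of_nonneg_right this.le))

theorem NEnd.c_eq_of_lt {e : φ.NEnd} {f g : G} (h : φ.c f g < e.c f) : e.c g = φ.c f g := by
  have h1 := e.ultra f g
  have h2 := e.ultra' f g
  grind

theorem NEnd.at_ray_of_le {e : φ.NEnd} {α : {α : ZVec n // 0 ≤ α}} {h : G} (hα : α ≤ e.c h) :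
    φ.At α h (e.ray.toFun α) := by
  refine (e.at_ray α).change ?_
  have h1 := e.ultra' (e.elts α) h
  have h2 := e.le_c α.2
  exact (le_min h2 hα).trans h1

theorem NEnd.le_c_of_at {e : φ.NEnd} {α : ZVec n} {h : G} {s : {α : ZVec n // 0 ≤ α}}
    (hα : φ.At α h (e.ray.toFun s)) : α = s ∧ α ≤ e.c h := by
  obtain ⟨h1, h2⟩ := (hα.eq_iff (e.at_ray s)).1 rfl
  refine ⟨h1, ?_⟩
  have h3 := e.le_c s.2
  rw [φ.c_comm] at h2
  exact (le_min (h1 ▸ h3) h2).trans (e.ultra _ _)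

/-- Since an end has only one ray from `ε`, the cone condition concerns `e.ray` alone, and a ray
containing the far end of the segment [ε, x] contains all of it. -/
theorem mem_cone_iff {α : ZVec n} {f : G} {x : φ.Tree} (hx : φ.At α f x) (e : φ.NEnd) :
    e ∈ φ.cone x ↔ α ≤ e.c f := by
  constructor
  · rintro ⟨γ, h0, he, hseg⟩
    obtain ⟨E, hE⟩ := exists_elts_of_base h0
    have hγ : γ = e.ray := ray_unique hE e.at_ray (he.trans e.toEnd_ray.symm)
    obtain ⟨s, hs⟩ := hseg (show x ∈ φ.segment φ.basePoint x by
      change φ.dist _ _ + φ.dist _ _ = φ.dist _ _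
      rw [hx.dist_eq hx, c_self, min_self, min_eq_left hx.le_len]
      grind)
    subst hγ
    exact (NEnd.le_c_of_at (hs ▸ hx)).2
  · intro hα
    refine ⟨e.ray, ?_, e.toEnd_ray, fun z hz => ?_⟩
    · exact ((e.at_ray 0).eq_iff (at_basePoint (e.elts 0))).2 ⟨rfl, φ.c_nonneg _ _⟩
    · obtain ⟨β, g, hz'⟩ := exists_at z
      have hb := at_basePoint (φ := φ) 1
      have hz1 : φ.dist φ.basePoint z + φ.dist z x = φ.dist φ.basePoint x := hz
      rw [hb.dist_eq hz', hb.dist_eq hx, hz'.dist_eq hx] at hz1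
      have hβ0 := hz'.nonneg
      have hα0 := hx.nonneg
      rw [min_eq_left hβ0, min_eq_left hα0, min_eq_left (φ.c_nonneg _ _),
        min_eq_left (φ.c_nonneg _ _)] at hz1
      have l1 := min_le_left (min β α) (φ.c g f)
      have l2 := min_le_right (min β α) (φ.c g f)
      have l3 := min_le_right β α
      have hβ : β = min (min β α) (φ.c g f) := by
        generalize min (min β α) (φ.c g f) = A at *
        clear l1 l2 l3
        grind
      rw [← hβ] at l1 l2
      refine ⟨⟨β, hβ0⟩, ?_⟩
      have h2 : φ.At β f (e.ray.toFun ⟨β, hβ0⟩) := NEnd.at_ray_of_le (α := ⟨β, hβ0⟩) ((l1.trans l3).trans hα)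
      exact (h2.eq_iff hz').2 ⟨rfl, by rw [φ.c_comm]; exact l2⟩

theorem NEnd.toOrbit_ray (e : φ.NEnd) {h : G} {t : {α : ZVec n // 0 ≤ α}} (ht : φ.len h < t) :
    φ.toOrbit (e.ray.toFun t) h = t + φ.len h - 2 • e.c h := by
  rw [(e.at_ray t).toOrbit_eq, ← e.c_elts ht, min_eq_right]
  exact (φ.c_le_right _ _).trans ht.le

/-- Change of base point for ends. The translated ray `g • e.ray` and the ray of `g • e` have a
common tail; the distances from one far point of it to `(g * h) · ε` and to `ε` are computed along
both rays and compared. -/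
theorem NEnd.c_smul (e : φ.NEnd) (g h : G) :
    (g • e).c (g * h) = e.c h + φ.len g - e.c g⁻¹ - φ.c h g⁻¹ := by
  have heq : (g • e.ray).toEnd = (g • e).ray.toEnd := by
    rw [NEnd.toEnd_ray]
    conv_rhs => rw [← e.toEnd_ray]
    rfl
  obtain ⟨s, s', hs⟩ := Quotient.exact heq
  obtain ⟨t, ht0, ht1, ht2⟩ := exists_gt (max (φ.len h) (φ.len g⁻¹)) (max (φ.len (g * h)) (φ.len 1))
  have e1 := hs ⟨t, ht0⟩
  change g • e.ray.toFun (s + ⟨t, ht0⟩) = _ at e1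
  have hle : ∀ r : {α : ZVec n // 0 ≤ α},
      t ≤ ((r + ⟨t, ht0⟩ : {α : ZVec n // 0 ≤ α}) : ZVec n) := fun r => le_add_of_nonneg_left r.2
  have e2 := congrArg (fun x => φ.toOrbit x (g * h)) e1
  have e3 := congrArg (fun x => φ.toOrbit x 1) e1
  rw [toOrbit_smul, inv_mul_cancel_left,
    e.toOrbit_ray (lt_of_lt_of_le (lt_of_le_of_lt (le_max_left _ _) ht1) (hle s)),
    NEnd.toOrbit_ray _ (lt_of_lt_of_le (lt_of_le_of_lt (le_max_left _ _) ht2) (hle s'))] at e2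
  rw [toOrbit_smul, mul_one,
    e.toOrbit_ray (lt_of_lt_of_le (lt_of_le_of_lt (le_max_right _ _) ht1) (hle s)),
    NEnd.toOrbit_ray _ (lt_of_lt_of_le (lt_of_le_of_lt (le_max_right _ _) ht2) (hle s')),
    NEnd.c_one, φ.len_one, φ.len_inv] at e3
  have e4 := φ.two_c g⁻¹ h
  rw [_root_.inv_inv, φ.len_inv, φ.c_comm] at e4
  generalize ((s + ⟨t, ht0⟩ : {α : ZVec n // 0 ≤ α}) : ZVec n) = a at *
  generalize ((s' + ⟨t, ht0⟩ : {α : ZVec n // 0 ≤ α}) : ZVec n) = b at *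
  clear * - e2 e3 e4
  grind

end WordEmbedding
theorem map_letterInv_map_letterInv {X : Type*} (o : Option (X × Bool)) :
    (o.map letterInv).map letterInv = o := by
  cases o <;> simp [letterInv]

/-! ### Ends as unbounded integer point functions -/

/-- `y` has the properties of the function `g ↦ (x | g)` of Gromov products with a vertex or an end
`x` of the tree of an integer length function. -/
structure IsPointFn {G : Type*} [Group G] (l : LengthFn G ℤ) (y : G → ℤ) : Prop where
  nonneg : ∀ g, 0 ≤ y g
  le_len : ∀ g, y g ≤ l.len g
  ultra : ∀ g h, min (y g) (l.c g h) ≤ y h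
  ultra' : ∀ g h, min (y g) (y h) ≤ l.c g h

/-- `p e g = (e | g)` are the Gromov products that identify `M` with the space of ends of the tree
of an integer length function. -/
structure IsEndSpace {G M : Type*} [Group G] [TopologicalSpace M] [MulAction G M]
    (l : LengthFn G ℤ) (p : M → G → ℤ) : Prop where
  isPointFn : ∀ e, IsPointFn l (p e)
  unbounded : ∀ e k, ∃ g, k ≤ p e g
  injective : Function.Injective p
  complete : ∀ y, IsPointFn l y → (∀ k, ∃ g, k ≤ y g) → ∃ e, p e = y
  smul : ∀ e g h, p (g • e) (g * h) = p e h + l.len g - p e g⁻¹ - l.c h g⁻¹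
  inducing : IsInducing p

namespace WordEmbedding

variable {n : ℕ} [NeZero n] {X G : Type*} [Group G] {φ : WordEmbedding n X G}

/-- The integer Gromov product of an end and a group element. -/
noncomputable def NEnd.topC (e : φ.NEnd) (h : G) : ℤ := (e.c h).top

theorem NEnd.isPointFn (e : φ.NEnd) : IsPointFn φ.topLengthFn e.topC where
  nonneg g := ZVec.top_mono (e.c_nonneg g)
  le_len g := φ.topLengthFn_len g ▸ ZVec.top_mono (e.c_le_len g)
  ultra g h := by
    have := ZVec.top_mono (e.ultra g h)
    rwa [ZVec.top_min] at this
  ultra' g h := by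
    have := ZVec.top_mono (e.ultra' g h)
    rwa [ZVec.top_min] at this

theorem exists_nonneg_top_ge (k : ℤ) : ∃ α : ZVec n, 0 ≤ α ∧ k ≤ α.top := by
  obtain ⟨a, ha⟩ := ZVec.exists_top_eq n (max k 1)
  refine ⟨a, le_of_lt (ZVec.lt_of_top_lt ?_), by omega⟩
  rw [ZVec.top_zero]
  omega

theorem NEnd.topC_unbounded (e : φ.NEnd) (k : ℤ) : ∃ g, k ≤ e.topC g := by
  obtain ⟨α, h0, hk⟩ := exists_nonneg_top_ge (n := n) k
  exact ⟨e.elts α, hk.trans (ZVec.top_mono (e.le_c h0))⟩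

/-- To find the point of the ray at time `t` it suffices to know one `f` whose integer product with
the end exceeds the top coordinate of `t`: lexicographically, `t` then precedes the place where the
ray leaves [ε, f · ε]. -/
theorem topC_injective : Function.Injective (NEnd.topC (φ := φ)) := by
  intro e e' h
  rw [← e.toEnd_ray, ← e'.toEnd_ray]
  congr 1
  refine Ray.ext (funext fun t => ?_)
  obtain ⟨f, hf⟩ := e.topC_unbounded ((t : ZVec n).top + 1)
  have h1 : (t : ZVec n).top < (e.c f).top := hf
  have h2 : (t : ZVec n).top < (e'.c f).top := by
    have : e.topC f = e'.topC f := by rw [h]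
    exact lt_of_lt_of_eq h1 this
  have k1 := NEnd.at_ray_of_le (ZVec.lt_of_top_lt h1).le
  have k2 := NEnd.at_ray_of_le (ZVec.lt_of_top_lt h2).le
  refine (k1.eq_iff k2).2 ⟨rfl, ?_⟩
  rw [c_self]
  exact k1.le_len

theorem exists_topC_eq (y : G → ℤ) (hy : IsPointFn φ.topLengthFn y) (hu : ∀ k, ∃ g, k ≤ y g) :
    ∃ e : φ.NEnd, e.topC = y := by
  -- The ray at time `t` follows `H (t.top + 1)`. The added 1 makes top coordinates strictly larger,
  -- hence elements of ℤⁿ larger irrespective of their lower coordinates.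
  choose H hH using hu
  have hc : ∀ s t : ZVec n, s ≤ t → s < φ.c (H (s.top + 1)) (H (t.top + 1)) := by
    intro s t hst
    refine ZVec.lt_of_top_lt (lt_of_lt_of_le ?_ (hy.ultra' _ _))
    have := hH (s.top + 1)
    have := hH (t.top + 1)
    have := ZVec.top_mono hst
    omega
  obtain ⟨γ, hγ⟩ := exists_ray_of_elts (φ := φ) (fun t => H (t.top + 1))
    (fun t _ => (hc t t le_rfl).le.trans (φ.c_le_left _ _)) (fun s t _ hst => (hc s t hst).le)
  refine ⟨γ.toEnd, funext fun h => ?_⟩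
  obtain ⟨α, h0, h1, -⟩ := exists_gt (φ.len h) (φ.len h)
  have hr : γ.toEnd.ray = γ := ray_unique (E' := fun t => H (t.top + 1)) γ.toEnd.at_ray hγ γ.toEnd.toEnd_ray
  have h2 := γ.toEnd.at_ray ⟨α, h0⟩
  rw [hr] at h2
  have h3 := (h2.eq_iff (hγ ⟨α, h0⟩)).1 rfl
  dsimp only at h3
  have h4 : φ.c (H (α.top + 1)) h = γ.toEnd.c h := by
    rw [← γ.toEnd.c_elts h1]
    exact c_eq_of_lt (lt_of_lt_of_le (lt_of_le_of_lt (φ.c_le_right _ _) h1) h3.2)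
  have u1 := hy.ultra (H (α.top + 1)) h
  have u2 := hy.ultra' (H (α.top + 1)) h
  have u3 := hH (α.top + 1)
  have u4 := hy.le_len h
  have u5 := ZVec.top_mono h1.le
  have u6 := ZVec.top_mono (φ.c_le_right (H (α.top + 1)) h)
  rw [topLengthFn_c] at u1 u2
  rw [topLengthFn_len] at u4
  rw [NEnd.topC, ← h4]
  omega

/-- Near an end `e`, the product with `h` is constant on the cone of a point of the ray beyond
`φ.len h`. Conversely, membership in a cone at ⟨α, f⟩ is constant where the integer product with a
single far element `h` keeps its value. -/
theorem inducing_topC : IsInducing (NEnd.topC (φ := φ)) := by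
  refine ⟨le_antisymm ?_ ?_⟩
  · refine continuous_iff_le_induced.1 (continuous_pi fun h => ?_)
    refine continuous_discrete_rng.2 fun k => isOpen_iff_mem_nhds.2 fun e he => ?_
    obtain ⟨α, h0, h1, -⟩ := exists_gt (φ.len h) (φ.len h)
    obtain ⟨x, hx⟩ := exists_at_of_le h0 (e.le_len_elts h0)
    have hopen : IsOpen (φ.cone x) := TopologicalSpace.isOpen_generateFrom_of_mem ⟨x, rfl⟩
    refine mem_of_superset (hopen.mem_nhds ((mem_cone_iff hx e).2 (e.le_c h0))) fun e' he' => ?_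
    have h2 := (mem_cone_iff hx e').1 he'
    have h3 : ∀ e'' : φ.NEnd, α ≤ e''.c (e.elts α) → e''.c h = φ.c (e.elts α) h := fun e'' h'' =>
      NEnd.c_eq_of_lt (lt_of_lt_of_le (lt_of_le_of_lt (φ.c_le_right _ _) h1) h'')
    change (e'.c h).top = k
    rw [h3 e' h2, ← h3 e (e.le_c h0)]
    exact he
  · refine le_generateFrom ?_
    rintro _ ⟨x, rfl⟩
    let _ : TopologicalSpace φ.NEnd := TopologicalSpace.induced NEnd.topC inferInstance
    have hcont : Continuous (NEnd.topC (φ := φ)) := continuous_induced_dom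
    refine isOpen_iff_mem_nhds.2 fun e he => ?_
    obtain ⟨α, f, hx⟩ := exists_at x
    rw [mem_cone_iff hx] at he
    obtain ⟨h, hh⟩ := e.topC_unbounded ((φ.len f).top + 1)
    have h1 : IsOpen {e' : φ.NEnd | e'.topC h = e.topC h} :=
      (isOpen_discrete {e.topC h}).preimage ((continuous_apply h).comp hcont)
    refine mem_of_superset (h1.mem_nhds rfl) fun e' he' => (mem_cone_iff hx e').2 ?_
    have h3 : ∀ e'' : φ.NEnd, (φ.len f).top + 1 ≤ e''.topC h → e''.c f = φ.c h f := fun e'' h'' =>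
      NEnd.c_eq_of_lt (lt_of_le_of_lt (φ.c_le_right _ _) (ZVec.lt_of_top_lt h''))
    rw [h3 e' (hh.trans he'.ge), ← h3 e hh]
    exact he

theorem isEndSpace : IsEndSpace φ.topLengthFn (NEnd.topC (φ := φ)) where
  isPointFn := NEnd.isPointFn
  unbounded := NEnd.topC_unbounded
  injective := topC_injective
  complete := exists_topC_eq
  smul e g h := by
    rw [NEnd.topC, e.c_smul, ZVec.top_sub, ZVec.top_sub, ZVec.top_add, topLengthFn_len]
    rfl
  inducing := inducing_topC

/-! ### The action on the ends is non-elementary -/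

/-- An empty core `u` would leave `d⁻¹ ∘ d` reduced, which forces `d` empty and `g = 1`. At position
`d.len + 1` the words of `g` and `g⁻¹` carry the first letter of `u` and the inverse of its last
letter, which differ by cyclic reducedness. -/
theorem exists_cyclicallyReduced_conj {g : G} (hg : g ≠ 1) : ∃ d u : ZWord n X,
    φ.toWord g = d.inv.concat (u.concat d) ∧ 0 < u.len ∧ φ.c g⁻¹ g ≤ d.len := by
  obtain ⟨d, u, t, ⟨hu, hcyc⟩, ⟨-, -, ht, htu⟩, ⟨-, -, hv, hvt⟩⟩ := φ.isCDR g
  have hd0 := d.len_nonneg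
  have hu0 := u.len_nonneg
  have h1 := ZVec.one_pos n
  have hlen : φ.len g = d.len + (u.len + d.len) := by
    rw [len, hvt, htu]
    rfl
  have hone : ZVec.one n - 0 = ZVec.one n := sub_zero _
  have hlet : ∀ β, (φ.toWord g).letter β = if β ≤ d.len then
      (d.letter (d.len + ZVec.one n - β)).map letterInv
      else if β - d.len ≤ u.len then u.letter (β - d.len) else
        d.letter (β - d.len - u.len) := by
    intro β
    rw [hvt, htu]
    rfl
  refine ⟨d, u, by rw [hvt, htu], ?_⟩
  rcases hu0.eq_or_lt with hz | hpos
  · exfalso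
    rcases hd0.eq_or_lt with hz' | hpos'
    · refine hg (φ.injective ?_)
      have hl0 : φ.len g = 0 := by rw [hlen, ← hz, ← hz']; simp
      have hemp : ∀ w : ZWord n X, w.len = 0 → w.letter = fun _ => none := by
        intro w hw
        funext β
        rw [← Option.not_isSome_iff_eq_none, w.isSome_iff, hw]
        grind
      exact ZWord.ext (hl0.trans φ.len_one.symm) ((hemp _ hl0).trans (hemp _ φ.len_one).symm)
    · refine hv d.len (ZVec.one_le_of_pos hpos') ?_ ?_
      · change d.len < φ.len g
        grind
      · rw [hlet, hlet, if_neg (by grind), if_neg (by grind), if_pos le_rfl, ← hz]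
        have e1 : d.len + ZVec.one n - d.len - 0 = ZVec.one n := by grind
        have e2 : d.len + ZVec.one n - d.len = ZVec.one n := by grind
        rw [e1, e2, map_letterInv_map_letterInv]
  · refine ⟨hpos, ?_⟩
    by_contra hlt
    have h2 := ((φ.le_c_iff g⁻¹ g _).1 le_rfl).2.2 (d.len + ZVec.one n) (by grind) (by
      have := ZVec.one_le_of_pos (sub_pos.2 (not_le.1 hlt))
      grind)
    rw [φ.map_inv] at h2
    change ((φ.toWord g).letter (φ.len g + ZVec.one n - (d.len + ZVec.one n))).map letterInv
      = _ at h2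
    have hul := ZVec.one_le_of_pos hpos
    have e1 : φ.len g + ZVec.one n - (d.len + ZVec.one n) - d.len = u.len := by grind
    have e2 : d.len + ZVec.one n - d.len = ZVec.one n := by grind
    rw [hlet, hlet, if_neg (by grind), e1, if_pos le_rfl, if_neg (by grind), e2,
      if_pos hul] at h2
    refine hcyc hpos ?_
    rw [← h2, map_letterInv_map_letterInv]

/-- This concerns the full ℤⁿ-valued length; the top coordinate of the translation length may still
vanish. -/
theorem hyperbolic_of_ne_one {g : G} (hg : g ≠ 1) : φ.lengthFn.Hyperbolic g := by
  rw [LengthFn.hyperbolic_iff, lengthFn_c, lengthFn_len]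
  obtain ⟨d, u, h, hu, hd⟩ := exists_cyclicallyReduced_conj (φ := φ) hg
  have hlen : φ.len g = d.len + (u.len + d.len) := by
    rw [len, h]
    rfl
  grind

/-- The translation number of `g` towards the end `e`. -/
noncomputable def NEnd.busemann (e : φ.NEnd) (g : G) : ZVec n := φ.len g - (e.c g + e.c g)

theorem NEnd.c_mul_of_fixed {e : φ.NEnd} {g : G} (he : g • e = e) (h : G) :
    e.c (g * h) = e.c h + φ.len g - e.c g⁻¹ - φ.c h g⁻¹ := by
  rw [← e.c_smul, he]

theorem NEnd.c_inv_of_fixed {e : φ.NEnd} {g : G} (he : g • e = e) :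
    e.c g = φ.len g - e.c g⁻¹ := by
  have h := NEnd.c_mul_of_fixed he 1
  rw [mul_one, e.c_one, φ.c_comm, show φ.c g⁻¹ 1 = 0 from φ.lengthFn.c_one _] at h
  grind

theorem NEnd.busemann_mul {e : φ.NEnd} {g : G} (he : g • e = e) (h : G) :
    e.busemann (g * h) = e.busemann g + e.busemann h := by
  have h1 := NEnd.c_mul_of_fixed he h
  have h2 := NEnd.c_inv_of_fixed he
  have h3 := φ.two_c g⁻¹ h
  rw [_root_.inv_inv, φ.len_inv, φ.c_comm] at h3
  unfold busemann
  grind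

/-- Without translation towards `e`, both `g` and `g⁻¹` follow the ray for half of their length, so
`2 c g⁻¹ g ≥ len g` and `g` is not hyperbolic. -/
theorem NEnd.eq_one_of_busemann_eq_zero {e : φ.NEnd} {g : G} (he : g • e = e)
    (h : e.busemann g = 0) : g = 1 := by
  by_contra hg
  have h1 := (φ.lengthFn.hyperbolic_iff g).1 (hyperbolic_of_ne_one hg)
  have h2 := NEnd.c_inv_of_fixed he
  have h3 := e.ultra' g⁻¹ g
  rw [lengthFn_c, lengthFn_len] at h1
  unfold busemann at h
  grind

theorem NEnd.exists_c_elts_lt {e e' : φ.NEnd} (hne : e ≠ e') :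
    ∃ α, 0 ≤ α ∧ φ.c (e.elts α) (e'.elts α) < α := by
  by_contra hcon
  push Not at hcon
  refine hne ?_
  rw [← e.toEnd_ray, ← e'.toEnd_ray]
  congr 1
  exact Ray.ext (funext fun t => ((e.at_ray t).eq_iff (e'.at_ray t)).2 ⟨rfl, hcon t t.2⟩)

/-- The Gromov product of the two distinct ends is finite and does not change when both are moved by
`k`. The change of base point formula then gives `e.c k⁻¹ + e'.c k⁻¹ = len k`: translation towards
one end is translation away from the other. -/
theorem NEnd.busemann_add_eq_zero {e e' : φ.NEnd} {k : G} (hne : e ≠ e') (he : k • e = e)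
    (he' : k • e' = e') : e.busemann k + e'.busemann k = 0 := by
  obtain ⟨α, h0, hα⟩ := NEnd.exists_c_elts_lt hne
  have hl := φ.len_nonneg k
  have hone := ZVec.one_pos n
  have key : ∀ f f' : G, α ≤ e.c f → α ≤ e'.c f' →
      φ.c f f' = φ.c (e.elts α) (e'.elts α) := by
    intro f f' hf hf'
    have h1 : φ.c (e.elts α) (e'.elts α) < φ.c (e.elts α) f :=
      hα.trans_le ((le_min (e.le_c h0) hf).trans (e.ultra' _ _))
    have h2 := WordEmbedding.c_eq_of_lt h1
    have h3 : φ.c (e'.elts α) f < φ.c (e'.elts α) f' := by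
      rw [φ.c_comm _ f, h2]
      exact hα.trans_le ((le_min (e'.le_c h0) hf').trans (e'.ultra' _ _))
    rw [φ.c_comm f, WordEmbedding.c_eq_of_lt h3, φ.c_comm, h2]
  -- Applying `k` lowers a Gromov product with a fixed end by at most `φ.len k`, so approximations
  -- of level β stay beyond α; also β exceeds `φ.len k⁻¹`.
  have hβ : 0 ≤ α + (φ.len k + φ.len k + ZVec.one n) := by grind
  generalize hβ' : α + (φ.len k + φ.len k + ZVec.one n) = β at *
  have m := φ.lengthFn.c_mul_mul k (e.elts β) (e'.elts β)
  simp only [lengthFn_c, lengthFn_len] at m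
  have hk : φ.len k⁻¹ < β := by rw [φ.len_inv]; grind
  rw [e.c_elts hk, e'.c_elts hk] at m
  have mv : ∀ e : φ.NEnd, k • e = e → α ≤ e.c (k * e.elts β) := by
    intro e he
    rw [NEnd.c_mul_of_fixed he, e.c_elts hk]
    have := e.le_c hβ
    have := e.c_le_len k⁻¹
    rw [φ.len_inv] at this
    grind
  rw [key _ _ (mv e he) (mv e' he'), key (e.elts β) (e'.elts β)
    ((show α ≤ β by grind).trans (e.le_c hβ)) ((show α ≤ β by grind).trans (e'.le_c hβ))] at m
  have h2 := NEnd.c_inv_of_fixed he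
  have h2' := NEnd.c_inv_of_fixed he'
  unfold busemann
  grind

theorem NEnd.busemann_smul {e : φ.NEnd} {g k : G} (he : k • e = e) (hgk : g * k = k * g) :
    (g • e).busemann k = e.busemann k := by
  have e1 : g * (k * g⁻¹) = k := by rw [← mul_assoc, hgk, mul_inv_cancel_right]
  have e2 : k * g⁻¹ = g⁻¹ * k := by rw [eq_inv_mul_iff_mul_eq, e1]
  have h1 := e.c_smul g (k * g⁻¹)
  rw [e1, NEnd.c_mul_of_fixed he] at h1
  have h2 := NEnd.c_inv_of_fixed he
  have h3 := φ.two_c (k * g⁻¹) g⁻¹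
  have h4 := φ.two_c g⁻¹ k⁻¹
  have e3 : (k * g⁻¹)⁻¹ * g⁻¹ = k⁻¹ := by rw [e2]; group
  have e4 : g⁻¹⁻¹ * k⁻¹ = (k * g⁻¹)⁻¹ := by group
  rw [e3, φ.len_inv, φ.len_inv] at h3
  rw [e4, φ.len_inv, φ.len_inv, φ.len_inv] at h4
  unfold busemann
  grind

/-- Were `g • e` different from `e`, the power `g ^ N` would fix both, with equal translation
numbers since it commutes with `g`, and with opposite ones since the ends are distinct. So they
vanish and `g ^ N = 1`, contrary to hyperbolicity of `g`. -/
theorem NEnd.smul_eq_of_pow_smul_eq {e : φ.NEnd} {g : G} {N : ℕ} (hN : N ≠ 0)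
    (h : g ^ N • e = e) : g • e = e := by
  by_contra hne
  have hg : g ≠ 1 := fun h1 => hne (by rw [h1, one_smul])
  have hk : g ^ N ≠ 1 := (hyperbolic_of_ne_one (φ := φ) hg).pow_ne_one hN
  have hc : g * g ^ N = g ^ N * g := (pow_succ' g N).symm.trans (pow_succ g N)
  have h' : g ^ N • g • e = g • e := by rw [← mul_smul, ← hc, mul_smul, h]
  have h1 := NEnd.busemann_add_eq_zero hne h' h
  rw [NEnd.busemann_smul h hc] at h1
  exact hk (NEnd.eq_one_of_busemann_eq_zero h (by grind))

/-- If `G` has a finite invariant set of ends, then it is abelian. -/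
theorem mul_comm_of_finite_invariant {F : Set φ.NEnd} (hF : F.Finite) (hne : F.Nonempty)
    (hinv : ∀ g : G, ∀ e ∈ F, g • e ∈ F) (a b : G) : a * b = b * a := by
  obtain ⟨e, he⟩ := hne
  have hfix : ∀ g : G, g • e = e := by
    intro g
    have hmaps : Set.MapsTo (fun k : ℕ => g ^ k • e) Set.univ F := fun k _ => hinv _ _ he
    obtain ⟨i, -, j, -, hij, heq⟩ := Set.infinite_univ.exists_ne_map_eq_of_mapsTo hmaps hF
    wlog hlt : i < j generalizing i j
    · exact this j i hij.symm heq.symm (lt_of_le_of_ne (not_lt.1 hlt) hij.symm)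
    refine NEnd.smul_eq_of_pow_smul_eq (N := j - i) (by omega) ?_
    have e1 : g ^ j = g ^ i * g ^ (j - i) := by rw [← pow_add]; congr 1; omega
    rw [e1, mul_smul] at heq
    exact (MulAction.injective (g ^ i) heq).symm
  have hz : e.busemann 1 = 0 := by
    have := NEnd.busemann_mul (hfix 1) 1
    rw [mul_one] at this
    grind
  have hinv : ∀ g, e.busemann g⁻¹ = - e.busemann g := by
    intro g
    have := NEnd.busemann_mul (hfix g) g⁻¹
    rw [mul_inv_cancel, hz] at this
    grind
  -- All of `G` fixes `e`, so the Busemann function is a homomorphism to an abelian group; it kills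
  -- this element and has trivial kernel.
  have h1 : a * b * (b * a)⁻¹ = 1 := by
    refine NEnd.eq_one_of_busemann_eq_zero (hfix _) ?_
    rw [NEnd.busemann_mul (hfix _), NEnd.busemann_mul (hfix _), hinv, NEnd.busemann_mul (hfix _)]
    grind
  exact mul_inv_eq_one.1 h1

end WordEmbedding
-- The monoid of words, tripods and the four-point condition
namespace ZWord

variable {n : ℕ} [NeZero n] {X : Type*}

theorem letter_eq_none {u : ZWord n X} {β : ZVec n} (h : ¬ (ZVec.one n ≤ β ∧ β ≤ u.len)) :
    u.letter β = none := by
  rwa [← Option.not_isSome_iff_eq_none, u.isSome_iff]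

theorem eq_of_len_eq_zero {u v : ZWord n X} (hu : u.len = 0) (hv : v.len = 0) : u = v := by
  have h := ZVec.one_pos n
  refine ZWord.ext (hu.trans hv.symm) (funext fun β => ?_)
  rw [letter_eq_none (by grind), letter_eq_none (by grind)]

/-- Words form a monoid under concatenation. -/
noncomputable instance : Monoid (ZWord n X) where
  mul := concat
  one := ⟨0, fun _ => none, le_rfl, fun β => by
    have h := ZVec.one_pos n
    simp only [Option.isSome_none, Bool.false_eq_true, false_iff]
    grind⟩
  mul_assoc u v w := by
    have hu := u.len_nonneg
    have hv := v.len_nonneg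
    refine ZWord.ext (add_assoc _ _ _) (funext fun β => ?_)
    change (if β ≤ u.len + v.len then if β ≤ u.len then u.letter β else v.letter (β - u.len)
      else w.letter (β - (u.len + v.len))) = if β ≤ u.len then u.letter β else
        if β - u.len ≤ v.len then v.letter (β - u.len) else w.letter (β - u.len - v.len)
    have e : β - (u.len + v.len) = β - u.len - v.len := by grind
    rw [e]
    by_cases h1 : β ≤ u.len
    · rw [if_pos h1, if_pos h1, if_pos (by grind)]
    · rw [if_neg h1, if_neg h1]
      by_cases h2 : β - u.len ≤ v.len
      · rw [if_pos h2, if_pos (by grind)]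
      · rw [if_neg h2, if_neg (by grind)]
  one_mul u := by
    refine ZWord.ext (zero_add _) (funext fun β => ?_)
    change (if β ≤ 0 then none else u.letter (β - 0)) = u.letter β
    have h := ZVec.one_pos n
    split_ifs with h1
    · rw [letter_eq_none (by grind)]
    · rw [sub_zero]
  mul_one u := by
    refine ZWord.ext (add_zero _) (funext fun β => ?_)
    change (if β ≤ u.len then u.letter β else none) = u.letter β
    split_ifs with h1
    · rfl
    · rw [letter_eq_none (by grind)]

theorem concat_eq_mul (u v : ZWord n X) : concat u v = u * v := rfl

theorem len_mul (u v : ZWord n X) : (u * v).len = u.len + v.len := rfl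

theorem len_one : (1 : ZWord n X).len = 0 := rfl

theorem len_inv (u : ZWord n X) : u.inv.len = u.len := rfl

theorem eq_one_of_len_eq_zero {u : ZWord n X} (h : u.len = 0) : u = 1 :=
  eq_of_len_eq_zero h len_one

theorem letter_mul (u v : ZWord n X) (β : ZVec n) :
    (u * v).letter β = if β ≤ u.len then u.letter β else v.letter (β - u.len) := rfl

theorem letter_mul_of_le (u v : ZWord n X) {β : ZVec n} (h : β ≤ u.len) :
    (u * v).letter β = u.letter β := if_pos h

theorem letter_mul_add (u v : ZWord n X) {β : ZVec n} (h : 0 < β) :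
    (u * v).letter (u.len + β) = v.letter β := by
  rw [letter_mul, if_neg (by grind), add_sub_cancel_left]

theorem letter_inv (u : ZWord n X) (β : ZVec n) :
    u.inv.letter β = (u.letter (u.len + ZVec.one n - β)).map letterInv := rfl

theorem inv_one : (1 : ZWord n X).inv = 1 := eq_one_of_len_eq_zero rfl

theorem inv_mul (u v : ZWord n X) : (u * v).inv = v.inv * u.inv := by
  have hu := u.len_nonneg
  have hv := v.len_nonneg
  have h1 := ZVec.one_pos n
  refine ZWord.ext (add_comm _ _) (funext fun β => ?_)
  rw [letter_inv, letter_mul, letter_mul, letter_inv, letter_inv, len_mul, len_inv]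
  by_cases h : ZVec.one n ≤ β ∧ β ≤ u.len + v.len
  · by_cases hβ : β ≤ v.len
    · have h2 : ¬ (u.len + v.len + ZVec.one n - β ≤ u.len) := fun h3 => by
        have : ZVec.one n ≤ 0 := by grind
        exact absurd h1 (not_lt.2 this)
      rw [if_pos hβ, if_neg h2]
      congr 2
      grind
    · have h2 : ZVec.one n ≤ β - v.len := ZVec.one_le_of_pos (by grind)
      rw [if_neg hβ, if_pos (by grind)]
      congr 2
      grind
  · have e1 : ∀ w : ZWord n X, ∀ γ, (¬ (ZVec.one n ≤ γ ∧ γ ≤ w.len)) →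
        (w.letter γ).map letterInv = none := fun w γ hγ => by
      rw [letter_eq_none hγ, Option.map_none]
    split_ifs with h2 h3 h3 <;> rw [e1 _ _ (by grind), e1 _ _ (by grind)]

theorem mul_inj_of_len_eq {a b a' b' : ZWord n X} (h : a * b = a' * b') (hl : a.len = a'.len) :
    a = a' ∧ b = b' := by
  have hlen : a.len + b.len = a'.len + b'.len := congrArg len h
  have ha := a.len_nonneg
  have hlet : ∀ β, (a * b).letter β = (a' * b').letter β := fun β => by rw [h]
  have h1 := ZVec.one_pos n
  refine ⟨ZWord.ext hl (funext fun β => ?_), ZWord.ext (by grind) (funext fun β => ?_)⟩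
  · by_cases hβ : β ≤ a.len
    · rw [← letter_mul_of_le a b hβ, hlet, letter_mul_of_le _ _ (by rwa [← hl])]
    · rw [letter_eq_none (by grind), letter_eq_none (by grind)]
  · by_cases hβ : ZVec.one n ≤ β
    · rw [← letter_mul_add a b (h1.trans_le hβ), hlet, hl, letter_mul_add _ _ (h1.trans_le hβ)]
    · rw [letter_eq_none (by grind), letter_eq_none (by grind)]

theorem mul_left_cancel' {a b b' : ZWord n X} (h : a * b = a * b') : b = b' :=
  (mul_inj_of_len_eq h rfl).2

theorem exists_split (w : ZWord n X) {k : ZVec n} (h0 : 0 ≤ k) (hk : k ≤ w.len) :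
    ∃ a b : ZWord n X, w = a * b ∧ a.len = k := by
  have h1 := ZVec.one_pos n
  let a : ZWord n X := ⟨k, fun β => if β ≤ k then w.letter β else none, h0, fun β => by
    split_ifs with h
    · rw [w.isSome_iff]
      grind
    · simp [h]⟩
  let b : ZWord n X := ⟨w.len - k, fun β => if 0 < β then w.letter (k + β) else none, by grind,
    fun β => by
      split_ifs with h
      · rw [w.isSome_iff]
        have := ZVec.one_le_of_pos h
        grind
      · simp only [Option.isSome_none, Bool.false_eq_true, false_iff]
        grind⟩
  refine ⟨a, b, ZWord.ext ?_ (funext fun β => ?_), rfl⟩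
  · change w.len = k + (w.len - k)
    grind
  · change _ = if β ≤ k then if β ≤ k then w.letter β else none
      else if 0 < β - k then w.letter (k + (β - k)) else none
    split_ifs with h h'
    · rfl
    · congr 1
      grind
    · grind

theorem levi {a b c d : ZWord n X} (h : a * b = c * d) (hl : a.len ≤ c.len) :
    ∃ m, c = a * m ∧ b = m * d := by
  obtain ⟨a', m, hc, ha'⟩ := c.exists_split a.len_nonneg hl
  rw [hc, mul_assoc] at h
  obtain ⟨rfl, hb⟩ := mul_inj_of_len_eq h ha'.symm
  exact ⟨m, hc, hb⟩

theorem Reduced.left {u v : ZWord n X} (h : (u * v).Reduced) : u.Reduced := by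
  intro β h1 h2
  have hv := v.len_nonneg
  have h3 := ZVec.one_le_of_pos (sub_pos.2 h2)
  have h4 := h β h1 (by rw [len_mul]; grind)
  rwa [letter_mul_of_le _ _ h2.le, letter_mul_of_le _ _ (by grind)] at h4

theorem Reduced.right {u v : ZWord n X} (h : (u * v).Reduced) : v.Reduced := by
  intro β h1 h2
  have hu := u.len_nonneg
  have h0 := ZVec.one_pos n
  have h4 := h (u.len + β) (by grind) (by rw [len_mul]; grind)
  rwa [add_assoc, letter_mul_add _ _ (by grind), letter_mul_add _ _ (by grind)] at h4

theorem Reduced.inv {u : ZWord n X} (h : u.Reduced) : u.inv.Reduced := by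
  intro β h1 h2 h3
  rw [len_inv] at h2
  have h0 := ZVec.one_pos n
  have h5 := ZVec.one_le_of_pos (sub_pos.2 h2)
  refine h (u.len - β) (by grind) (by grind) ?_
  have e1 : u.len + ZVec.one n - (β + ZVec.one n) = u.len - β := by grind
  have e2 : u.len - β + ZVec.one n = u.len + ZVec.one n - β := by grind
  rw [letter_inv, letter_inv, map_letterInv_map_letterInv, e1] at h3
  rw [e2, h3]

theorem reduced_inv_iff {u : ZWord n X} : u.inv.Reduced ↔ u.Reduced :=
  ⟨fun h => inv_inv u ▸ h.inv, Reduced.inv⟩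

/-- A common first letter of `p` and `q` would cancel at the junction of `p⁻¹` and `q`. -/
theorem Reduced.noCommonStart {p q : ZWord n X} (h : (p.inv * q).Reduced) : NoCommonStart p q := by
  rintro x ⟨h1, h2⟩
  have h0 := ZVec.one_pos n
  have hp : ZVec.one n ≤ p.len := ((p.isSome_iff _).1 (by rw [h1]; rfl)).2
  have hq : ZVec.one n ≤ q.len := ((q.isSome_iff _).1 (by rw [h2]; rfl)).2
  have e : p.len + ZVec.one n - p.len = ZVec.one n := by grind
  refine h p.inv.len hp (by rw [len_mul]; grind) ?_
  rw [letter_mul_add _ _ h0, letter_mul_of_le _ _ le_rfl, letter_inv, len_inv, e, h1, h2,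
    map_letterInv_map_letterInv]

theorem eq_one_of_reduced {m p q : ZWord n X} (h : ((m * p).inv * (m * q)).Reduced) : m = 1 := by
  by_contra hm
  have hpos : 0 < m.len := lt_of_le_of_ne m.len_nonneg fun e => hm (eq_one_of_len_eq_zero e.symm)
  have h1 := ZVec.one_le_of_pos hpos
  obtain ⟨x, hx⟩ := Option.isSome_iff_exists.1 ((m.isSome_iff _).2 ⟨le_rfl, h1⟩)
  exact h.noCommonStart x ⟨by rw [letter_mul_of_le _ _ h1, hx], by rw [letter_mul_of_le _ _ h1, hx]⟩

/-- If `m` and `m'` are initial segments of the same word, they start with the same letter, unless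
one of them is empty. -/
theorem eq_one_or_eq_one_of_reduced {m m' p q s t : ZWord n X} (hst : m * s = m' * t)
    (h : ((m * p).inv * (m' * q)).Reduced) : m = 1 ∨ m' = 1 := by
  rcases le_total m.len m'.len with hl | hl
  · obtain ⟨k, rfl, -⟩ := levi hst hl
    rw [mul_assoc] at h
    exact Or.inl (eq_one_of_reduced h)
  · obtain ⟨k, rfl, -⟩ := levi hst.symm hl
    rw [mul_assoc] at h
    exact Or.inr (eq_one_of_reduced h)

/-- `u`, `v` and `w` are the labels of the sides of a tripod with legs `p`, `q`, `r`. -/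
structure Tripod (u v w p q r : ZWord n X) : Prop where
  fst : u = p.inv * q
  snd : v = q.inv * r
  trd : w = p.inv * r

/-- A symmetric form of the partial product: a tripod with three reduced sides. Permuting the legs
gives the rules `IsProd.inv`, `IsProd.inv_left` and `IsProd.inv_right`. -/
theorem isProd_iff {u v w : ZWord n X} : IsProd u v w ↔
    (u.Reduced ∧ v.Reduced ∧ w.Reduced) ∧ ∃ p q r, Tripod u v w p q r := by
  constructor
  · rintro ⟨a, p, r, ⟨-, -, hu, hua⟩, ⟨-, -, hv, hva⟩, -, -, -, hw, hwa⟩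
    refine ⟨⟨reduced_inv_iff.1 hu, hv, hw⟩, p, a.inv, r, ?_, ?_, hwa⟩
    · rw [← inv_mul, ← concat_eq_mul, ← hua, inv_inv]
    · rw [inv_inv, hva, concat_eq_mul]
  · rintro ⟨⟨hu, hv, hw⟩, p, q, r, rfl, rfl, rfl⟩
    refine ⟨q.inv, p, r, ⟨hv.left, ?_, hu.inv, ?_⟩, ⟨hv.left, hv.right, hv, rfl⟩,
      hw.noCommonStart, hw.left, hw.right, hw, rfl⟩
    · exact reduced_inv_iff.1 hu.left
    · rw [inv_mul, inv_inv, concat_eq_mul]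

theorem IsProd.inv {u v w : ZWord n X} (h : IsProd u v w) : IsProd v.inv u.inv w.inv := by
  rw [isProd_iff] at *
  obtain ⟨⟨hu, hv, hw⟩, p, q, r, rfl, rfl, rfl⟩ := h
  exact ⟨⟨hv.inv, hu.inv, hw.inv⟩, r, q, p, by rw [inv_mul, inv_inv], by rw [inv_mul, inv_inv],
    by rw [inv_mul, inv_inv]⟩

theorem IsProd.inv_left {u v w : ZWord n X} (h : IsProd u v w) : IsProd u.inv w v := by
  rw [isProd_iff] at *
  obtain ⟨⟨hu, hv, hw⟩, p, q, r, rfl, rfl, rfl⟩ := h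
  exact ⟨⟨hu.inv, hw, hv⟩, q, p, r, by rw [inv_mul, inv_inv], rfl, rfl⟩

theorem IsProd.inv_right {u v w : ZWord n X} (h : IsProd u v w) : IsProd w v.inv u := by
  rw [isProd_iff] at *
  obtain ⟨⟨hu, hv, hw⟩, p, q, r, rfl, rfl, rfl⟩ := h
  exact ⟨⟨hw, hv.inv, hu⟩, p, r, q, rfl, by rw [inv_mul, inv_inv], rfl⟩

/-- Two tripods on the same `u` and `v` differ by moving the centre along their common part; a
nonempty shift `m` would cancel in the third side. -/
theorem IsProd.unique {u v w w' : ZWord n X} (h : IsProd u v w) (h' : IsProd u v w') : w = w' := by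
  rw [isProd_iff] at *
  obtain ⟨⟨-, -, hw⟩, p, q, r, hu, hv, rfl⟩ := h
  obtain ⟨⟨-, -, hw'⟩, p', q', r', hu', hv', rfl⟩ := h'
  wlog hl : q.len ≤ q'.len generalizing p q r p' q' r'
  · exact (this p' q' r' hu' hv' hw' p q r hu hv hw (le_of_not_ge hl)).symm
  obtain ⟨m, hm, hr⟩ := levi (hv.symm.trans hv') (show q.inv.len ≤ q'.inv.len from hl)
  have hu2 : q.inv * p = q'.inv * p' := by
    rw [← inv_inv p, ← inv_mul, ← hu, hu', inv_mul, inv_inv]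
  rw [hm, mul_assoc] at hu2
  have hp := mul_left_cancel' hu2
  rw [hp, hr] at hw
  obtain rfl := eq_one_of_reduced hw
  rw [hp, hr, one_mul, one_mul]

theorem Tripod.eqs {u v w p q r : ZWord n X} (h : Tripod u v w p q r) : u.inv = q.inv * p := by
  rw [h.fst, inv_mul, inv_inv]

/-- Four points of which three triangles have labelled sides span a labelled tetrahedron, and the
lengths of its sides satisfy the four-point condition. -/
theorem IsProd.assoc {u v w x y z : ZWord n X} (h₁ : IsProd u v x) (h₂ : IsProd v w y)
    (h₃ : IsProd u y z) : IsProd x w z ∧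
      u.len + w.len ≤ max (x.len + y.len) (z.len + v.len) ∧
      x.len + y.len ≤ max (u.len + w.len) (z.len + v.len) ∧
      z.len + v.len ≤ max (u.len + w.len) (x.len + y.len) := by
  rw [isProd_iff] at *
  obtain ⟨⟨-, -, hx⟩, p₀, p₁, p₂, t₁⟩ := h₁
  obtain ⟨⟨-, hw, -⟩, q₁, q₂, q₃, t₂⟩ := h₂
  obtain ⟨⟨-, -, hz⟩, s₀, s₁, s₃, t₃⟩ := h₃
  have hv := t₁.snd.symm.trans t₂.fst
  have hy := t₂.trd.symm.trans t₃.snd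
  have hu := t₁.eqs.symm.trans t₃.eqs
  have hx' := hx
  have hw' := hw
  have hz' := hz
  rw [t₁.trd] at hx'
  rw [t₂.snd] at hw'
  rw [t₃.trd] at hz'
  have lu : u.len = p₁.inv.len + p₀.len := by rw [t₁.fst, len_mul, len_inv, len_inv, add_comm]
  have lv : v.len = q₁.inv.len + q₂.len := by rw [t₂.fst, len_mul]
  have lw : w.len = q₂.len + q₃.len := by rw [t₂.snd, len_mul, len_inv]
  have lx : x.len = p₀.len + p₂.len := by rw [t₁.trd, len_mul, len_inv]
  have ly : y.len = q₁.inv.len + q₃.len := by rw [t₂.trd, len_mul]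
  have lz : z.len = s₀.len + s₃.len := by rw [t₃.trd, len_mul, len_inv]
  rw [lu, lv, lw, lx, ly, lz]
  have fin : ∀ {p q r : ZWord n X}, p₀.inv * p₂ = p.inv * q → q₂.inv * q₃ = q.inv * r →
      s₀.inv * s₃ = p.inv * r → (x.Reduced ∧ w.Reduced ∧ z.Reduced) ∧
        ∃ p q r, Tripod x w z p q r := fun {p q r} h1 h2 h3 =>
    ⟨⟨hx, hw, hz⟩, p, q, r, t₁.trd.trans h1, t₂.snd.trans h2, t₃.trd.trans h3⟩
  generalize p₁.inv = a at *
  generalize q₁.inv = b at *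
  generalize s₁.inv = d at *
  clear lu lv lw lx ly lz t₁ t₂ t₃
  -- Number the vertices 0 to 3, with sides `u` = 01, `v` = 12, `w` = 23, `x` = 02, `y` = 13, `z` =
  -- 03. The words `a`, `b`, `d` lead from vertex 1 to the branch points of the pairs 02, 23, 03.
  -- Reducedness makes the two shortest of them equal; the three cases are the three shapes of a
  -- tree with four leaves, and `m` labels the inner edge.
  suffices H : (∃ m, q₂ = m * p₂ ∧ s₀ = m * p₀ ∧ s₃ = q₃ ∧ a = b * m ∧ b.len = d.len) ∨
      (∃ m, p₀ = m * s₀ ∧ q₂ = p₂ ∧ q₃ = m * s₃ ∧ d = b * m ∧ a.len = b.len) ∨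
      (∃ m, p₂ = m * q₂ ∧ s₀ = p₀ ∧ s₃ = m * q₃ ∧ b = a * m) by
    rcases H with ⟨m, e1, e2, e3, e4, e5⟩ | ⟨m, e1, e2, e3, e4, e5⟩ | ⟨m, e1, e2, e3, e4⟩
    · refine ⟨fin (p := p₀) (q := p₂) (r := m.inv * q₃) rfl ?_ ?_, ?_⟩
      · rw [e1, inv_mul, mul_assoc]
      · rw [e2, e3, inv_mul, mul_assoc]
      · have := m.len_nonneg
        rw [e1, e2, e3, e4]
        simp only [len_mul]
        clear fin hx' hw' hz' hv hy hu e1 e2 e3 e4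
        grind
    · refine ⟨fin (p := s₀) (q := m.inv * p₂) (r := s₃) ?_ ?_ rfl, ?_⟩
      · rw [e1, inv_mul, mul_assoc]
      · rw [e2, e3, inv_mul, inv_inv, mul_assoc]
      · have := m.len_nonneg
        rw [e1, e2, e3]
        simp only [len_mul]
        clear fin hx' hw' hz' hv hy hu e1 e2 e3 e4
        grind
    · refine ⟨fin (p := m.inv * p₀) (q := q₂) (r := q₃) ?_ rfl ?_, ?_⟩
      · rw [e1, inv_mul, inv_inv, mul_assoc]
      · rw [e2, e3, inv_mul, inv_inv, mul_assoc]
      · have := m.len_nonneg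
        rw [e1, e2, e3, e4]
        simp only [len_mul]
        clear fin hx' hw' hz' hv hy hu e1 e2 e3 e4
        grind
  rcases le_total b.len a.len with h | h
  · obtain ⟨m, ha, hq⟩ := levi hv.symm h
    rcases le_total b.len d.len with h' | h'
    · obtain ⟨m', hd, hq'⟩ := levi hy h'
      rw [ha, hd, mul_assoc, mul_assoc] at hu
      have hu' := mul_left_cancel' hu
      rw [hq, hq'] at hw'
      rcases eq_one_or_eq_one_of_reduced hu' hw' with rfl | rfl
      · exact Or.inr (Or.inl ⟨m', by rw [← hu', one_mul], by rw [hq, one_mul], hq', hd,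
          by rw [ha, mul_one]⟩)
      · exact Or.inl ⟨m, hq, by rw [hu', one_mul], by rw [hq', one_mul], ha, by rw [hd, mul_one]⟩
    · obtain ⟨m', hd, hs⟩ := levi hy.symm h'
      rw [ha, hd, mul_assoc, mul_assoc] at hu
      have hu' := mul_left_cancel' hu
      rw [hs, ← hu'] at hz'
      obtain rfl := eq_one_of_reduced hz'
      exact Or.inl ⟨m, hq, by rw [← hu', one_mul], by rw [hs, one_mul], ha, by rw [hd, mul_one]⟩
  · obtain ⟨m, hb, hp⟩ := levi hv h
    rcases le_total a.len d.len with h' | h'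
    · obtain ⟨m', hd, hp'⟩ := levi hu h'
      rw [hb, hd, mul_assoc, mul_assoc] at hy
      have hy' := mul_left_cancel' hy
      rw [hp, hp'] at hx'
      rcases eq_one_or_eq_one_of_reduced hy'.symm hx' with rfl | rfl
      · exact Or.inr (Or.inr ⟨m, hp, by rw [hp', one_mul], by rw [hy', one_mul], hb⟩)
      · rw [mul_one] at hb
        exact Or.inr (Or.inl ⟨m', hp', by rw [hp, one_mul], by rw [← hy', one_mul], by rw [hd, hb],
          by rw [hb]⟩)
    · obtain ⟨m', hd, hs⟩ := levi hu.symm h'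
      rw [hb, hd, mul_assoc, mul_assoc] at hy
      have hy' := mul_left_cancel' hy
      rw [hs, ← hy'] at hz'
      obtain rfl := eq_one_of_reduced hz'
      exact Or.inr (Or.inr ⟨m, hp, by rw [hs, one_mul], by rw [← hy', one_mul], hb⟩)

/-- If `u * v` is defined, so is the product of `u` with an initial segment of `v`. -/
theorem IsProd.exists_of_prefix {u p q x : ZWord n X} (h : IsProd u (p * q) x) :
    ∃ y, IsProd u p y := by
  simp only [isProd_iff] at *
  obtain ⟨⟨hu, hv, hx⟩, a, b, r, t⟩ := h
  have hs := t.snd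
  rcases le_total b.inv.len p.len with hl | hl
  · obtain ⟨m, rfl, rfl⟩ := levi hs.symm hl
    have hx' := hx
    rw [t.trd, ← mul_assoc] at hx'
    exact ⟨a.inv * m, ⟨hu, hv.left, hx'.left⟩, a, b, m, t.fst, rfl, rfl⟩
  · obtain ⟨m, hm, rfl⟩ := levi hs hl
    have hu' : u = a.inv * m.inv * p.inv := by
      rw [t.fst, ← inv_inv b, hm, inv_mul, mul_assoc]
    have hu'' := hu
    rw [hu'] at hu''
    exact ⟨a.inv * m.inv, ⟨hu, hv.left, hu''.left⟩, m * a, p.inv, 1, by rw [hu', inv_mul],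
      by rw [inv_inv, mul_one], by rw [inv_mul, mul_one]⟩

end ZWord
-- Conjugation by an initial segment and irreducibility
namespace ZWord

variable {n : ℕ} [NeZero n] {X : Type*}

theorem reduced_one : (1 : ZWord n X).Reduced := fun β h1 h2 => by
  have h := ZVec.one_pos n
  rw [len_one] at h2
  grind

theorem isProd_one {u : ZWord n X} (hu : u.Reduced) : IsProd u 1 u :=
  isProd_iff.2 ⟨⟨hu, reduced_one, hu⟩, u.inv, 1, 1, by rw [inv_inv, mul_one],
    by rw [inv_one, mul_one], by rw [inv_inv, mul_one]⟩

theorem isProd_inv_self {u : ZWord n X} (hu : u.Reduced) : IsProd u u.inv 1 :=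
  isProd_iff.2 ⟨⟨hu, hu.inv, reduced_one⟩, 1, u, 1, by rw [inv_one, one_mul],
    by rw [mul_one], by rw [inv_one, mul_one]⟩

theorem IsProd.reduced {u v w : ZWord n X} (h : IsProd u v w) :
    u.Reduced ∧ v.Reduced ∧ w.Reduced := (isProd_iff.1 h).1

theorem isCDR_one : (1 : ZWord n X).IsCDR :=
  ⟨1, 1, 1, ⟨reduced_one, fun h => absurd h (lt_irrefl _)⟩,
    ⟨reduced_one, reduced_one, reduced_one, by rw [concat_eq_mul, mul_one]⟩,
    ⟨reduced_one.inv, reduced_one, reduced_one, by rw [concat_eq_mul, inv_one, mul_one]⟩⟩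

/-- If `v * v` is defined and longer than `v`, then `v` is conjugate to a cyclically reduced
word. -/
theorem IsProd.isCDR {v w : ZWord n X} (h : IsProd v v w) (hl : v.len < w.len) : v.IsCDR := by
  obtain ⟨⟨hv, -, hw⟩, p, q, s, t⟩ := isProd_iff.1 h
  have l1 : v.len = p.len + q.len := by rw [t.fst, len_mul, len_inv]
  have l2 : v.len = q.len + s.len := by rw [t.snd, len_mul, len_inv]
  have l3 : w.len = p.len + s.len := by rw [t.trd, len_mul, len_inv]
  -- The length hypothesis says that the cancelled leg `q` is shorter than `p`. Hence `v = q⁻¹ m q`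
  -- and `w = q⁻¹ m m q`; reducedness of `m m` means that `m` is cyclically reduced.
  obtain ⟨m, hp, hs⟩ := levi (t.snd.symm.trans t.fst) (show q.inv.len ≤ p.inv.len by
    rw [len_inv, len_inv]
    grind)
  have hvq : v = q.inv * (m * q) := by rw [t.snd, hs]
  have hmm : (m.inv.inv * m).Reduced := by
    have hw' := hw
    rw [t.trd, hp, hs, ← mul_assoc, mul_assoc q.inv] at hw'
    rw [inv_inv]
    exact hw'.left.right
  rw [hvq] at hv
  refine ⟨q, m, m * q, ⟨hv.right.left, fun hpos heq => ?_⟩,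
    ⟨hv.right.left, hv.right.right, hv.right, rfl⟩, ?_⟩
  · have h1 := ZVec.one_le_of_pos hpos
    obtain ⟨x, hx⟩ := Option.isSome_iff_exists.1 ((m.isSome_iff _).2 ⟨le_rfl, h1⟩)
    refine hmm.noCommonStart x ⟨?_, hx⟩
    rw [letter_inv, add_sub_cancel_right, ← heq, map_letterInv_map_letterInv, hx]
  · rw [hvq]
    exact ⟨hv.left, hv.right, hv, rfl⟩

end ZWord

namespace WordEmbedding

open ZWord

variable {n : ℕ} [NeZero n] {X G : Type*} [Group G] {φ : WordEmbedding n X G}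

theorem toWord_one : φ.toWord 1 = 1 := eq_one_of_len_eq_zero φ.len_one

/-- Words labelling the segments from a point `m` to the points `g · ε` and `g · m`. -/
theorem exists_conj {r q : ZWord n X} {f : G} (hf : φ.toWord f = r.inv * q) :
    ∃ A B : G → ZWord n X, (∀ g, IsProd r (φ.toWord g) (A g)) ∧
      (∀ g, IsProd (A g) r.inv (B g)) ∧ (∀ g h, IsProd (A g) (φ.toWord h) (A (g * h))) ∧
      (∀ g h, IsProd (B g) (A h) (A (g * h))) ∧ (∀ g h, IsProd (B g) (B h) (B (g * h))) ∧
      A 1 = r ∧ A f = q ∧ B 1 = 1 := by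
  have hfr : (r.inv * q).Reduced := hf ▸ (φ.map_mul f 1).reduced.1
  have hr : r.Reduced := reduced_inv_iff.1 hfr.left
  -- The product of `g⁻¹` with `f = r⁻¹ q` is defined, hence so is the one with its initial segment
  -- `r⁻¹`; inverting gives `r * g`.
  have hA : ∀ g, ∃ a, IsProd r (φ.toWord g) a := fun g => by
    have h := φ.map_mul g⁻¹ f
    rw [hf] at h
    obtain ⟨y, hy⟩ := h.exists_of_prefix
    have hy' := hy.inv
    rw [ZWord.inv_inv, φ.map_inv, ZWord.inv_inv] at hy'
    exact ⟨_, hy'⟩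
  choose A hA using hA
  have h2 : ∀ g h, IsProd (A g) (φ.toWord h) (A (g * h)) := fun g h =>
    ((hA g).assoc (φ.map_mul g h) (hA _)).1
  have hB : ∀ g, ∃ b, IsProd (A g) r.inv b := fun g => by
    have h := h2 g f
    rw [hf] at h
    exact h.exists_of_prefix
  choose B hB using hB
  have h4 : ∀ g h, IsProd (B g) (A h) (A (g * h)) := fun g h =>
    ((hB g).assoc (hA h).inv_left (h2 g h)).1
  have h5 : ∀ g h, IsProd (B g) (B h) (B (g * h)) := fun g h =>
    ((h4 g h).inv_right.assoc (hB h).inv_left (hB _)).1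
  have e1 : A 1 = r := by
    have := hA 1
    rw [toWord_one] at this
    exact this.unique (isProd_one hr)
  refine ⟨A, B, hA, hB, h2, h4, h5, e1, ?_, ?_⟩
  · have h6 := hA f
    refine h6.unique (isProd_iff.2 ⟨⟨hr, h6.reduced.2.1, hfr.right⟩, 1, r, q, ?_, hf, ?_⟩)
    · rw [ZWord.inv_one, one_mul]
    · rw [ZWord.inv_one, one_mul]
  · have h6 := hB 1
    rw [e1] at h6
    exact h6.unique (isProd_inv_self hr)

/-- The conjugate of `G` by an initial segment of an element of `G` is again a subgroup of
`CDR(ℤⁿ, X)`. -/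
theorem exists_conj_embedding {r : ZWord n X} {A B : G → ZWord n X} (h1 : ∀ g, IsProd r (φ.toWord g) (A g))
    (h3 : ∀ g, IsProd (A g) r.inv (B g)) (h2 : ∀ g h, IsProd (A g) (φ.toWord h) (A (g * h)))
    (h4 : ∀ g h, IsProd (B g) (A h) (A (g * h))) (h5 : ∀ g h, IsProd (B g) (B h) (B (g * h)))
    (eA : A 1 = r) (eB : B 1 = 1) : ∃ ψ : WordEmbedding n X G, ψ.toWord = B := by
  refine ⟨⟨B, fun g h e => ?_, fun g => ?_, h5, fun g => ?_⟩, rfl⟩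
  · have k1 := h4 g 1
    have k2 := h4 h 1
    rw [mul_one] at k1 k2
    rw [e] at k1
    have k3 := (h1 g).inv_left
    rw [k1.unique k2] at k3
    exact φ.injective (k3.unique (h1 h).inv_left)
  · by_cases hg : g = 1
    · rw [hg, eB]
      exact isCDR_one
    -- It suffices that `g` is hyperbolic as seen from the new base point `m`. The lengths of `A`
    -- and `B` are distances from `m` to orbit points of `ε` and of `m`; if `B (g * g)` were no
    -- longer than `B g`, the four-point conditions `q1` to `q4` would contradict `len g < len (g *
    -- g)`.
    refine (h5 g g).isCDR ?_
    by_contra hle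
    have hyp : φ.len g < φ.len (g * g) := by
      have := hyperbolic_of_ne_one (φ := φ) hg
      rwa [LengthFn.Hyperbolic, lengthFn_len, lengthFn_len] at this
    have k1 := h4 (g * g) g⁻¹
    rw [mul_inv_cancel_right] at k1
    have k2 := h2 g⁻¹ (g * g)
    rw [inv_mul_cancel_left] at k2
    have k3 := h2 g⁻¹ g
    rw [inv_mul_cancel, eA] at k3
    have q1 := ((h3 g).inv_left.assoc (h5 g g) k1.inv_right.inv_left).2.2.2
    have q2 := ((h4 g g).inv_right.inv_left.assoc (h5 g g) (h3 (g * g)).inv_left).2.1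
    have q3 := ((h1 g).assoc (φ.map_mul g g) (h1 _)).2.2.1
    have q4 := (k3.assoc (φ.map_mul g g) k2).2.2.1
    simp only [ZWord.len_inv] at q1 q2
    change _ + φ.len (g * g) ≤ max (_ + φ.len g) (_ + φ.len g) at q3
    change _ + φ.len (g * g) ≤ max (_ + φ.len g) (_ + φ.len g) at q4
    generalize (A g).len = a1 at *
    generalize (A (g * g)).len = a2 at *
    generalize (A g⁻¹).len = a3 at *
    generalize (B g).len = b1 at *
    generalize (B (g * g)).len = b2 at *
    generalize φ.len g = l1 at *
    generalize φ.len (g * g) = l2 at *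
    generalize r.len = a0 at *
    clear * - q1 q2 q3 q4 hyp hle
    rcases le_total a1 a0 with h | h
    · have : a3 ≤ a0 := by grind
      grind
    · have : a2 ≤ a1 := by grind
      grind
  · have k := h5 g g⁻¹
    rw [mul_inv_cancel, eB] at k
    exact k.inv_left.unique (isProd_one k.reduced.1.inv)

/-- If the vertex at the middle of a longest segment `[ε, f · ε]` is fixed, `G` is reducible. -/
theorem not_irreducible_of_len_le {r q : ZWord n X} {f : G} (hf : φ.toWord f = r.inv * q)
    (hr : r.len.top + r.len.top = (φ.len f).top) (hmax : ∀ g, (φ.len g).top ≤ (φ.len f).top) :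
    ¬ φ.Irreducible := by
  obtain ⟨A, B, h1, h3, h2, h4, h5, eA, eAf, eB⟩ := exists_conj hf
  obtain ⟨ψ, hψ⟩ := exists_conj_embedding h1 h3 h2 h4 h5 eA eB
  have hq : q.len.top = r.len.top := by
    have : (φ.len f).top = r.len.top + q.len.top := by
      rw [← ZVec.top_add, len, hf, len_mul, ZWord.len_inv]
    omega
  -- No orbit point of `ε` is farther from the middle `m` than half of [ε, f · ε]: otherwise one of
  -- the distances from it to `ε` and to `f · ε` would exceed the maximal top length.
  have hA : ∀ g, (A g).len.top ≤ r.len.top := fun g => by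
    have k := φ.map_mul f (f⁻¹ * g)
    rw [mul_inv_cancel_left] at k
    have k1 := ZVec.top_mono ((h1 f).assoc k (h1 g)).2.2.2
    rw [max_comm, ZVec.top_add] at k1
    rcases max_cases ((A f).len + (φ.toWord g).len) (r.len + (φ.toWord (f⁻¹ * g)).len) with h | h
    · rw [h.1, ZVec.top_add, eAf, hq] at k1
      have := hmax g
      change _ + (φ.len f).top ≤ _ + (φ.len g).top at k1
      omega
    · rw [h.1, ZVec.top_add] at k1
      have := hmax (f⁻¹ * g)
      change _ + (φ.len f).top ≤ _ + (φ.len (f⁻¹ * g)).top at k1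
      omega
  refine fun hirr => hirr ⟨n - 1, Nat.sub_one_lt (NeZero.ne n), r, ?_, ψ, fun g => ?_, fun g => ?_⟩
  · exact (h1 1).reduced.1
  · refine ZVec.inSub_of_top_eq_zero ?_
    rw [hψ]
    refine le_antisymm ?_ (ZVec.top_mono (B g).len_nonneg)
    -- The four-point condition for `m`, `g · ε`, `g f · ε`, `g · m` bounds the top of `(B g).len`
    -- plus that of `φ.len f` by twice the top of `r.len`, which is the top of `φ.len f`.
    have k1 := ZVec.top_mono ((h2 g f).assoc (h1 f).inv_left.inv_right (h3 g)).2.2.2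
    rw [ZVec.top_add, eAf] at k1
    have a1 := hA g
    have a2 := hA (g * f)
    change _ + (φ.len f).top ≤ _ at k1
    rcases max_cases ((A g).len + q.inv.len) ((A (g * f)).len + r.inv.len) with h | h
    · rw [h.1, ZVec.top_add, ZWord.len_inv] at k1
      omega
    · rw [h.1, ZVec.top_add, ZWord.len_inv] at k1
      omega
  · rw [hψ]
    exact ⟨A g, h1 g, h3 g⟩

/-- An irreducible finitely generated group contains an element that acts on the tree of the integer
length function as a translation along an axis. -/
theorem exists_hyperbolic [hfg : Group.FG G] (hirr : φ.Irreducible) :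
    ∃ h, φ.topLengthFn.Hyperbolic h := by
  by_contra hcon
  push Not at hcon
  obtain ⟨S, hS, hfin⟩ := Group.fg_iff.1 hfg
  -- With all elements elliptic, `len_mul_le` extends the bound from the generators to the whole
  -- group. Inserting 1 keeps the set nonempty.
  obtain ⟨f, -, hf⟩ := Set.exists_max_image (insert 1 S) φ.topLengthFn.len (hfin.insert 1)
    ⟨1, Set.mem_insert _ _⟩
  have hmax : ∀ g, φ.topLengthFn.len g ≤ φ.topLengthFn.len f := fun g => by
    have hg : g ∈ Subgroup.closure S := hS ▸ Subgroup.mem_top g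
    induction hg using Subgroup.closure_induction with
    | mem x hx => exact hf x (Set.mem_insert_of_mem _ hx)
    | one => exact hf 1 (Set.mem_insert _ _)
    | mul x y _ _ hx hy =>
      exact (φ.topLengthFn.len_mul_le (hcon x) (hcon y) (hcon _)).trans (max_le hx hy)
    | inv x _ hx => rwa [LengthFn.len_inv]
  simp only [topLengthFn_len] at hmax
  by_cases h1 : f = 1
  · refine not_irreducible_of_len_le (r := 1) (q := 1) (f := f) ?_ ?_ hmax hirr
    · rw [h1, toWord_one, ZWord.inv_one, one_mul]
    · rw [h1, φ.len_one]
      rfl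
  · obtain ⟨d, u, hdu, hu, hd⟩ := exists_cyclicallyReduced_conj (φ := φ) h1
    refine not_irreducible_of_len_le (r := d) (q := u * d) (f := f) hdu ?_ hmax hirr
    -- Ellipticity of `f = d⁻¹ u d` forces the core `u` to have top length 0, so `d` is half of `f`
    -- in the top coordinate.
    have e1 := hcon f
    rw [LengthFn.hyperbolic_iff, topLengthFn_c, topLengthFn_len] at e1
    have e2 := ZVec.top_mono hd
    have e3 := ZVec.top_mono hu.le
    have e4 : (φ.len f).top = d.len.top + (u.len.top + d.len.top) := by
      rw [len, hdu, ← ZVec.top_add, ← ZVec.top_add]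
      rfl
    rw [ZVec.top_zero] at e3
    omega

end WordEmbedding
-- Bounded harmonic functions along the random walk
section RandomWalkLimits

open ProbabilityTheory

variable {G : Type*} [Group G] [MeasurableSpace G]

/-- `f` is `μ`-harmonic: `f x = ∑_s μ(s) f(xs)`. -/
def IsHarmonic (μ : Measure G) (f : G → ℝ) : Prop := ∀ x, ∫ s, f (x * s) ∂μ = f x

/-- The law of a sequence of independent increments. -/
noncomputable def incrementMeasure (μ : Measure G) : Measure (ℕ → G) :=
  Measure.infinitePi fun _ : ℕ => μ

variable [Countable G] [DiscreteMeasurableSpace G] {μ : Measure G} [IsProbabilityMeasure μ]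

instance : IsProbabilityMeasure (incrementMeasure μ) := by
  unfold incrementMeasure
  infer_instance

theorem walk_succ (x : ℕ → G) (i : ℕ) : walk x (i + 1) = walk x i * x i := by
  simp [walk, List.range_succ]

theorem walk_congr {x y : ℕ → G} {i : ℕ} (h : ∀ j < i, x j = y j) : walk x i = walk y i := by
  unfold walk
  congr 1
  exact List.map_congr_left fun j hj => h j (List.mem_range.1 hj)

open Classical in
/-- The position at time `i` as a function of the first `i` increments. -/
noncomputable def position (i : ℕ) (y : Finset.range i → G) : G :=
  walk (fun j => if h : j ∈ Finset.range i then y ⟨j, h⟩ else 1) i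

theorem position_restrict (i : ℕ) (x : ℕ → G) :
    position i ((Finset.range i).restrict x) = walk x i :=
  walk_congr fun j hj => by
    rw [dif_pos (Finset.mem_range.2 hj)]
    rfl

/-- The next increment is independent of the previous ones. -/
theorem integral_step (i : ℕ) (F : (Finset.range i → G) → G → ℝ) {C : ℝ}
    (hC : ∀ y s, |F y s| ≤ C) :
    ∫ x, F ((Finset.range i).restrict x) (x i) ∂(incrementMeasure μ)
      = ∫ x, ∫ s, F ((Finset.range i).restrict x) s ∂μ ∂(incrementMeasure μ) := by
  have hind : IndepFun (fun x : ℕ → G => (Finset.range i).restrict x) (fun x => x i)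
      (incrementMeasure μ) := by
    have h := (iIndepFun_infinitePi (P := fun _ : ℕ => μ) (X := fun _ x => x)
      fun _ => measurable_id).indepFun_finset (Finset.range i) {i} (by simp)
      fun j => measurable_pi_apply j
    have hψ : Measurable fun y : ({i} : Finset ℕ) → G => y ⟨i, Finset.mem_singleton_self i⟩ :=
      measurable_pi_apply _
    exact h.comp measurable_id hψ
  have hY : Measurable fun x : ℕ → G => (Finset.range i).restrict x := Finset.measurable_restrict _
  have hmap := (indepFun_iff_map_prod_eq_prod_map_map hY.aemeasurable
    (measurable_pi_apply i).aemeasurable).1 hind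
  have hμ : (incrementMeasure μ).map (fun x => x i) = μ := Measure.infinitePi_map_eval _ i
  rw [hμ] at hmap
  have : IsProbabilityMeasure ((incrementMeasure μ).map
    fun x : ℕ → G => (Finset.range i).restrict x) := Measure.isProbabilityMeasure_map hY.aemeasurable
  have hF : Measurable (Function.uncurry F) := Measurable.of_discrete
  have h1 := integral_map (μ := incrementMeasure μ)
    (hY.prodMk (measurable_pi_apply i)).aemeasurable (f := Function.uncurry F)
    hF.aestronglyMeasurable
  rw [hmap, integral_prod] at h1
  · rw [integral_map hY.aemeasurable (Measurable.of_discrete).aestronglyMeasurable] at h1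
    exact h1.symm
  · exact Integrable.of_bound hF.aestronglyMeasurable C (ae_of_all _ fun p => hC p.1 p.2)

/-- The one-step Markov property. -/
theorem integral_walk_succ (F : G → ℝ) {C : ℝ} (hC : ∀ x, |F x| ≤ C) (i : ℕ) :
    ∫ x, F (walk x (i + 1)) ∂(incrementMeasure μ)
      = ∫ x, ∫ s, F (walk x i * s) ∂μ ∂(incrementMeasure μ) := by
  have h := integral_step (μ := μ) i (fun y s => F (position i y * s)) fun _ _ => hC _
  simp only [position_restrict] at h
  simpa only [walk_succ] using h

theorem measurable_walk_apply (i : ℕ) : Measurable fun x : ℕ → G => walk x i :=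
  (measurable_pi_apply i).comp measurable_walk

theorem integrable_walk (F : G → ℝ) {C : ℝ} (hC : ∀ x, |F x| ≤ C) (i : ℕ) :
    Integrable (fun x => F (walk x i)) (incrementMeasure μ) :=
  Integrable.of_bound ((Measurable.of_discrete (f := F)).comp
    (measurable_walk_apply i)).aestronglyMeasurable C (ae_of_all _ fun _ => hC _)

theorem integral_harmonic_walk {f : G → ℝ} (hf : IsHarmonic μ f) {C : ℝ} (hC : ∀ x, |f x| ≤ C)
    (i : ℕ) : ∫ x, f (walk x i) ∂(incrementMeasure μ) = f 1 := by
  induction i with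
  | zero => simp [walk]
  | succ i ih =>
    rw [integral_walk_succ f hC]
    simp only [hf _]
    exact ih

/-- The filtration of the increments: at time `i` the first `i` increments are known. -/
def incrementFiltration (G : Type*) [MeasurableSpace G] :
    Filtration ℕ (inferInstance : MeasurableSpace (ℕ → G)) where
  seq i := MeasurableSpace.comap (Finset.range i).restrict inferInstance
  mono' i j hij := by
    rintro _ ⟨B, hB, rfl⟩
    exact ⟨Finset.restrict₂ (π := fun _ => G) (Finset.range_mono hij) ⁻¹' B,
      Finset.measurable_restrict₂ (Finset.range_mono hij) hB, rfl⟩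
  le' i := (Finset.measurable_restrict _).comap_le

theorem martingale_walk {f : G → ℝ} (hf : IsHarmonic μ f) {C : ℝ} (hC : ∀ x, |f x| ≤ C) :
    Martingale (fun i x => f (walk x i)) (incrementFiltration G) (incrementMeasure μ) := by
  have hadp : ∀ i, StronglyMeasurable[incrementFiltration G i] fun x : ℕ → G => f (walk x i) := by
    intro i
    have h : (fun x : ℕ → G => f (walk x i))
        = (fun y => f (position i y)) ∘ (Finset.range i).restrict := by
      funext x
      rw [Function.comp, position_restrict]
    rw [h]
    exact (Measurable.of_discrete (f := fun y => f (position i y))).stronglyMeasurable.comp_measurable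
      (comap_measurable _)
  refine martingale_nat hadp (integrable_walk f hC) fun i => ?_
  refine ae_eq_condExp_of_forall_setIntegral_eq _ (integrable_walk f hC _)
    (fun s _ _ => (integrable_walk f hC i).integrableOn) ?_ (hadp i).aestronglyMeasurable
  rintro _ ⟨B, hB, rfl⟩ -
  have hm : MeasurableSet ((Finset.range i).restrict ⁻¹' B : Set (ℕ → G)) :=
    Finset.measurable_restrict _ hB
  rw [← integral_indicator hm, ← integral_indicator hm]
  have h := integral_step (μ := μ) i
    (fun y s => B.indicator (fun y => f (position i y * s)) y) (C := C) fun y s => by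
      by_cases hy : y ∈ B
      · rw [Set.indicator_of_mem hy]
        exact hC _
      · rw [Set.indicator_of_notMem hy, abs_zero]
        exact (abs_nonneg _).trans (hC 1)
  have e1 : ∀ x : ℕ → G, B.indicator (fun y => f (position i y * x i)) ((Finset.range i).restrict x)
      = ((Finset.range i).restrict ⁻¹' B).indicator (fun x => f (walk x (i + 1))) x := fun x => by
    by_cases hx : (Finset.range i).restrict x ∈ B
    · rw [Set.indicator_of_mem hx, Set.indicator_of_mem (show x ∈ _ ⁻¹' B from hx),
        position_restrict, walk_succ]
    · rw [Set.indicator_of_notMem hx, Set.indicator_of_notMem (show x ∉ _ ⁻¹' B from hx)]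
  have e2 : ∀ x : ℕ → G,
      ∫ s, B.indicator (fun y => f (position i y * s)) ((Finset.range i).restrict x) ∂μ
      = ((Finset.range i).restrict ⁻¹' B).indicator (fun x => f (walk x i)) x := fun x => by
    by_cases hx : (Finset.range i).restrict x ∈ B
    · simp only [Set.indicator_of_mem hx]
      rw [Set.indicator_of_mem (show x ∈ _ ⁻¹' B from hx), position_restrict, hf]
    · simp only [Set.indicator_of_notMem hx]
      rw [Set.indicator_of_notMem (show x ∉ _ ⁻¹' B from hx), integral_zero]
  simp only [e1, e2] at h
  exact h.symm

theorem ae_exists_tendsto_walk {f : G → ℝ} (hf : IsHarmonic μ f) {C : ℝ} (hC : ∀ x, |f x| ≤ C) :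
    ∀ᵐ x ∂(incrementMeasure μ), ∃ c, Tendsto (fun i => f (walk x i)) atTop (𝓝 c) := by
  refine (martingale_walk hf hC).submartingale.exists_ae_tendsto_of_bdd (R := C.toNNReal)
    fun i => (eLpNorm_le_of_ae_bound (ae_of_all _ fun x => hC _)).trans ?_
  simp only [measure_univ, ENNReal.one_rpow, one_mul, ENNReal.ofReal,
    le_refl]

theorem mul_measure_le_integral {F : G → ℝ} (h0 : ∀ x, 0 ≤ F x) {C : ℝ} (hC : ∀ x, |F x| ≤ C)
    (s : G) : μ.real {s} * F s ≤ ∫ t, F t ∂μ := by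
  have hint : Integrable F μ :=
    Integrable.of_bound (Measurable.of_discrete).aestronglyMeasurable C (ae_of_all _ fun _ => hC _)
  have h := setIntegral_le_integral (s := {s}) hint (ae_of_all _ h0)
  rwa [integral_singleton, smul_eq_mul] at h

/-- The squared increments of a bounded harmonic function along the random walk are summable. -/
theorem summable_sq_sub {f : G → ℝ} (hf : IsHarmonic μ f) {C : ℝ} (hC : ∀ x, |f x| ≤ C)
    (hμ : IsNondegenerate μ) (g : G) :
    Summable fun i : ℕ => ∫ x, (f (walk x i * g) - f (walk x i)) ^ 2 ∂(incrementMeasure μ) := by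
  have hbd : ∀ a b : G, |(f a - f b) ^ 2| ≤ (2 * C) ^ 2 := fun a b => by
    rw [abs_of_nonneg (sq_nonneg _)]
    refine sq_le_sq' ?_ ?_ <;>
    · have := abs_le.1 (hC a)
      have := abs_le.1 (hC b)
      linarith
  have hsq : ∀ a : G, |f a ^ 2| ≤ C ^ 2 := fun a => by
    rw [abs_of_nonneg (sq_nonneg _)]
    exact sq_le_sq' (abs_le.1 (hC a)).1 (abs_le.1 (hC a)).2
  -- Orthogonality of martingale increments: the expected squared increments telescope, so their sum
  -- is at most `C ^ 2`.
  have key : ∀ i, ∫ x, ∫ s, (f (walk x i * s) - f (walk x i)) ^ 2 ∂μ ∂(incrementMeasure μ)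
      = ∫ x, f (walk x (i + 1)) ^ 2 ∂(incrementMeasure μ)
        - ∫ x, f (walk x i) ^ 2 ∂(incrementMeasure μ) := fun i => by
    rw [integral_walk_succ (fun y => f y ^ 2) hsq, ← integral_sub]
    · refine integral_congr_ae (ae_of_all _ fun x => ?_)
      have i1 : Integrable (fun s => f (walk x i * s) ^ 2) μ :=
        Integrable.of_bound (Measurable.of_discrete).aestronglyMeasurable _
          (ae_of_all _ fun _ => hsq _)
      have i2 : Integrable (fun s => f (walk x i * s)) μ :=
        Integrable.of_bound (Measurable.of_discrete).aestronglyMeasurable _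
          (ae_of_all _ fun _ => hC _)
      have e : ∀ s, (f (walk x i * s) - f (walk x i)) ^ 2
          = f (walk x i * s) ^ 2 - (2 * f (walk x i)) * f (walk x i * s) + f (walk x i) ^ 2 :=
        fun s => by ring
      simp only [e]
      have i3 : Integrable
          (fun s => f (walk x i * s) ^ 2 - (2 * f (walk x i)) * f (walk x i * s)) μ :=
        i1.sub (i2.const_mul _)
      rw [integral_add i3 (integrable_const _),
        integral_sub i1 (i2.const_mul _), integral_const_mul, hf, integral_const, probReal_univ]
      simp only [smul_eq_mul]
      ring
    · exact integrable_walk (fun y => ∫ s, f (y * s) ^ 2 ∂μ) (C := C ^ 2) (fun y => by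
        rw [abs_of_nonneg (integral_nonneg fun _ => sq_nonneg _)]
        calc ∫ s, f (y * s) ^ 2 ∂μ ≤ ∫ _, C ^ 2 ∂μ := by
              refine integral_mono (Integrable.of_bound
                (Measurable.of_discrete).aestronglyMeasurable _ (ae_of_all _ fun _ => hsq _))
                (integrable_const _) fun s => ?_
              exact (le_abs_self _).trans (hsq _)
          _ = C ^ 2 := by simp) i
    · exact integrable_walk (fun y => f y ^ 2) hsq i
  have hg : g ∈ Subsemigroup.closure {g : G | μ {g} ≠ 0} := by
    rw [show Subsemigroup.closure {g : G | μ {g} ≠ 0} = ⊤ from hμ]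
    exact Subsemigroup.mem_top g
  -- The extra right factor `h` lets the induction over products of elements of the support proceed
  -- one factor at a time.
  suffices H : ∀ h : G,
      (Summable fun i : ℕ => ∫ x, (f (walk x i * h) - f (walk x i)) ^ 2 ∂(incrementMeasure μ)) →
      Summable fun i : ℕ =>
        ∫ x, (f (walk x i * (g * h)) - f (walk x i)) ^ 2 ∂(incrementMeasure μ) by
    have := H 1 (by simp [summable_zero])
    simpa using this
  induction hg using Subsemigroup.closure_induction with
  | mem s hs =>
    intro h hh
    have hs0 : 0 < μ.real {s} := ENNReal.toReal_pos hs (measure_ne_top _ _)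
    -- A nonnegative integral over one step dominates the contribution of the single atom `s`, at
    -- the cost of the factor `1 / μ {s}`.
    have hpt : ∀ H : G → G → ℝ, (∀ a b, 0 ≤ H a b) → (∀ a b, |H a b| ≤ (2 * C) ^ 2) → ∀ i,
        ∫ x, H (walk x i) s ∂(incrementMeasure μ) ≤
          (μ.real {s})⁻¹ * ∫ x, ∫ t, H (walk x i) t ∂μ ∂(incrementMeasure μ) := by
      intro H H0 HC i
      rw [← integral_const_mul]
      have hb : ∀ y, |∫ t, H y t ∂μ| ≤ (2 * C) ^ 2 := fun y => by
        have := norm_integral_le_of_norm_le_const (μ := μ) (f := H y) (ae_of_all _ fun t => HC y t)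
        simpa using this
      refine integral_mono (integrable_walk (fun y => H y s) (fun y => HC y s) i)
        ((integrable_walk (fun y => ∫ t, H y t ∂μ) hb i).const_mul _) fun x => ?_
      dsimp only
      rw [inv_mul_eq_div, le_div_iff₀ hs0, mul_comm]
      exact mul_measure_le_integral (H0 _) (HC _) s
    have hD : Summable fun i : ℕ =>
        ∫ x, (f (walk x i * s) - f (walk x i)) ^ 2 ∂(incrementMeasure μ) := by
      refine Summable.of_nonneg_of_le (fun i => integral_nonneg fun _ => sq_nonneg _)
        (fun i => hpt (fun a b => (f (a * b) - f a) ^ 2) (fun _ _ => sq_nonneg _)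
          (fun _ _ => hbd _ _) i) (Summable.mul_left _ ?_)
      simp only [key]
      refine summable_of_sum_range_le (c := C ^ 2) (fun i => ?_) fun N => ?_
      · rw [← key]
        exact integral_nonneg fun _ => integral_nonneg fun _ => sq_nonneg _
      · rw [Finset.sum_range_sub fun i => ∫ x, f (walk x i) ^ 2 ∂(incrementMeasure μ)]
        have h1 : ∫ x, f (walk x N) ^ 2 ∂(incrementMeasure μ) ≤ C ^ 2 := by
          calc _ ≤ ∫ _, C ^ 2 ∂(incrementMeasure μ) :=
                integral_mono (integrable_walk (fun y => f y ^ 2) hsq N) (integrable_const _)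
                  fun x => (le_abs_self _).trans (hsq _)
            _ = C ^ 2 := by simp
        have h2 : 0 ≤ ∫ x, f (walk x 0) ^ 2 ∂(incrementMeasure μ) :=
          integral_nonneg fun _ => sq_nonneg _
        linarith
    -- Averaging over the step `s` advances the walk to time `i + 1`, so this series is controlled
    -- by the tail of the one given for `h`.
    have hE : Summable fun i : ℕ =>
        ∫ x, (f (walk x i * s * h) - f (walk x i * s)) ^ 2 ∂(incrementMeasure μ) := by
      refine Summable.of_nonneg_of_le (fun i => integral_nonneg fun _ => sq_nonneg _)
        (fun i => hpt (fun a b => (f (a * b * h) - f (a * b)) ^ 2) (fun _ _ => sq_nonneg _)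
          (fun _ _ => hbd _ _) i) (Summable.mul_left _ ?_)
      simp only [← integral_walk_succ (μ := μ) (fun y => (f (y * h) - f y) ^ 2) fun _ => hbd _ _]
      exact (summable_nat_add_iff 1).2 hh
    refine Summable.of_nonneg_of_le (fun i => integral_nonneg fun _ => sq_nonneg _) (fun i => ?_)
      ((hE.mul_left 2).add (hD.mul_left 2))
    rw [← integral_const_mul, ← integral_const_mul, ← integral_add]
    · refine integral_mono (integrable_walk (fun y => (f (y * (s * h)) - f y) ^ 2)
        (fun _ => hbd _ _) i) (integrable_walk (fun y => 2 * (f (y * s * h) - f (y * s)) ^ 2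
          + 2 * (f (y * s) - f y) ^ 2) (C := 2 * (2 * C) ^ 2 + 2 * (2 * C) ^ 2) (fun y => ?_) i)
        fun x => ?_
      · have h1 := hbd (y * s * h) (y * s)
        have h2 := hbd (y * s) y
        rw [abs_of_nonneg (sq_nonneg _)] at h1 h2
        rw [abs_of_nonneg (by positivity)]
        linarith
      · dsimp only
        rw [← mul_assoc]
        nlinarith [sq_nonneg ((f (walk x i * s * h) - f (walk x i * s))
          - (f (walk x i * s) - f (walk x i)))]
    · exact (integrable_walk (fun y => (f (y * s * h) - f (y * s)) ^ 2)
        (fun _ => hbd _ _) i).const_mul _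
    · exact (integrable_walk (fun y => (f (y * s) - f y) ^ 2) (fun _ => hbd _ _) i).const_mul _
  | mul a b _ _ ha hb =>
    intro h hh
    rw [mul_assoc]
    exact ha _ (hb _ hh)

/-- By Tonelli the summable expectations make the series of squares finite almost surely, so its
terms tend to 0. This asymptotic right invariance is what uses nondegeneracy. -/
theorem ae_tendsto_sub_walk {f : G → ℝ} (hf : IsHarmonic μ f) {C : ℝ} (hC : ∀ x, |f x| ≤ C)
    (hμ : IsNondegenerate μ) (g : G) : ∀ᵐ x ∂(incrementMeasure μ),
      Tendsto (fun i => f (walk x i * g) - f (walk x i)) atTop (𝓝 0) := by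
  have hsum := summable_sq_sub hf hC hμ g
  have hm : ∀ i, Measurable fun x : ℕ → G => (f (walk x i * g) - f (walk x i)) ^ 2 := fun i =>
    (Measurable.of_discrete (f := fun y => (f (y * g) - f y) ^ 2)).comp (measurable_walk_apply i)
  have hint : ∀ i, Integrable (fun x : ℕ → G => (f (walk x i * g) - f (walk x i)) ^ 2)
      (incrementMeasure μ) := fun i =>
    integrable_walk (fun y => (f (y * g) - f y) ^ 2) (C := (2 * C) ^ 2) (fun y => by
      rw [abs_of_nonneg (sq_nonneg _)]
      refine sq_le_sq' ?_ ?_ <;>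
      · have := abs_le.1 (hC (y * g))
        have := abs_le.1 (hC y)
        linarith) i
  have hfin : ∫⁻ x, ∑' i, ENNReal.ofReal ((f (walk x i * g) - f (walk x i)) ^ 2)
      ∂(incrementMeasure μ) ≠ ⊤ := by
    rw [lintegral_tsum fun i => (hm i).ennreal_ofReal.aemeasurable]
    have e : ∀ i, ∫⁻ x, ENNReal.ofReal ((f (walk x i * g) - f (walk x i)) ^ 2)
        ∂(incrementMeasure μ)
        = ENNReal.ofReal (∫ x, (f (walk x i * g) - f (walk x i)) ^ 2 ∂(incrementMeasure μ)) :=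
      fun i => (ofReal_integral_eq_lintegral_ofReal (hint i) (ae_of_all _ fun _ => sq_nonneg _)).symm
    simp only [e]
    rw [← ENNReal.ofReal_tsum_of_nonneg (fun i => integral_nonneg fun _ => sq_nonneg _) hsum]
    exact ENNReal.ofReal_ne_top
  filter_upwards [ae_lt_top (Measurable.tsum fun i => (hm i).ennreal_ofReal) hfin] with x hx
  have h1 := ENNReal.tendsto_atTop_zero_of_tsum_ne_top hx.ne
  have h2 : Tendsto (fun i => (f (walk x i * g) - f (walk x i)) ^ 2) atTop (𝓝 0) := by
    have := (ENNReal.tendsto_toReal ENNReal.zero_ne_top).comp h1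
    simpa [Function.comp_def, ENNReal.toReal_ofReal (sq_nonneg _)] using this
  have h3 := h2.sqrt
  simp only [Real.sqrt_sq_eq_abs, Real.sqrt_zero] at h3
  exact (tendsto_zero_iff_abs_tendsto_zero _).2 h3

/-- Almost sure behaviour of a bounded harmonic function along the random walk. -/
theorem ae_pathMeasure_tendsto {f : G → ℝ} (hf : IsHarmonic μ f) {C : ℝ} (hC : ∀ x, |f x| ≤ C)
    (hμ : IsNondegenerate μ) : ∀ᵐ τ ∂(pathMeasure μ),
      (∃ c, Tendsto (fun i => f (τ i)) atTop (𝓝 c)) ∧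
        ∀ g, Tendsto (fun i => f (τ i * g) - f (τ i)) atTop (𝓝 0) := by
  have hm : ∀ (F : G → ℝ) (i : ℕ), Measurable fun τ : ℕ → G => F (τ i) := fun F i =>
    (Measurable.of_discrete (f := F)).comp (measurable_pi_apply i)
  refine Filter.Eventually.and ?_ (ae_all_iff.2 fun g => ?_)
  · refine (ae_map_iff measurable_walk.aemeasurable ?_).2 (ae_exists_tendsto_walk hf hC)
    exact measurableSet_exists_tendsto fun i => hm f i
  · refine (ae_map_iff measurable_walk.aemeasurable ?_).2 (ae_tendsto_sub_walk hf hC hμ g)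
    exact measurableSet_tendsto _ fun i => hm (fun y => f (y * g) - f y) i

theorem integral_pathMeasure {f : G → ℝ} (hf : IsHarmonic μ f) {C : ℝ} (hC : ∀ x, |f x| ≤ C)
    (i : ℕ) : ∫ τ, f (τ i) ∂(pathMeasure μ) = f 1 := by
  have hm : Measurable fun τ : ℕ → G => f (τ i) :=
    (Measurable.of_discrete (f := f)).comp (measurable_pi_apply i)
  rw [pathMeasure, integral_map measurable_walk.aemeasurable hm.aestronglyMeasurable]
  exact integral_harmonic_walk hf hC i

end RandomWalkLimits

/-! ### Stationary measures: atoms and existence on compact spaces -/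

section Stationary

variable {G M : Type*} [Group G] [Countable G] [MeasurableSpace G] [DiscreteMeasurableSpace G]
  [TopologicalSpace M] [MeasurableSpace M] [BorelSpace M] [MulAction G M] [ContinuousConstSMul G M]
  {μ : Measure G}

theorem measurableSet_preimage_smul (g : G) {S : Set M} (hS : MeasurableSet S) :
    MeasurableSet ((fun e => g • e) ⁻¹' S) :=
  (continuous_const_smul g).measurable hS

theorem translate_apply (g : G) (ν : ProbabilityMeasure M) {S : Set M} (hS : MeasurableSet S) :
    (translate g ν : Measure M) S = (ν : Measure M) ((fun e => g • e) ⁻¹' S) := by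
  rw [translate, ProbabilityMeasure.toMeasure_map,
    Measure.map_apply (continuous_const_smul g).measurable hS]

theorem sum_translate_apply (ν : ProbabilityMeasure M) {S : Set M} (hS : MeasurableSet S) :
    Measure.sum (fun g : G => μ {g} • (translate g ν : Measure M)) S
      = ∫⁻ g, (ν : Measure M) ((fun e => g • e) ⁻¹' S) ∂μ := by
  rw [Measure.sum_apply _ hS, lintegral_countable']
  refine tsum_congr fun g => ?_
  rw [Measure.smul_apply, translate_apply g ν hS, smul_eq_mul, mul_comm]

theorem isStationary_iff (ν : ProbabilityMeasure M) :
    IsStationary μ ν ↔ ∀ S : Set M, MeasurableSet S →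
      ∫⁻ g, (ν : Measure M) ((fun e => g • e) ⁻¹' S) ∂μ = (ν : Measure M) S := by
  constructor
  · intro h S hS
    rw [← sum_translate_apply ν hS, show Measure.sum _ = _ from h]
  · intro h
    refine Measure.ext fun S hS => ?_
    rw [sum_translate_apply ν hS, h S hS]

variable [IsProbabilityMeasure μ]

/-- The harmonic function `g ↦ (g · ν)(S)`. -/
noncomputable def hitting (ν : ProbabilityMeasure M) (S : Set M) (g : G) : ℝ :=
  (ν : Measure M).real ((fun e => g • e) ⁻¹' S)

theorem hitting_nonneg (ν : ProbabilityMeasure M) (S : Set M) (g : G) : 0 ≤ hitting ν S g :=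
  measureReal_nonneg

theorem hitting_le_one (ν : ProbabilityMeasure M) (S : Set M) (g : G) : hitting ν S g ≤ 1 :=
  measureReal_le_one

theorem abs_hitting_le_one (ν : ProbabilityMeasure M) (S : Set M) (g : G) : |hitting ν S g| ≤ 1 :=
  abs_le.2 ⟨by linarith [hitting_nonneg ν S g], hitting_le_one ν S g⟩

theorem hitting_one (ν : ProbabilityMeasure M) (S : Set M) :
    hitting ν S (1 : G) = (ν : Measure M).real S := by
  simp [hitting]

theorem hitting_mono (ν : ProbabilityMeasure M) {S T : Set M} (h : S ⊆ T) (g : G) :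
    hitting ν S g ≤ hitting ν T g :=
  measureReal_mono (Set.preimage_mono h)

theorem IsStationary.isHarmonic {ν : ProbabilityMeasure M} (h : IsStationary μ ν) {S : Set M}
    (hS : MeasurableSet S) : IsHarmonic μ (hitting (G := G) ν S) := by
  intro x
  have h1 := (isStationary_iff ν).1 h _ (measurableSet_preimage_smul x hS)
  have h2 : ∀ s : G, hitting ν S (x * s)
      = ((ν : Measure M) ((fun e => s • e) ⁻¹' ((fun e => x • e) ⁻¹' S))).toReal := fun s => by
    simp only [hitting, Measure.real, mul_smul]
    rfl
  simp only [h2]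
  rw [integral_toReal (Measurable.of_discrete).aemeasurable (ae_of_all _ fun _ => measure_lt_top _ _),
    h1]
  rfl

/-- A harmonic function which is maximal at `1` is constant on the support of `μ`. -/
theorem IsHarmonic.eq_of_forall_le {f : G → ℝ} (hf : IsHarmonic μ f) {C : ℝ} (hC : ∀ x, |f x| ≤ C)
    (hmax : ∀ g, f g ≤ f 1) {s : G} (hs : μ {s} ≠ 0) : f s = f 1 := by
  have hs0 : 0 < μ.real {s} := ENNReal.toReal_pos hs (measure_ne_top _ _)
  have hint : Integrable f μ :=
    Integrable.of_bound (Measurable.of_discrete).aestronglyMeasurable C (ae_of_all _ fun _ => hC _)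
  have h1 := mul_measure_le_integral (μ := μ) (F := fun g => f 1 - f g) (C := C + C)
    (fun g => sub_nonneg.2 (hmax g)) (fun g => (abs_sub _ _).trans (add_le_add (hC _) (hC _))) s
  have h2 := hf 1
  simp only [one_mul] at h2
  rw [integral_sub (integrable_const _) hint, integral_const, probReal_univ, one_smul, h2,
    sub_self] at h1
  exact le_antisymm (hmax s) (by nlinarith [hmax s])

/-- The atoms of maximal mass of a stationary measure form a finite invariant set. -/
theorem IsStationary.exists_finite_invariant [MeasurableSingletonClass M]
    {ν : ProbabilityMeasure M} (h : IsStationary μ ν) (hμ : IsNondegenerate μ) {D : Set M}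
    (hD : ∀ g : G, ∀ e ∈ D, g • e ∈ D) {x : M} (hx : x ∈ D) (hνx : (ν : Measure M) {x} ≠ 0) :
    -- `F` will be the set of points of `D` of largest mass; the mass is finite, so only finitely
    -- many points reach any positive level.
    ∃ F ⊆ D, F.Finite ∧ F.Nonempty ∧ ∀ g : G, ∀ e ∈ F, g • e ∈ F := by
  set w : M → ℝ := fun y => (ν : Measure M).real {y} with hw
  have hfin : ∀ ε : ℝ, 0 < ε → {y | ε ≤ w y}.Finite := fun ε hε => by
    have := Measure.finite_const_le_meas_of_disjoint_iUnion (ν : Measure M)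
      (ε := ENNReal.ofReal ε) (ENNReal.ofReal_pos.2 hε) (As := fun y : M => {y})
      (fun y => measurableSet_singleton y)
      (fun a b hab => Set.disjoint_singleton.2 hab) (measure_ne_top _ _)
    refine this.subset fun y hy => ?_
    exact ENNReal.ofReal_le_of_le_toReal hy
  have hx0 : 0 < w x := ENNReal.toReal_pos hνx (measure_ne_top _ _)
  obtain ⟨z, ⟨hzx, hzD⟩, hz⟩ := ((hfin (w x) hx0).inter_of_left D).exists_maximalFor w _
    ⟨x, le_refl (w x), hx⟩
  have hmax : ∀ y ∈ D, w y ≤ w z := fun y hy => by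
    by_contra! hlt
    exact absurd (hz ⟨hzx.trans hlt.le, hy⟩ hlt.le) (not_le.2 hlt)
  have hz0 : 0 < w z := hx0.trans_le hzx
  set F : Set M := {y | y ∈ D ∧ w y = w z} with hF
  have hFfin : F.Finite := (hfin (w z) hz0).subset fun y hy => hy.2.ge
  -- For `y` of maximal mass the harmonic function `g ↦ ν {g⁻¹ • y}` is maximal at 1, hence keeps
  -- this value on the support of `μ`.
  have hback : ∀ s : G, μ {s} ≠ 0 → ∀ y ∈ F, s⁻¹ • y ∈ F := fun s hs y hy => by
    have hh : ∀ g : G, hitting ν {y} g = w (g⁻¹ • y) := fun g => by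
      rw [hitting, hw]
      congr 1
      ext e
      simp [eq_inv_smul_iff]
    refine ⟨hD _ _ hy.1, ?_⟩
    rw [← hh, IsHarmonic.eq_of_forall_le (h.isHarmonic (measurableSet_singleton y))
      (abs_hitting_le_one ν _) (fun g => ?_) hs, hh, inv_one, one_smul, hy.2]
    rw [hh, hh, inv_one, one_smul, hy.2]
    exact hmax _ (hD _ _ hy.1)
  refine ⟨F, fun y hy => hy.1, hFfin, ⟨z, hzD, rfl⟩, fun g => ?_⟩
  have hg : g ∈ Subsemigroup.closure {g : G | μ {g} ≠ 0} := by
    rw [show Subsemigroup.closure {g : G | μ {g} ≠ 0} = ⊤ from hμ]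
    exact Subsemigroup.mem_top g
  induction hg using Subsemigroup.closure_induction with
  | mem s hs =>
    intro y hy
    -- An injective self-map of a finite set is onto, so invariance under `s⁻¹` gives invariance
    -- under `s`.
    have himg : (fun e => s⁻¹ • e) '' F = F :=
      Set.eq_of_subset_of_ncard_le (Set.image_subset_iff.2 fun e he => hback s hs e he)
        (Set.ncard_image_of_injective F (MulAction.injective s⁻¹)).ge hFfin
    rw [← himg] at hy
    obtain ⟨e, he, rfl⟩ := hy
    simpa using he
  | mul a b _ _ ha hb =>
    intro y hy
    rw [mul_smul]
    exact ha _ (hb _ hy)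

/-- The convolution `∑_g μ(g) g · ν`. -/
noncomputable def convolve (μ : Measure G) [IsProbabilityMeasure μ] (ν : ProbabilityMeasure M) :
    ProbabilityMeasure M :=
  ⟨Measure.sum fun g : G => μ {g} • (translate g ν : Measure M), ⟨by
    rw [sum_translate_apply ν MeasurableSet.univ]
    simp⟩⟩

theorem integral_convolve (ν : ProbabilityMeasure M) (f : BoundedContinuousFunction M ℝ) :
    ∫ y, f y ∂(convolve μ ν : Measure M) = ∫ y, ∫ g, f (g • y) ∂μ ∂(ν : Measure M) := by
  have hm : AEStronglyMeasurable f (convolve μ ν : Measure M) :=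
    f.continuous.measurable.aestronglyMeasurable
  have hint : Integrable f (convolve μ ν : Measure M) := f.integrable _
  have h1 : ∫ y, f y ∂(convolve μ ν : Measure M)
      = ∑' g : G, ∫ y, f y ∂(μ {g} • (translate g ν : Measure M)) := integral_sum_measure hint
  have hb : ∀ y, |f y| ≤ ‖f‖ := fun y => f.norm_coe_le_norm y
  have hmeas : Measurable (Function.uncurry fun (y : M) (g : G) => f (g • y)) :=
    measurable_from_prod_countable_left fun g =>
      (f.continuous.comp (continuous_const_smul g)).measurable
  rw [h1, integral_integral_swap, integral_countable]
  · refine tsum_congr fun g => ?_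
    rw [integral_smul_measure, translate, ProbabilityMeasure.toMeasure_map, integral_map
      (continuous_const_smul g).measurable.aemeasurable
      f.continuous.measurable.aestronglyMeasurable]
    rfl
  · refine Integrable.of_bound (Measurable.of_discrete).aestronglyMeasurable ‖f‖
      (ae_of_all _ fun g => ?_)
    have := norm_integral_le_of_norm_le_const (μ := (ν : Measure M)) (f := fun y => f (g • y))
      (ae_of_all _ fun y => hb _)
    simpa using this
  · exact Integrable.of_bound hmeas.aestronglyMeasurable ‖f‖ (ae_of_all _ fun p => hb _)

/-- The operator dual to the convolution with `μ`. -/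
noncomputable def averaging [FirstCountableTopology M] (μ : Measure G) [IsProbabilityMeasure μ]
    (f : BoundedContinuousFunction M ℝ) : BoundedContinuousFunction M ℝ :=
  BoundedContinuousFunction.ofNormedAddCommGroup (fun y => ∫ g, f (g • y) ∂μ)
    (continuous_of_dominated (bound := fun _ => ‖f‖)
      (fun _ => (Measurable.of_discrete).aestronglyMeasurable)
      (fun _ => ae_of_all _ fun _ => f.norm_coe_le_norm _) (integrable_const _)
      (ae_of_all _ fun g => f.continuous.comp (continuous_const_smul g)))
    ‖f‖ fun y => by
      have := norm_integral_le_of_norm_le_const (μ := μ) (f := fun g : G => f (g • y))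
        (ae_of_all _ fun g => f.norm_coe_le_norm _)
      simpa using this

theorem integral_averaging [FirstCountableTopology M] (ν : ProbabilityMeasure M)
    (f : BoundedContinuousFunction M ℝ) :
    ∫ y, averaging μ f y ∂(ν : Measure M) = ∫ y, f y ∂(convolve μ ν : Measure M) :=
  (integral_convolve ν f).symm

/-- The Cesàro means of the convolution powers applied to `ν`. -/
noncomputable def cesaro (μ : Measure G) [IsProbabilityMeasure μ] (ν : ProbabilityMeasure M)
    (n : ℕ) : ProbabilityMeasure M :=
  ⟨(n + 1 : NNReal)⁻¹ • ∑ i ∈ Finset.range (n + 1), ((convolve μ)^[i] ν : Measure M), ⟨by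
    rw [Measure.smul_apply, Measure.finsetSum_apply]
    simp only [measure_univ, Finset.sum_const, Finset.card_range, nsmul_eq_mul, mul_one]
    rw [ENNReal.smul_def, smul_eq_mul, ENNReal.coe_inv (by positivity)]
    push_cast
    exact ENNReal.inv_mul_cancel (by simp) (by simp)⟩⟩

theorem integral_cesaro (ν : ProbabilityMeasure M) (n : ℕ) (f : BoundedContinuousFunction M ℝ) :
    ∫ y, f y ∂(cesaro μ ν n : Measure M)
      = (n + 1 : ℝ)⁻¹ * ∑ i ∈ Finset.range (n + 1), ∫ y, f y ∂((convolve μ)^[i] ν : Measure M) := by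
  rw [cesaro, ProbabilityMeasure.coe_mk, integral_smul_nnreal_measure,
    integral_finsetSum_measure fun i _ => f.integrable _]
  rfl

/-- A group acting by homeomorphisms on a nonempty compact metrizable space has a stationary
measure. -/
theorem exists_isStationary [CompactSpace M] [T2Space M] [FirstCountableTopology M]
    [HasOuterApproxClosed M] [Nonempty M] (μ : Measure G) [IsProbabilityMeasure μ] :
    ∃ m : ProbabilityMeasure M, IsStationary μ m := by
  let ν : ProbabilityMeasure M := diracProba (Classical.arbitrary M)
  -- The probability measures form a compact space, so the Cesàro means converge along an
  -- ultrafilter; convolution changes the mean of index `n` by at most `2 ‖f‖ / (n + 1)` when tested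
  -- on `f`, by telescoping.
  obtain ⟨m, -, hm⟩ := isCompact_univ.ultrafilter_le_nhds
    ((hyperfilter ℕ : Ultrafilter ℕ).map (cesaro μ ν)) (by simp)
  have hlim : Tendsto (cesaro μ ν) (hyperfilter ℕ : Filter ℕ) (𝓝 m) := hm
  refine ⟨m, ?_⟩
  suffices H : convolve μ m = m from congrArg ProbabilityMeasure.toMeasure H
  refine ProbabilityMeasure.toMeasure_injective
    (ext_of_forall_integral_eq_of_IsFiniteMeasure fun f => ?_)
  rw [← integral_averaging]
  have h1 := ProbabilityMeasure.tendsto_iff_forall_integral_tendsto.1 hlim (averaging μ f)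
  have h2 := ProbabilityMeasure.tendsto_iff_forall_integral_tendsto.1 hlim f
  have h3 : Tendsto (fun n => ∫ y, averaging μ f y ∂(cesaro μ ν n : Measure M)
      - ∫ y, f y ∂(cesaro μ ν n : Measure M)) atTop (𝓝 0) := by
    have hb : Tendsto (fun n : ℕ => (2 * ‖f‖) * (1 / ((n : ℝ) + 1))) atTop (𝓝 0) := by
      simpa using tendsto_one_div_add_atTop_nhds_zero_nat.const_mul (2 * ‖f‖)
    refine squeeze_zero_norm (fun n => ?_) hb
    rw [integral_cesaro, integral_cesaro, ← mul_sub, ← Finset.sum_sub_distrib]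
    simp only [integral_averaging, ← Function.iterate_succ_apply' (convolve μ)]
    rw [Finset.sum_range_sub fun i => ∫ y, f y ∂((convolve μ)^[i] ν : Measure M), norm_mul,
      mul_comm, one_div]
    have hn : ∀ ν' : ProbabilityMeasure M, ‖∫ y, f y ∂(ν' : Measure M)‖ ≤ ‖f‖ := fun ν' => by
      have := norm_integral_le_of_norm_le_const (μ := (ν' : Measure M)) (f := f)
        (ae_of_all _ fun y => f.norm_coe_le_norm y)
      simpa using this
    have hpos : (0 : ℝ) ≤ ((n : ℝ) + 1)⁻¹ := by positivity
    rw [Real.norm_of_nonneg hpos]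
    refine mul_le_mul_of_nonneg_right ((norm_sub_le _ _).trans ?_) hpos
    linarith [hn ((convolve μ)^[n + 1] ν), hn ((convolve μ)^[0] ν)]
  have h4 := tendsto_nhds_unique (h1.sub h2) (h3.mono_left Nat.hyperfilter_le_atTop)
  exact sub_eq_zero.1 h4

end Stationary

/-! ### Shadows and powers of a hyperbolic element -/

namespace LengthFn

variable {G : Type*} [Group G] {l : LengthFn G ℤ} {q : G}

theorem Hyperbolic.le_len_pow (h : l.Hyperbolic q) (k : ℕ) : (k : ℤ) ≤ l.len (q ^ k) := by
  induction k with
  | zero => simpa using l.len_nonneg _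
  | succ k ih =>
    have := h.len_pow_lt k
    push_cast
    omega

theorem one_c (g : G) : l.c 1 g = 0 := by rw [l.comm, l.c_one]

theorem Hyperbolic.c_inv_pow_pow_le (h : l.Hyperbolic q) (i j : ℕ) :
    l.c (q⁻¹ ^ i) (q ^ j) ≤ l.c q⁻¹ q := by
  rcases i with _ | i
  · simpa [one_c] using l.nonneg _ _
  rcases j with _ | j
  · simpa [l.c_one] using l.nonneg _ _
  exact (h.c_inv_pow_pow i j).le

/-- Positive powers stay together up to the distance of the base point from the axis: by the change
of base point, the defect is the Gromov product of a positive and a negative power. -/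
theorem Hyperbolic.le_c_pow_pow (h : l.Hyperbolic q) {k j : ℕ} (hkj : k ≤ j) :
    l.len (q ^ k) - l.c q⁻¹ q ≤ l.c (q ^ k) (q ^ j) := by
  obtain ⟨m, rfl⟩ := Nat.exists_eq_add_of_le hkj
  have h1 := l.c_mul_mul (q ^ k) 1 (q ^ m)
  have h2 := h.c_inv_pow_pow_le k m
  rw [mul_one, ← pow_add, one_c, one_c, l.comm (q ^ m), ← inv_pow] at h1
  linarith

end LengthFn

section Shadows

variable {G M : Type*} [Group G] {l : LengthFn G ℤ} {p : M → G → ℤ}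

theorem IsPointFn.eq_c {y : G → ℤ} (hy : IsPointFn l y) {g h : G} (hlt : l.len h < y g) :
    y h = l.c g h := by
  have h1 := hy.ultra g h
  have h2 := hy.ultra' g h
  have h3 := hy.le_len h
  have h4 := l.c_le_right g h
  omega

theorem IsPointFn.map_one {y : G → ℤ} (hy : IsPointFn l y) : y 1 = 0 :=
  le_antisymm ((hy.le_len 1).trans l.len_one.le) (hy.nonneg 1)

/-- The points whose Gromov product with `g` is at least `k`. -/
def shadow (p : M → G → ℤ) (g : G) (k : ℤ) : Set M := {e | k ≤ p e g}

theorem shadow_anti (g : G) {k k' : ℤ} (h : k ≤ k') : shadow p g k' ⊆ shadow p g k :=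
  fun _ he => h.trans he

variable [TopologicalSpace M] [MulAction G M]

theorem IsEndSpace.isClopen_shadow (hp : IsEndSpace l p) (g : G) (k : ℤ) :
    IsClopen (shadow p g k) := by
  have hc : Continuous fun e => p e g := (continuous_apply g).comp hp.inducing.continuous
  exact (isClopen_discrete (Set.Ici k)).preimage hc

/-- Shadows of one level are balls of one radius in an ultrametric, so they are equal or disjoint.
-/
theorem IsEndSpace.shadow_eq (hp : IsEndSpace l p) {g h : G} {k : ℤ}
    (hne : (shadow p g k ∩ shadow p h k).Nonempty) : shadow p g k = shadow p h k := by
  obtain ⟨e, he, he'⟩ := hne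
  have hc : k ≤ l.c g h := (le_min he he').trans ((hp.isPointFn e).ultra' g h)
  ext x
  constructor
  · intro hx
    exact (le_min hx hc).trans ((hp.isPointFn x).ultra g h)
  · intro hx
    exact (le_min hx (hc.trans (l.comm g h).le)).trans ((hp.isPointFn x).ultra h g)

theorem IsEndSpace.exists_shadow_subset (hp : IsEndSpace l p) {U : Set M} (hU : IsOpen U) {ω : M}
    (hω : ω ∈ U) : ∃ R₀, ∀ R ≥ R₀, ∀ g, R ≤ p ω g → shadow p g R ⊆ U := by
  obtain ⟨V, hV, rfl⟩ := hp.inducing.isOpen_iff.1 hU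
  obtain ⟨H, u, hu, hsub⟩ := isOpen_pi_iff.1 hV (p ω) hω
  -- A basic neighbourhood constrains the products with finitely many `h`. The sum is a crude level
  -- above all their lengths, at which a shadow determines these products.
  refine ⟨∑ h ∈ H, l.len h + 1, fun R hR g hg e he => hsub fun h hh => ?_⟩
  have hlen : l.len h < R := by
    have := Finset.single_le_sum (f := l.len) (fun i _ => l.len_nonneg i) hh
    omega
  rw [(hp.isPointFn e).eq_c (hlen.trans_le he), ← (hp.isPointFn ω).eq_c (hlen.trans_le hg)]
  exact (hu h hh).2

/-- The products `l.c (g R) h` are constant for `R > l.len h`; their limits form an unbounded point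
function, which completeness realizes by an end. -/
theorem IsEndSpace.exists_of_coherent (hp : IsEndSpace l p) (g : ℤ → G)
    (hg : ∀ R R', R ≤ R' → R ≤ l.c (g R) (g R')) : ∃ ω, ∀ R, R ≤ p ω (g R) := by
  set y : G → ℤ := fun h => l.c (g (l.len h + 1)) h with hy
  have hstab : ∀ h R, l.len h + 1 ≤ R → l.c (g R) h = y h := fun h R hR => by
    refine l.c_eq_of_lt ?_
    have := l.c_le_right (g (l.len h + 1)) h
    have := hg _ _ hR
    omega
  have hpt : IsPointFn l y := by
    refine ⟨fun h => l.nonneg _ _, fun h => l.c_le_right _ _, fun h h' => ?_, fun h h' => ?_⟩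
    · have e1 := hstab h (max (l.len h + 1) (l.len h' + 1)) (le_max_left _ _)
      have e2 := hstab h' (max (l.len h + 1) (l.len h' + 1)) (le_max_right _ _)
      rw [← e1, ← e2]
      exact l.ultra _ _ _
    · have e1 := hstab h (max (l.len h + 1) (l.len h' + 1)) (le_max_left _ _)
      have e2 := hstab h' (max (l.len h + 1) (l.len h' + 1)) (le_max_right _ _)
      rw [← e1, ← e2, l.comm _ h]
      exact l.ultra _ _ _
  have hle : ∀ R, R ≤ y (g R) := fun R => by
    rw [← hstab (g R) (max R (l.len (g R) + 1)) (le_max_right _ _), l.comm]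
    exact hg _ _ (le_max_left _ _)
  obtain ⟨ω, hω⟩ := hp.complete y hpt fun k => ⟨g k, hle k⟩
  exact ⟨ω, fun R => hω ▸ hle R⟩

/-- At most one point of an end space is an accumulation point of the powers of `q`. -/
theorem IsEndSpace.subsingleton_unbounded_pow (hp : IsEndSpace l p) {q : G}
    (hq : l.Hyperbolic q) : {e | ∀ s : ℕ, ∃ k : ℕ, (s : ℤ) < p e (q ^ k)}.Subsingleton := by
  intro e he e' he'
  refine hp.injective (funext fun g => ?_)
  have hd := l.nonneg q⁻¹ q
  have hg := l.len_nonneg g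
  have key : ∀ x : M, (∀ s : ℕ, ∃ k : ℕ, (s : ℤ) < p x (q ^ k)) →
      ∃ k, ∀ j ≥ k, p x g = l.c (q ^ j) g := fun x hx => by
    obtain ⟨k, hk⟩ := hx (l.len g + l.c q⁻¹ q).toNat
    refine ⟨k, fun j hj => (hp.isPointFn x).eq_c ?_⟩
    have h1 := (hp.isPointFn x).ultra (q ^ k) (q ^ j)
    have h2 := hq.le_c_pow_pow hj
    have h3 := (hp.isPointFn x).le_len (q ^ k)
    omega
  obtain ⟨k, hk⟩ := key e he
  obtain ⟨k', hk'⟩ := key e' he'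
  rw [hk _ (le_max_left k k'), hk' _ (le_max_right k k')]

end Shadows

/-! ### Convergence to point masses -/

section Boundary

variable {G M : Type*} [Group G] [Countable G] [MeasurableSpace G] [DiscreteMeasurableSpace G]
  [TopologicalSpace M] [MeasurableSpace M] [BorelSpace M] [MulAction G M] [ContinuousConstSMul G M]
  {μ : Measure G} [IsProbabilityMeasure μ] {l : LengthFn G ℤ} {p : M → G → ℤ}
  {ν : ProbabilityMeasure M}

theorem IsEndSpace.measurableSet_shadow (hp : IsEndSpace l p) (g : G) (k : ℤ) :
    MeasurableSet (shadow p g k) := (hp.isClopen_shadow g k).isOpen.measurableSet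

/-- All points but at most one have bounded products with the powers of `q`, and that one point
carries no mass; the sets in question increase to the rest. -/
theorem IsEndSpace.exists_measure_bounded_pow (hp : IsEndSpace l p) {q : G} (hq : l.Hyperbolic q)
    (hν : ∀ x, (ν : Measure M) {x} = 0) {ε : ℝ} (hε : 0 < ε) :
    ∃ s : ℤ, 1 - ε ≤ (ν : Measure M).real {e | ∀ k : ℕ, p e (q ^ k) ≤ s} := by
  set B : ℕ → Set M := fun s => {e | ∀ k : ℕ, p e (q ^ k) ≤ s} with hB
  have hmono : Monotone B := fun s t hst e he k => (he k).trans (by exact_mod_cast hst)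
  have hcompl : (⋃ s, B s)ᶜ = {e | ∀ s : ℕ, ∃ k : ℕ, (s : ℤ) < p e (q ^ k)} := by
    ext e
    simp [hB]
  have hnull : (ν : Measure M) (⋃ s, B s)ᶜ = 0 := by
    rw [hcompl]
    rcases (hp.subsingleton_unbounded_pow hq).eq_empty_or_singleton with h | ⟨x, h⟩
    · rw [h, measure_empty]
    · rw [h, hν]
  have hone : (ν : Measure M) (⋃ s, B s) = 1 := by
    have hae : (⋃ s, B s) =ᵐ[(ν : Measure M)] Set.univ := by
      rwa [ae_eq_univ]
    rw [measure_congr hae, measure_univ]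
  have hlim := tendsto_measure_iUnion_atTop (μ := (ν : Measure M)) hmono
  rw [hone] at hlim
  have hlim' := (ENNReal.tendsto_toReal ENNReal.one_ne_top).comp hlim
  rw [ENNReal.toReal_one] at hlim'
  obtain ⟨s, hs⟩ := (hlim'.eventually (lt_mem_nhds (show 1 - ε < 1 by linarith))).exists
  exact ⟨s, hs.le⟩

/-- North-south dynamics with constants: a point whose products with the negative powers stay below
`s` is moved by `q ^ k` to within product `l.len (q ^ k) - s` of `q ^ k`. If `w⁻¹` leaves `q ^ k`
earlier, then `w` lowers this level by at most `l.c (q ^ k) w⁻¹`. -/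
theorem IsEndSpace.le_hitting_shadow (hp : IsEndSpace l p) {q : G} {δ : ℝ} {s : ℤ}
    (hs : δ ≤ (ν : Measure M).real {e | ∀ k : ℕ, p e (q⁻¹ ^ k) ≤ s}) (k : ℕ) (w : G)
    (hlt : l.c (q ^ k) w⁻¹ < l.len (q ^ k) - s) :
    δ ≤ hitting ν (shadow p (w * q ^ k) (l.len (q ^ k) - s - l.c (q ^ k) w⁻¹)) (w * q ^ k) := by
  refine hs.trans (measureReal_mono fun e he => ?_)
  have h1 := hp.smul (q ^ k • e) w (q ^ k)
  have h2 := hp.smul e (q ^ k) 1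
  have h3 := he k
  have h4 := (hp.isPointFn (q ^ k • e)).ultra' (q ^ k) w⁻¹
  have h5 := l.c_le_right (q ^ k) w⁻¹
  rw [mul_one, LengthFn.one_c, (hp.isPointFn e).map_one] at h2
  rw [inv_pow] at h3
  rw [l.len_inv] at h5
  change _ ≤ p ((w * q ^ k) • e) (w * q ^ k)
  rw [mul_smul]
  omega

/-- Two group elements such that, in front of one of them, translation by any group element
concentrates a non-atomic measure in a small shadow. -/
theorem IsEndSpace.exists_concentrating (hp : IsEndSpace l p) {h : G} (hh : l.Hyperbolic h)
    (hν : ∀ x, (ν : Measure M) {x} = 0) {ε : ℝ} (hε : 0 < ε) (R : ℤ) :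
    ∃ a b : G, ∀ w : G, ∃ f : G, 1 - ε ≤ hitting ν (shadow p f R) (w * a) ∨
      1 - ε ≤ hitting ν (shadow p f R) (w * b) := by
  obtain ⟨s, hs⟩ := hp.exists_measure_bounded_pow hh.inv hν hε
  obtain ⟨t, ht⟩ := hp.exists_measure_bounded_pow (q := h⁻¹⁻¹) hh.inv.inv hν hε
  set k : ℕ := (|R| + |s| + |t| + l.c h⁻¹ h + 1).toNat with hk
  have hd := l.nonneg h⁻¹ h
  have hlen := hh.le_len_pow k
  have hlen' := hh.inv.le_len_pow k
  have hd' := hh.c_inv_pow_pow_le k k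
  have hR := le_abs_self R
  have hs' := le_abs_self s
  have ht' := le_abs_self t
  have hR0 := abs_nonneg R
  have hs0 := abs_nonneg s
  have ht0 := abs_nonneg t
  refine ⟨h ^ k, h⁻¹ ^ k, fun w => ?_⟩
  -- The two powers separate by `l.c h⁻¹ h`, so `w⁻¹` cannot follow both of them longer; the one it
  -- leaves early concentrates the measure. The exponent `k` makes the length exceed this bound plus
  -- `R` and the relevant one of `s`, `t`.
  have hmin := l.ultra (h⁻¹ ^ k) w⁻¹ (h ^ k)
  rw [l.comm w⁻¹] at hmin
  rcases min_le_iff.1 (hmin.trans hd') with hw | hw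
  · refine ⟨w * h⁻¹ ^ k, Or.inr ((hp.le_hitting_shadow ht k w (by omega)).trans
      (hitting_mono _ (shadow_anti _ ?_) _))⟩
    omega
  · refine ⟨w * h ^ k, Or.inl ((hp.le_hitting_shadow hs k w (by omega)).trans
      (hitting_mono _ (shadow_anti _ ?_) _))⟩
    omega

theorem inter_nonempty_of_hitting {S T : Set M} (hT : MeasurableSet T) {g : G}
    (h : 1 < hitting ν S g + hitting ν T g) : (S ∩ T).Nonempty := by
  by_contra hne
  have hdisj : Disjoint ((fun e => g • e) ⁻¹' S) ((fun e => g • e) ⁻¹' T) :=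
    (Set.disjoint_iff_inter_eq_empty.2 (Set.not_nonempty_iff_eq_empty.1 hne)).preimage _
  have := measureReal_union (μ := (ν : Measure M)) hdisj (measurableSet_preimage_smul g hT)
  rw [hitting, hitting, ← this] at h
  exact absurd measureReal_le_one (not_le.2 h)

/-- A finite union of shadows of level `R`. -/
def shadows (p : M → G → ℤ) (s : Finset G) (R : ℤ) : Set M := ⋃ γ ∈ s, shadow p γ R

theorem IsEndSpace.measurableSet_shadows (hp : IsEndSpace l p) (s : Finset G) (R : ℤ) :
    MeasurableSet (shadows p s R) :=
  s.measurableSet_biUnion fun γ _ => hp.measurableSet_shadow γ R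

/-- If the measures `τ i · ν` stabilize on shadows and are asymptotically invariant and tight, then
they concentrate in a single shadow of each level. -/
theorem IsEndSpace.exists_tendsto_one (hp : IsEndSpace l p) {h : G} (hh : l.Hyperbolic h)
    (hν : ∀ x, (ν : Measure M) {x} = 0) {τ : ℕ → G} {R : ℤ}
    (h1 : ∀ g, ∃ c, Tendsto (fun i => hitting ν (shadow p g R) (τ i)) atTop (𝓝 c))
    (h2 : ∀ s a, Tendsto (fun i => hitting ν (shadows p s R) (τ i * a)
      - hitting ν (shadows p s R) (τ i)) atTop (𝓝 0))
    (h3 : ∃ s, ∃ᶠ i in atTop, 7 / 8 < hitting ν (shadows p s R) (τ i)) :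
    ∃ g, Tendsto (fun i => hitting ν (shadow p g R) (τ i)) atTop (𝓝 1) := by
  obtain ⟨s, hs⟩ := h3
  choose c hc using h1
  by_contra! hne
  have hc1 : ∀ γ, c γ < 1 := fun γ =>
    lt_of_le_of_ne (le_of_tendsto' (hc γ) fun i => hitting_le_one _ _ _) fun h =>
      hne γ (h ▸ hc γ)
  -- If no shadow has limit mass 1, a gap of `3 * δ` is available on the finitely many shadows
  -- indexed by `s`. The bound 1/8 makes a shadow of mass at least `1 - δ` meet their union, of mass
  -- above `7 / 8 - δ`; it then equals one of them, whose translated mass is below `1 - 2 * δ`.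
  obtain ⟨δ, hδ, hδ0, hδ1⟩ : ∃ δ : ℝ, (∀ γ ∈ s, c γ < 1 - 3 * δ) ∧ 0 < δ ∧ δ < 1 / 8 := by
    have e1 : ∀ᶠ δ : ℝ in 𝓝[>] 0, ∀ γ ∈ s, c γ < 1 - 3 * δ := by
      refine (Finset.eventually_all s).2 fun γ _ => ?_
      have : Tendsto (fun δ : ℝ => 1 - 3 * δ) (𝓝[>] 0) (𝓝 (1 - 3 * 0)) :=
        ((continuous_const.sub (continuous_const.mul continuous_id)).tendsto 0).mono_left
          nhdsWithin_le_nhds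
      exact this.eventually (lt_mem_nhds (by simpa using hc1 γ))
    have e2 : ∀ᶠ δ : ℝ in 𝓝[>] 0, δ ∈ Set.Ioo (0 : ℝ) (1 / 8) :=
      Ioo_mem_nhdsGT (by norm_num)
    obtain ⟨δ, hd⟩ := (e1.and e2).exists
    exact ⟨δ, hd.1, hd.2⟩
  obtain ⟨a, b, hab⟩ := hp.exists_concentrating hh hν hδ0 R
  have hsing : ∀ γ, shadows p {γ} R = shadow p γ R := fun γ => by simp [shadows]
  have near : ∀ x : G, ∀ t : Finset G, ∀ᶠ i in atTop,
      |hitting ν (shadows p t R) (τ i * x) - hitting ν (shadows p t R) (τ i)| < δ := fun x t => by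
    have := (h2 t x).abs
    rw [abs_zero] at this
    exact this.eventually (gt_mem_nhds hδ0)
  have hev : ∀ᶠ i in atTop, ∀ x ∈ ({a, b} : Set G),
      |hitting ν (shadows p s R) (τ i * x) - hitting ν (shadows p s R) (τ i)| < δ ∧
      ∀ γ ∈ s, |hitting ν (shadow p γ R) (τ i * x) - hitting ν (shadow p γ R) (τ i)| < δ ∧
        hitting ν (shadow p γ R) (τ i) < 1 - 3 * δ := by
    refine ((Set.toFinite {a, b}).eventually_all).2 fun x _ => (near x s).and
      ((Finset.eventually_all s).2 fun γ hγ => ?_)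
    refine Filter.Eventually.and ?_ ((hc γ).eventually (gt_mem_nhds (hδ γ hγ)))
    simpa only [hsing] using near x {γ}
  obtain ⟨i, hi, hev⟩ := (hs.and_eventually hev).exists
  have final : ∀ x ∈ ({a, b} : Set G), ∀ f, ¬ 1 - δ ≤ hitting ν (shadow p f R) (τ i * x) := by
    intro x hx f hf
    obtain ⟨hU, hγ⟩ := hev x hx
    have hU' := (abs_lt.1 hU).1
    obtain ⟨e, he, he'⟩ := inter_nonempty_of_hitting (ν := ν) (hp.measurableSet_shadows s R)
      (S := shadow p f R) (T := shadows p s R) (g := τ i * x) (by linarith)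
    simp only [shadows, Set.mem_iUnion] at he'
    obtain ⟨γ, hγs, heγ⟩ := he'
    rw [hp.shadow_eq ⟨e, he, heγ⟩] at hf
    obtain ⟨h5, h6⟩ := hγ γ hγs
    linarith [(abs_lt.1 h5).2]
  obtain ⟨f, hf | hf⟩ := hab (τ i)
  · exact final a (by simp) f hf
  · exact final b (by simp) f hf

/-- Every end lies in some shadow of level `R` and there are countably many shadows, so finite
unions exhaust the measure. This replaces compactness. -/
theorem IsEndSpace.exists_shadows_gt (hp : IsEndSpace l p) (ν : ProbabilityMeasure M) (R : ℤ)
    {ε : ℝ} (hε : 0 < ε) : ∃ s, 1 - ε < (ν : Measure M).real (shadows p s R) := by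
  have hmono : Monotone fun s : Finset G => shadows p s R := fun s t hst =>
    Set.biUnion_subset_biUnion_left hst
  have hun : (⋃ s, shadows p s R) = Set.univ := by
    refine Set.eq_univ_of_forall fun e => ?_
    obtain ⟨g, hg⟩ := hp.unbounded e R
    exact Set.mem_iUnion.2 ⟨{g}, by simpa [shadows, shadow] using hg⟩
  have hlim := tendsto_measure_iUnion_atTop (μ := (ν : Measure M)) hmono
  rw [hun, measure_univ] at hlim
  have hlim' := (ENNReal.tendsto_toReal ENNReal.one_ne_top).comp hlim
  rw [ENNReal.toReal_one] at hlim'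
  exact (hlim'.eventually (lt_mem_nhds (show 1 - ε < 1 by linarith))).exists

theorem IsEndSpace.ae_frequently (hp : IsEndSpace l p) (hst : IsStationary μ ν) (R : ℤ) :
    ∀ᵐ τ ∂(pathMeasure μ), ∃ s, ∃ᶠ i in atTop, 7 / 8 < hitting ν (shadows p s R) (τ i) := by
  have := isProbabilityMeasure_pathMeasure μ
  set F : Finset G → ℕ → (ℕ → G) → ENNReal := fun s i τ =>
    ENNReal.ofReal (1 - hitting ν (shadows p s R) (τ i)) with hF
  have hFm : ∀ s i, Measurable (F s i) := fun s i =>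
    (Measurable.of_discrete (f := fun g : G =>
      ENNReal.ofReal (1 - hitting ν (shadows p s R) g))).comp (measurable_pi_apply i)
  have hint : ∀ s i, ∫⁻ τ, F s i τ ∂(pathMeasure μ)
      = ENNReal.ofReal (1 - (ν : Measure M).real (shadows p s R)) := fun s i => by
    have hm : Measurable fun τ : ℕ → G => hitting ν (shadows p s R) (τ i) :=
      (Measurable.of_discrete (f := hitting ν (shadows p s R))).comp (measurable_pi_apply i)
    have hi : Integrable (fun τ : ℕ → G => hitting ν (shadows p s R) (τ i)) (pathMeasure μ) :=
      Integrable.of_bound hm.aestronglyMeasurable 1 (ae_of_all _ fun τ => abs_hitting_le_one _ _ _)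
    have hi' : Integrable (fun τ : ℕ → G => 1 - hitting ν (shadows p s R) (τ i)) (pathMeasure μ) :=
      (integrable_const _).sub hi
    rw [hF, ← ofReal_integral_eq_lintegral_ofReal hi'
      (ae_of_all _ fun τ => sub_nonneg.2 (hitting_le_one _ _ _)),
      integral_sub (integrable_const _) hi, integral_pathMeasure
      (hst.isHarmonic (hp.measurableSet_shadows s R)) (abs_hitting_le_one ν _), hitting_one]
    simp
  -- By harmonicity the expected mass outside `shadows p s R` does not depend on the time and is
  -- small for suitable `s`; Fatou's lemma bounds the expected lower limit by it.
  have hzero : ∫⁻ τ, ⨅ s, liminf (fun i => F s i τ) atTop ∂(pathMeasure μ) = 0 := by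
    refine le_antisymm (ENNReal.le_of_forall_pos_le_add fun ε hε _ => ?_) zero_le
    obtain ⟨s, hs⟩ := hp.exists_shadows_gt ν R (ε := (ε : ℝ)) (by exact_mod_cast hε)
    calc ∫⁻ τ, ⨅ s, liminf (fun i => F s i τ) atTop ∂(pathMeasure μ)
        ≤ ∫⁻ τ, liminf (fun i => F s i τ) atTop ∂(pathMeasure μ) :=
          lintegral_mono fun τ => iInf_le _ s
      _ ≤ liminf (fun i => ∫⁻ τ, F s i τ ∂(pathMeasure μ)) atTop := lintegral_liminf_le (hFm s)
      _ = ENNReal.ofReal (1 - (ν : Measure M).real (shadows p s R)) := by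
          simp only [hint, liminf_const]
      _ ≤ ENNReal.ofReal ε := ENNReal.ofReal_le_ofReal (by linarith)
      _ = 0 + ε := by simp
  rw [lintegral_eq_zero_iff (Measurable.iInf fun s => Measurable.liminf (hFm s))] at hzero
  filter_upwards [hzero] with τ hτ
  have hlt : ⨅ s, liminf (fun i => F s i τ) atTop < ENNReal.ofReal (1 / 8) := by
    rw [show (⨅ s, liminf (fun i => F s i τ) atTop) = 0 from hτ]
    exact ENNReal.ofReal_pos.2 (by norm_num)
  obtain ⟨s, hs⟩ := iInf_lt_iff.1 hlt
  refine ⟨s, (frequently_lt_of_liminf_lt (by isBoundedDefault) hs).mono fun i hi => ?_⟩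
  have := (ENNReal.ofReal_lt_ofReal_iff (by norm_num)).1 hi
  linarith

/-- Almost surely the translates of a non-atomic stationary measure along the random walk converge
to a point mass. -/
theorem IsEndSpace.isMuBoundary (hp : IsEndSpace l p) {h : G} (hh : l.Hyperbolic h)
    (hμ : IsNondegenerate μ) (hst : IsStationary μ ν) (hν : ∀ x, (ν : Measure M) {x} = 0) :
    IsMuBoundary μ ν := by
  refine ⟨hst, ?_⟩
  have hharm : ∀ (s : Finset G) (R : ℤ), ∀ᵐ τ ∂(pathMeasure μ),
      (∃ c, Tendsto (fun i => hitting ν (shadows p s R) (τ i)) atTop (𝓝 c)) ∧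
        ∀ a, Tendsto (fun i => hitting ν (shadows p s R) (τ i * a)
          - hitting ν (shadows p s R) (τ i)) atTop (𝓝 0) := fun s R =>
    ae_pathMeasure_tendsto (hst.isHarmonic (hp.measurableSet_shadows s R))
      (abs_hitting_le_one ν _) hμ
  have hsing : ∀ γ R, shadows p {γ} R = shadow p γ R := fun γ R => by simp [shadows]
  filter_upwards [ae_all_iff.2 fun s => ae_all_iff.2 (hharm s),
    ae_all_iff.2 fun R => hp.ae_frequently hst R] with τ hτ hτ'
  have hone : ∀ R, ∃ g, Tendsto (fun i => hitting ν (shadow p g R) (τ i)) atTop (𝓝 1) := fun R =>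
    hp.exists_tendsto_one hh hν (fun g => by simpa only [hsing] using (hτ {g} R).1)
      (fun s a => (hτ s R).2 a) (hτ' R)
  choose g hg using hone
  -- Two shadows whose masses both tend to 1 must intersect, so the chosen elements are coherent and
  -- define the limit end.
  obtain ⟨ω, hω⟩ := hp.exists_of_coherent g fun R R' hRR' => by
    have hsum := (hg R).add (hg R')
    obtain ⟨i, hi⟩ := (hsum.eventually (lt_mem_nhds (show (1 : ℝ) < 1 + 1 by norm_num))).exists
    obtain ⟨e, he, he'⟩ := inter_nonempty_of_hitting (hp.measurableSet_shadow _ _) hi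
    exact (le_min he (hRR'.trans he')).trans ((hp.isPointFn e).ultra' _ _)
  refine ⟨ω, tendsto_of_forall_isOpen_le_liminf' fun U hU => ?_⟩
  by_cases hωU : ω ∈ U
  · obtain ⟨R, hR⟩ := hp.exists_shadow_subset hU hωU
    have hsub := hR R le_rfl (g R) (hω R)
    have hlim : Tendsto (fun i => (translate (τ i) ν : Measure M) (shadow p (g R) R)) atTop
        (𝓝 1) := by
      have := ENNReal.tendsto_ofReal (hg R)
      rw [ENNReal.ofReal_one] at this
      refine this.congr fun i => ?_
      rw [translate_apply _ _ (hp.measurableSet_shadow _ _), hitting, ofReal_measureReal]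
    calc (diracProba ω : Measure M) U ≤ 1 := prob_le_one
      _ = liminf (fun i => (translate (τ i) ν : Measure M) (shadow p (g R) R)) atTop :=
          hlim.liminf_eq.symm
      _ ≤ liminf (fun i => (translate (τ i) ν : Measure M) U) atTop :=
          liminf_le_liminf (Eventually.of_forall fun i => measure_mono hsub)
  · rw [diracProba_toMeasure_apply' _ hU.measurableSet, Set.indicator_of_notMem hωU]
    exact zero_le

end Boundary

/-! ### Uniqueness by averaging two stationary measures -/

section Uniqueness

variable {G M : Type*} [Group G] [Countable G] [MeasurableSpace G] [DiscreteMeasurableSpace G]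
  [TopologicalSpace M] [MeasurableSpace M] [BorelSpace M] [MulAction G M] [ContinuousConstSMul G M]
  {μ : Measure G} [IsProbabilityMeasure μ] {ν ν' : ProbabilityMeasure M}

/-- The arithmetic mean of two probability measures. -/
noncomputable def midpointMeasure (ν ν' : ProbabilityMeasure M) : ProbabilityMeasure M :=
  ⟨(2 : ENNReal)⁻¹ • ((ν : Measure M) + ν'), ⟨by
    rw [Measure.smul_apply, Measure.add_apply, measure_univ, measure_univ, one_add_one_eq_two,
      smul_eq_mul, ENNReal.inv_mul_cancel (by simp) (by simp)]⟩⟩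

theorem midpointMeasure_apply (S : Set M) : (midpointMeasure ν ν' : Measure M) S
    = 2⁻¹ * ((ν : Measure M) S + (ν' : Measure M) S) := rfl

theorem hitting_midpointMeasure (S : Set M) (g : G) :
    hitting (midpointMeasure ν ν') S g = (hitting ν S g + hitting ν' S g) / 2 := by
  rw [hitting, Measure.real, midpointMeasure_apply, ENNReal.toReal_mul,
    ENNReal.toReal_add (measure_ne_top _ _) (measure_ne_top _ _), ENNReal.toReal_inv,
    ENNReal.toReal_ofNat]
  simp only [hitting, Measure.real]
  ring

theorem IsStationary.midpointMeasure (h : IsStationary μ ν) (h' : IsStationary μ ν') :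
    IsStationary μ (midpointMeasure ν ν') := by
  rw [isStationary_iff] at *
  intro S hS
  simp only [midpointMeasure_apply]
  rw [lintegral_const_mul _ Measurable.of_discrete, lintegral_add_left Measurable.of_discrete,
    h S hS, h' S hS]

/-- Stationary measures whose arithmetic mean is a boundary measure agree on clopen sets. -/
theorem IsMuBoundary.eq_of_isClopen [HasOuterApproxClosed M] (h : IsStationary μ ν)
    (h' : IsStationary μ ν') (hθ : IsMuBoundary μ (ZnFree.midpointMeasure ν ν')) {S : Set M}
    (hS : IsClopen S) : (ν : Measure M).real S = (ν' : Measure M).real S := by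
  have := isProbabilityMeasure_pathMeasure μ
  have hSm : MeasurableSet S := hS.isOpen.measurableSet
  have hdiff : ∀ᵐ τ ∂(pathMeasure μ),
      Tendsto (fun i => hitting ν S (τ i) - hitting ν' S (τ i)) atTop (𝓝 0) := by
    filter_upwards [hθ.2] with τ hτ
    obtain ⟨ω, hω⟩ := hτ
    have h1 := ProbabilityMeasure.tendsto_measure_of_isClopen_of_tendsto hω hS
    have h2 : Tendsto (fun i => hitting (ZnFree.midpointMeasure ν ν') S (τ i)) atTop
        (𝓝 ((diracProba ω : Measure M).real S)) := by
      refine (NNReal.tendsto_coe.2 h1).congr fun i => ?_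
      rw [hitting, Measure.real, ← translate_apply _ _ hSm]
      rfl
    -- The mean tends to 0 or to 1 on a clopen set; in either case both measures are squeezed to the
    -- same limit.
    have hb : ∀ i, |hitting ν S (τ i) - hitting ν' S (τ i)|
        ≤ 2 * hitting (ZnFree.midpointMeasure ν ν') S (τ i) ∧
        |hitting ν S (τ i) - hitting ν' S (τ i)|
        ≤ 2 * (1 - hitting (ZnFree.midpointMeasure ν ν') S (τ i)) := fun i => by
      rw [hitting_midpointMeasure, abs_le, abs_le]
      have := hitting_nonneg ν S (τ i)
      have := hitting_nonneg ν' S (τ i)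
      have := hitting_le_one ν S (τ i)
      have := hitting_le_one ν' S (τ i)
      refine ⟨⟨?_, ?_⟩, ?_, ?_⟩ <;> linarith
    rw [Measure.real, diracProba_toMeasure_apply' _ hSm] at h2
    by_cases hωS : ω ∈ S
    · rw [Set.indicator_of_mem hωS, Pi.one_apply, ENNReal.toReal_one] at h2
      exact squeeze_zero_norm (fun i => (hb i).2) (by
        simpa using (tendsto_const_nhds (x := (1 : ℝ)).sub h2).const_mul 2)
    · rw [Set.indicator_of_notMem hωS, ENNReal.toReal_zero] at h2
      exact squeeze_zero_norm (fun i => (hb i).1) (by simpa using h2.const_mul 2)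
  have hm : ∀ (θ : ProbabilityMeasure M) i,
      Measurable fun τ : ℕ → G => hitting θ S (τ i) := fun θ i =>
    (Measurable.of_discrete (f := hitting θ S)).comp (measurable_pi_apply i)
  have hint : ∀ (θ : ProbabilityMeasure M) i,
      Integrable (fun τ : ℕ → G => hitting θ S (τ i)) (pathMeasure μ) := fun θ i =>
    Integrable.of_bound (hm θ i).aestronglyMeasurable 1 (ae_of_all _ fun τ => abs_hitting_le_one _ _ _)
  have hlim := tendsto_integral_of_dominated_convergence (fun _ => (2 : ℝ))
    (fun i => ((hm ν i).sub (hm ν' i)).aestronglyMeasurable) (integrable_const _)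
    (fun i => ae_of_all _ fun τ => (abs_sub _ _).trans
      ((add_le_add (abs_hitting_le_one ν S (τ i)) (abs_hitting_le_one ν' S (τ i))).trans
        (by norm_num))) hdiff
  -- The expected difference is the same at every time and tends to 0 by dominated convergence.
  have hconst : ∀ i, ∫ τ, (hitting ν S (τ i) - hitting ν' S (τ i)) ∂(pathMeasure μ)
      = (ν : Measure M).real S - (ν' : Measure M).real S := fun i => by
    rw [integral_sub (hint ν i) (hint ν' i), integral_pathMeasure (h.isHarmonic hSm)
      (abs_hitting_le_one ν S), integral_pathMeasure (h'.isHarmonic hSm)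
      (abs_hitting_le_one ν' S), hitting_one, hitting_one]
  simp only [Pi.sub_apply, hconst, integral_zero] at hlim
  exact sub_eq_zero.1 (tendsto_nhds_unique tendsto_const_nhds hlim)

end Uniqueness

/-! ### The compact bordification of the group -/

section PointFunctions

variable {G : Type*} [Group G] (l : LengthFn G ℤ)

/-- The action of `G` on the functions `y : G → ℤ` which extends the action on `f ↦ l.c f`. -/
def moveFn (g : G) (y : G → ℤ) (h : G) : ℤ :=
  y (g⁻¹ * h) + l.len g - y g⁻¹ - l.c (g⁻¹ * h) g⁻¹

theorem moveFn_mul (g k : G) (y : G → ℤ) : moveFn l (g * k) y = moveFn l g (moveFn l k y) := by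
  funext h
  have h1 := l.c_mul_mul k⁻¹ (g⁻¹ * h) g⁻¹
  have h2 := l.c_mul_mul k⁻¹ (g⁻¹ * h) 1
  have h3 := l.c_mul_mul k⁻¹ g⁻¹ 1
  have h4 := l.c_mul_mul k⁻¹ g⁻¹ g⁻¹
  have h5 : l.len (g * k) = l.c (k⁻¹ * g⁻¹) (k⁻¹ * g⁻¹) := by
    rw [← mul_inv_rev, l.c_self, l.len_inv]
  have h6 : l.c g⁻¹ g⁻¹ = l.len g := l.len_inv g
  simp only [moveFn, mul_inv_rev, mul_assoc, mul_one, inv_inv, l.c_one, LengthFn.one_c,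
    l.len_inv] at *
  omega

theorem moveFn_c (g f : G) : moveFn l g (l.c f) = l.c (g * f) := by
  funext h
  have h1 := l.c_mul_mul g f (g⁻¹ * h)
  rw [mul_inv_cancel_left] at h1
  rw [moveFn, h1]

theorem continuous_moveFn (g : G) : Continuous (moveFn l g) := by
  refine continuous_pi fun h => ?_
  have ha : ∀ g : G, Continuous fun y : G → ℤ => y g := continuous_apply
  exact (((ha _).add continuous_const).sub (ha _)).sub continuous_const

theorem isPointFn_c (f : G) : IsPointFn l (l.c f) where
  nonneg g := l.nonneg f g
  le_len g := l.c_le_right f g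
  ultra g h := l.ultra f g h
  ultra' g h := by
    rw [l.comm f g]
    exact l.ultra g f h

theorem isClosed_isPointFn : IsClosed {y : G → ℤ | IsPointFn l y} := by
  have e : {y : G → ℤ | IsPointFn l y} = (⋂ g, {y | 0 ≤ y g}) ∩ (⋂ g, {y | y g ≤ l.len g}) ∩
      (⋂ g, ⋂ h, {y | min (y g) (l.c g h) ≤ y h}) ∩
      (⋂ g, ⋂ h, {y | min (y g) (y h) ≤ l.c g h}) := by
    ext y
    simp only [Set.mem_inter_iff, Set.mem_iInter, Set.mem_ofPred_eq]
    exact ⟨fun h => ⟨⟨⟨h.1, h.2⟩, h.3⟩, h.4⟩, fun h => ⟨h.1.1.1, h.1.1.2, h.1.2, h.2⟩⟩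
  rw [e]
  have ha : ∀ g : G, Continuous fun y : G → ℤ => y g := continuous_apply
  refine ((IsClosed.inter ?_ ?_).inter ?_).inter ?_
  · exact isClosed_iInter fun g => isClosed_le continuous_const (ha g)
  · exact isClosed_iInter fun g => isClosed_le (ha g) continuous_const
  · exact isClosed_iInter fun g => isClosed_iInter fun h =>
      isClosed_le ((ha g).min continuous_const) (ha h)
  · exact isClosed_iInter fun g => isClosed_iInter fun h =>
      isClosed_le ((ha g).min (ha h)) continuous_const

/-- The closure of `G` in the space of Gromov product functions. -/
def Bordification : Type _ := {y : G → ℤ // y ∈ closure (Set.range l.c)}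

variable {l}

/-- The Gromov product function of a point of the bordification. -/
def Bordification.val (y : Bordification l) : G → ℤ := Subtype.val y

theorem Bordification.isPointFn (y : Bordification l) : IsPointFn l y.val :=
  closure_minimal (Set.range_subset_iff.2 (isPointFn_c l)) (isClosed_isPointFn l) y.2

instance : TopologicalSpace (Bordification l) := instTopologicalSpaceSubtype

instance : MeasurableSpace (Bordification l) := Subtype.instMeasurableSpace

theorem Bordification.isEmbedding_val :
    IsEmbedding (Bordification.val (l := l)) := IsEmbedding.subtypeVal

theorem Bordification.continuous_val :
    Continuous (Bordification.val (l := l)) := continuous_subtype_val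

instance : T2Space (Bordification l) := Bordification.isEmbedding_val.t2Space

instance : Nonempty (Bordification l) := ⟨⟨l.c 1, subset_closure ⟨1, rfl⟩⟩⟩

/-- Point functions take values in the finite intervals from 0 to `l.len g`, so Tychonoff's theorem
applies. -/
instance : CompactSpace (Bordification l) := by
  refine isCompact_iff_compactSpace.1 (?_ : IsCompact (closure (Set.range l.c)))
  have hK : IsCompact (Set.pi Set.univ fun g : G => Set.Icc 0 (l.len g)) :=
    isCompact_univ_pi fun g => (Set.finite_Icc _ _).isCompact
  refine hK.of_isClosed_subset isClosed_closure fun y hy g _ => ?_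
  have := Bordification.isPointFn ⟨y, hy⟩
  exact ⟨this.nonneg g, this.le_len g⟩

instance : MulAction G (Bordification l) where
  smul g y := ⟨moveFn l g y.val, map_mem_closure (continuous_moveFn l g) y.2 (by
    rintro _ ⟨f, rfl⟩
    exact ⟨g * f, (moveFn_c l g f).symm⟩)⟩
  one_smul y := Subtype.ext (funext fun h => by
    change moveFn l 1 y.val h = y.val h
    rw [moveFn, inv_one, one_mul, l.len_one, y.isPointFn.map_one, l.c_one]
    ring)
  mul_smul g k y := Subtype.ext (moveFn_mul l g k y.val)

theorem Bordification.smul_val (g : G) (y : Bordification l) : (g • y).val = moveFn l g y.val := rfl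

instance : ContinuousConstSMul G (Bordification l) where
  continuous_const_smul g := Bordification.isEmbedding_val.continuous_iff.2
    ((continuous_moveFn l g).comp Bordification.continuous_val)

theorem Bordification.smul_apply_self (g : G) (y : Bordification l) :
    (g • y).val g = l.len g - y.val g⁻¹ := by
  rw [Bordification.smul_val, moveFn, inv_mul_cancel, y.isPointFn.map_one, LengthFn.one_c]
  ring

/-- A bounded point function attains its maximum at some `h` and describes the point at distance `y
h` on the segment towards `h`. Hence there are only countably many. -/
theorem IsPointFn.exists_eq_min {y : G → ℤ} (hy : IsPointFn l y) {K : ℤ} (hK : ∀ g, y g ≤ K) :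
    ∃ q : ℤ × G, (fun g => min q.1 (l.c q.2 g)) = y := by
  obtain ⟨m, ⟨h, rfl⟩, hmax⟩ := Int.exists_greatest_of_bdd (P := fun m => ∃ h, y h = m)
    ⟨K, by rintro _ ⟨h, rfl⟩; exact hK h⟩ ⟨_, 1, rfl⟩
  refine ⟨(y h, h), funext fun g => le_antisymm (hy.ultra h g) ?_⟩
  have hle := hmax _ ⟨g, rfl⟩
  exact le_min hle ((le_min hle le_rfl).trans (hy.ultra' h g))

variable (l) in
/-- The points of the bordification at finite distance from the base point. -/
def Bordification.bounded : Set (Bordification l) := {y | ∃ K, ∀ g, y.val g ≤ K}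

theorem Bordification.smul_mem_bounded (g : G) {y : Bordification l}
    (hy : y ∈ Bordification.bounded l) : g • y ∈ Bordification.bounded l := by
  obtain ⟨K, hK⟩ := hy
  refine ⟨K + l.len g, fun h => ?_⟩
  rw [Bordification.smul_val, moveFn]
  have := hK (g⁻¹ * h)
  have := y.isPointFn.nonneg g⁻¹
  have := l.nonneg (g⁻¹ * h) g⁻¹
  omega

theorem Bordification.countable_bounded [Countable G] : (Bordification.bounded l).Countable := by
  refine Set.countable_of_injective_of_countable_image (f := Bordification.val)
    Subtype.val_injective.injOn ((Set.countable_range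
      fun (q : ℤ × G) (g : G) => min q.1 (l.c q.2 g)).mono ?_)
  rintro _ ⟨y, ⟨K, hK⟩, rfl⟩
  exact y.isPointFn.exists_eq_min hK

/-- A group with a hyperbolic element has no finite orbits at finite distance. -/
theorem Bordification.eq_empty_of_finite_invariant {h : G} (hh : l.Hyperbolic h)
    {F : Set (Bordification l)} (hF : F.Finite) (hsub : F ⊆ Bordification.bounded l)
    (hinv : ∀ g : G, ∀ e ∈ F, g • e ∈ F) : F = ∅ := by
  by_contra hne
  obtain ⟨y, hy⟩ := Set.nonempty_iff_ne_empty.2 hne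
  obtain ⟨K, hK⟩ : ∃ K : ℤ, ∀ e ∈ F, ∀ g, e.val g ≤ K := by
    have : ∀ᶠ K : ℤ in atTop, ∀ e ∈ F, ∀ g, e.val g ≤ K := by
      refine (hF.eventually_all).2 fun e he => ?_
      obtain ⟨K, hK⟩ := hsub he
      exact (eventually_ge_atTop K).mono fun K' hK' g => (hK g).trans hK'
    exact this.exists
  -- For `f = h ^ (2K + 1)` the value of `f • y` at `f` is `l.len f - y.val f⁻¹`. Both values are at
  -- most `K`, but the length is at least `2K + 1`.
  have h1 := hh.le_len_pow (K + K + 1).toNat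
  have h2 := Bordification.smul_apply_self (h ^ (K + K + 1).toNat) y
  have h3 := hK _ (hinv (h ^ (K + K + 1).toNat) y hy) (h ^ (K + K + 1).toNat)
  have h4 := hK y hy (h ^ (K + K + 1).toNat)⁻¹
  omega

end PointFunctions

/-! ### Transfer to the ends: existence and regularity -/

section Existence

variable {G M : Type*} [Group G] [Countable G]
  [TopologicalSpace M] [MulAction G M] {l : LengthFn G ℤ} {p : M → G → ℤ}

instance : BorelSpace (Bordification l) := Subtype.borelSpace _

instance : SecondCountableTopology (Bordification l) :=
  Bordification.isEmbedding_val.secondCountableTopology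

namespace IsEndSpace

theorem isEmbedding (hp : IsEndSpace l p) : IsEmbedding p := ⟨hp.inducing, hp.injective⟩

theorem secondCountableTopology (hp : IsEndSpace l p) : SecondCountableTopology M :=
  hp.isEmbedding.secondCountableTopology

theorem t3Space (hp : IsEndSpace l p) : T3Space M := by
  have := hp.isEmbedding.t0Space
  have := hp.inducing.regularSpace
  infer_instance

/-- This exhibits the ends as a Borel subset of ℤ^G, so that Borel measures can be transported along
`p`. -/
theorem range_eq (hp : IsEndSpace l p) :
    Set.range p = {y | IsPointFn l y} ∩ ⋂ k : ℤ, ⋃ g, {y | k ≤ y g} := by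
  ext y
  constructor
  · rintro ⟨e, rfl⟩
    exact ⟨hp.isPointFn e, Set.mem_iInter.2 fun k => Set.mem_iUnion.2 (hp.unbounded e k)⟩
  · rintro ⟨hy, hu⟩
    exact hp.complete y hy fun k => Set.mem_iUnion.1 (Set.mem_iInter.1 hu k)

theorem measurableSet_range (hp : IsEndSpace l p) : MeasurableSet (Set.range p) := by
  rw [hp.range_eq]
  refine (isClosed_isPointFn l).measurableSet.inter (MeasurableSet.iInter fun k =>
    MeasurableSet.iUnion fun g => ?_)
  exact measurableSet_le measurable_const (measurable_pi_apply g)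

variable [MeasurableSpace M] [BorelSpace M]

theorem measurableEmbedding (hp : IsEndSpace l p) : MeasurableEmbedding p :=
  hp.isEmbedding.measurableEmbedding hp.measurableSet_range

theorem moveFn_apply (hp : IsEndSpace l p) (g : G) (e : M) : moveFn l g (p e) = p (g • e) := by
  funext h
  have := hp.smul e g (g⁻¹ * h)
  rw [mul_inv_cancel_left] at this
  rw [this, moveFn]

theorem continuousConstSMul (hp : IsEndSpace l p) : ContinuousConstSMul G M where
  continuous_const_smul g := by
    refine hp.inducing.continuous_iff.2 ?_
    have : (p ∘ fun e => g • e) = moveFn l g ∘ p := funext fun e => (hp.moveFn_apply g e).symm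
    rw [this]
    exact (continuous_moveFn l g).comp hp.inducing.continuous

theorem isTopologicalBasis_isClopen (hp : IsEndSpace l p) :
    TopologicalSpace.IsTopologicalBasis {S : Set M | IsClopen S} := by
  refine TopologicalSpace.isTopologicalBasis_of_isOpen_of_nhds (fun S hS => hS.isOpen)
    fun ω U hω hU => ?_
  obtain ⟨R, hR⟩ := hp.exists_shadow_subset hU hω
  obtain ⟨g, hg⟩ := hp.unbounded ω R
  exact ⟨shadow p g R, hp.isClopen_shadow g R, hg, hR R le_rfl g hg⟩

theorem ext_of_isClopen (hp : IsEndSpace l p) {ν ν' : ProbabilityMeasure M}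
    (h : ∀ S : Set M, IsClopen S → (ν : Measure M).real S = (ν' : Measure M).real S) : ν = ν' := by
  have := hp.secondCountableTopology
  refine ProbabilityMeasure.toMeasure_injective
    (ext_of_generate_finite {S : Set M | IsClopen S} ?_ ?_ ?_ (by simp))
  · rw [BorelSpace.measurable_eq (α := M), hp.isTopologicalBasis_isClopen.borel_eq_generateFrom]
  · exact fun S hS T hT _ => IsClopen.inter hS hT
  · exact fun S hS => (measureReal_eq_measureReal_iff (measure_ne_top _ _) (measure_ne_top _ _)).1
      (h S hS)

/-- Since `G` is countable, ℤ^G is Polish and finite measures on it are inner regular for compact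
sets; compact subsets of the range of `p` pull back to compact sets. -/
theorem regular (hp : IsEndSpace l p) (ν : Measure M) [IsFiniteMeasure ν] : ν.Regular := by
  have := hp.t3Space
  have hE := hp.measurableEmbedding
  have hwrt : (ν.map p).InnerRegularWRT (fun s => IsCompact s ∧ IsClosed s) MeasurableSet :=
    innerRegular_isCompact_isClosed_measurableSet_of_finite _
  have hinner := hwrt.comap (pa := IsCompact) (qa := MeasurableSet) hE
    (fun U hU => hE.measurableSet_image.2 hU)
    (fun K hK hc => hp.inducing.isCompact_preimage' hc.1 hK)
  rw [hE.comap_map] at hinner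
  have : ν.InnerRegular := ⟨hinner⟩
  infer_instance

variable [MeasurableSpace G] [DiscreteMeasurableSpace G] [ContinuousConstSMul G M]
  {μ : Measure G} [IsProbabilityMeasure μ]

theorem exists_isStationary (hp : IsEndSpace l p) {h : G} (hh : l.Hyperbolic h)
    (hμ : IsNondegenerate μ) : ∃ ν : ProbabilityMeasure M, IsStationary μ ν := by
  obtain ⟨m, hm⟩ := ZnFree.exists_isStationary (M := Bordification l) μ
  have hval : MeasurableEmbedding (Bordification.val (l := l)) :=
    Bordification.isEmbedding_val.measurableEmbedding (by
      rw [show Set.range (Bordification.val (l := l)) = closure (Set.range l.c) from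
        Subtype.range_coe]
      exact isClosed_closure.measurableSet)
  -- A bounded point of positive mass would produce a finite invariant set of bounded points, which
  -- a hyperbolic element excludes. As the bounded points are countable, they form a null set, and
  -- unbounded point functions come from ends.
  have hatom : ∀ y ∈ Bordification.bounded l, (m : Measure (Bordification l)) {y} = 0 := by
    intro y hy
    by_contra hne
    obtain ⟨F, hsub, hfin, hnon, hinv⟩ := hm.exists_finite_invariant hμ
      (fun g _ => Bordification.smul_mem_bounded g) hy hne
    exact hnon.ne_empty (Bordification.eq_empty_of_finite_invariant hh hfin hsub hinv)
  have hbdd : (m : Measure (Bordification l)) (Bordification.bounded l) = 0 :=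
    (measure_null_iff_singleton Bordification.countable_bounded).2 hatom
  have hrange : ∀ᵐ y ∂(m : Measure (Bordification l)), y.val ∈ Set.range p := by
    filter_upwards [measure_eq_zero_iff_ae_notMem.1 hbdd] with y hy
    refine hp.complete y.val y.isPointFn fun k => ?_
    by_contra! hk
    exact hy ⟨k, fun g => (hk g).le⟩
  set m' : Measure (G → ℤ) := (m : Measure (Bordification l)).map Bordification.val with hm'
  have happ : ∀ S : Set M, m'.comap p S
      = (m : Measure (Bordification l)) (Bordification.val ⁻¹' (p '' S)) := fun S => by
    rw [hp.measurableEmbedding.comap_apply, hm', hval.map_apply]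
  have hprob : IsProbabilityMeasure (m'.comap p) := ⟨by
    rw [happ, Set.image_univ]
    exact (prob_compl_eq_zero_iff (hval.measurable hp.measurableSet_range)).1 hrange⟩
  refine ⟨⟨m'.comap p, hprob⟩, (isStationary_iff _).2 fun S hS => ?_⟩
  simp only [ProbabilityMeasure.coe_mk, happ]
  rw [← (isStationary_iff m).1 hm _
    (hval.measurable (hp.measurableEmbedding.measurableSet_image.2 hS))]
  refine lintegral_congr fun g => congrArg _ ?_
  ext y
  simp only [Set.mem_preimage, Bordification.smul_val]
  constructor
  · rintro ⟨e, he, hey⟩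
    exact ⟨g • e, he, by rw [← hp.moveFn_apply, hey]⟩
  · rintro ⟨e, he, hey⟩
    refine ⟨g⁻¹ • e, by simpa using he, ?_⟩
    rw [← hp.moveFn_apply, hey, ← Bordification.smul_val, ← Bordification.smul_val,
      inv_smul_smul]

/-- Existence, uniqueness and boundary property of the stationary measure on an end space. -/
theorem exists_stationary_unique_boundary (hp : IsEndSpace l p) {h : G} (hh : l.Hyperbolic h)
    (hfix : ∀ F : Set M, F.Finite → F.Nonempty → ¬ ∀ g : G, ∀ e ∈ F, g • e ∈ F)
    (hμ : IsNondegenerate μ) : ∃ ν : ProbabilityMeasure M, IsStationary μ ν ∧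
      (∀ ν' : ProbabilityMeasure M, IsStationary μ ν' → ν' = ν) ∧
      (ν : Measure M).Regular ∧ (∀ x : M, (ν : Measure M) {x} = 0) ∧ IsMuBoundary μ ν := by
  have := hp.t3Space
  have := hp.secondCountableTopology
  have hatom : ∀ ν : ProbabilityMeasure M, IsStationary μ ν → ∀ x, (ν : Measure M) {x} = 0 := by
    intro ν hν x
    by_contra hne
    obtain ⟨F, -, hfin, hnon, hinv⟩ := hν.exists_finite_invariant hμ
      (fun _ _ _ => Set.mem_univ _) (Set.mem_univ x) hne
    exact hfix F hfin hnon hinv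
  obtain ⟨ν, hν⟩ := hp.exists_isStationary hh hμ
  refine ⟨ν, hν, fun ν' hν' => hp.ext_of_isClopen fun S hS => ?_, hp.regular _, hatom ν hν,
    hp.isMuBoundary hh hμ hν (hatom ν hν)⟩
  -- The mean is itself stationary, hence without atoms and a boundary measure.
  have hθ := hν'.midpointMeasure hν
  exact IsMuBoundary.eq_of_isClopen hν' hν (hp.isMuBoundary hh hμ hθ (hatom _ hθ)) hS

end IsEndSpace

end Existence

/-! ### Conclusion -/

theorem countable_of_fg (G : Type*) [Group G] [Group.FG G] : Countable G := by
  obtain ⟨α, _, f, hf⟩ := Group.fg_iff_exists_freeGroup_hom_surjective_finite.1 ‹Group.FG G›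
  have : Countable (FreeGroup α) := Quot.mk_surjective.countable
  exact hf.countable

end ZnFree

theorem mainTheorem4 {n : ℕ} [NeZero n] {X G : Type*} [Group G] [Group.FG G]
    [MeasurableSpace G] [DiscreteMeasurableSpace G]
    (φ : ZnFree.WordEmbedding n X G) (hirr : φ.Irreducible) (hab : ∃ a b : G, a * b ≠ b * a)
    (μ : Measure G) [IsProbabilityMeasure μ] (hμ : ZnFree.IsNondegenerate μ) :
    ∃ _ : ContinuousConstSMul G φ.NEnd, ∃ ν : ProbabilityMeasure φ.NEnd,
      ZnFree.IsStationary μ ν ∧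
      (∀ ν' : ProbabilityMeasure φ.NEnd, ZnFree.IsStationary μ ν' → ν' = ν) ∧
      (ν : Measure φ.NEnd).Regular ∧
      (∀ x : φ.NEnd, (ν : Measure φ.NEnd) {x} = 0) ∧
      ZnFree.IsMuBoundary μ ν := by
  have := ZnFree.countable_of_fg G
  obtain ⟨h, hh⟩ := φ.exists_hyperbolic hirr
  obtain ⟨a, b, hab⟩ := hab
  have := φ.isEndSpace.continuousConstSMul
  exact ⟨this, φ.isEndSpace.exists_stationary_unique_boundary hh
    (fun F hF hne hinv => hab (φ.mul_comm_of_finite_invariant hF hne hinv a b)) hμ⟩
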